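/- Let $d\ge 2$ be an integer and $\eta=e^{2\pi i/d}$. Let $\mathrm{HMF}^{\mathrm{gr}}_{\mathrm{bi}}$ be the following category. Its objects are the $\mathbb C$-graded matrix bifactorizations of $x^d-y^d$: $\mathbb Z_2$-graded free $\mathbb C[x,y]$-modules $M=M_0\oplus M_1$ (of possibly infinite rank, regarded as $\mathbb C[x]$-bimodules with $x$ acting from the left and $y$ from the right), with a $\mathbb C$-grading compatible with the module structure, where $x$ and $y$ have degree $\frac2d$, and with a $\mathbb C[x,y]$-linear map $\mathrm d:M\to M$ of $\mathbb Z_2$-degree $1$ and $\mathbb C$-degree $1$ such that $\mathrm d\circ\mathrm d=(x^d-y^d)\,\mathrm{id}_M$. Its morphisms are the $\mathbb C[x,y]$-linear maps of $\mathbb Z_2$-degree $0$ and $\mathbb C$-degree $0$ commuting with $\mathrm d$, modulo the maps $\mathrm d\circ h+h\circ \mathrm d$ with $h$ linear of $\mathbb Z_2$-degree $1$ and $\mathbb C$-degree $-1$. The tensor product $M\otimes N$ is taken over $\mathbb C[x]$ (right action on $M$, left action on $N$), with differential $\mathrm d(m\otimes n)=\mathrm d m\otimes n+(-1)^{|m|}m\otimes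 \mathrm d n$ for $m\in M_{|m|}$, and with additive $\mathbb C$-degree. For $a\in\mathbb Z_d$ and $\lambda\in\{0,\dots,d-2\}$ put $S=\{a,a+1,\dots,a+\lambda\}\subset\mathbb Z_d$, and let $\hat P_{a:\lambda}$ be the graded matrix bifactorization with $M_0=M_1=\mathbb C[x,y]$ as modules, where $1\in M_0$ has degree $-\frac{\lambda}{d}$ and $1\in M_1$ has degree $\frac{\lambda+2}{d}-1$, and where $\mathrm d:M_1\to M_0$ is multiplication by $\prod_{j\in S}(x-\eta^j y)$ and $\mathrm d:M_0\to M_1$ is multiplication by $\prod_{j\in\mathbb Z_d\setminus S}(x-\eta^j y)$. Let $\mathcal{PT}^{\mathrm{gr}}_d$ be the full subcategory of $\mathrm{HMF}^{\mathrm{gr}}_{\mathrm{bi}}$ of objects isomorphic to finite direct sums of objects $\hat P_{a:\lambda}$, $a\in\mathbb Z_d$, $\lambda\in\{0,\dots,d-2\}$. **Theorem.** The category $\mathcal{PT}^{\mathrm{gr}}_d$ is semisimple (abelian, with every object a finite direct sum of simple objects). The $\hat P_{a:\lambda}$ are simple, with $\mathrm{End}(\hat P_{a:\lambda})=\mathbb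 C\,\mathrm{id}$, and every simple object is isomorphic to $\hat P_{a:\lambda}$ for exactly one pair $(a,\lambda)\in\mathbb Z_d\times\{0,\dots,d-2\}$. The category $\mathcal{PT}^{\mathrm{gr}}_d$ is closed under tensor products, and for all $m,n\in\mathbb Z_d$ and $\lambda,\mu\in\{0,\dots,d-2\}$ one has, in $\mathrm{HMF}^{\mathrm{gr}}_{\mathrm{bi}}$, $$\hat P_{m:\lambda}\otimes\hat P_{n:\mu}\;\simeq\;\bigoplus_{\substack{\nu=|\lambda-\mu|\\ \text{step }2}}^{\min(\lambda+\mu,\;2d-4-\lambda-\mu)}\hat P_{m+n+\frac12(\lambda+\mu-\nu):\nu}.$$ -/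

import Mathlib

open CategoryTheory CategoryTheory.Limits
open scoped TensorProduct

namespace LG

/-! ### The polynomial ring of bimodules and its grading -/

/-- `ℂ[x, y]`, with `x = X 0` and `y = X 1`.  A `ℂ[x]`-`ℂ[x]`-bimodule is a left `ℂ[x, y]`-module:
the left action of `p` is multiplication by `p(x)`, the right action multiplication by `p(y)`. -/
abbrev Bi : Type := MvPolynomial (Fin 2) ℂ

/-- Both variables have `ℂ`-degree `2 / d`. -/
noncomputable def wt (d : ℕ) : Fin 2 → ℂ := fun _ => 2 / d

/-- The element `x ^ d - y ^ d` of `ℂ[x, y]`. -/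
noncomputable def potential (d : ℕ) : Bi := MvPolynomial.X 0 ^ d - MvPolynomial.X 1 ^ d

/-- A family of submodules is an internal direct sum decomposition as soon as it spans and there is
a linear map separating its members. -/
lemma isInternal_of_split {V : Type} [AddCommGroup V] [Module ℂ V] (gr : ℂ → Submodule ℂ V)
    (Φ : V →ₗ[ℂ] (ℂ →₀ V)) (h : ∀ q, ∀ v ∈ gr q, Φ v = Finsupp.single q v)
    (htop : iSup gr = ⊤) : DirectSum.IsInternal gr := by
  have key : ∀ (x : DirectSum ℂ fun q => gr q) (q : ℂ),
      Φ (DirectSum.coeAddMonoidHom gr x) q = x q := by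
    intro x q
    induction x using DirectSum.induction_on with
    | zero => simp
    | of i v =>
      rw [DirectSum.coeAddMonoidHom_of, h i v v.2, DirectSum.coe_of_apply, Finsupp.single_apply]
      split_ifs <;> rfl
    | add x y hx hy => simp [hx, hy]
  constructor
  · intro x y hxy
    apply DFinsupp.ext
    intro q
    apply Subtype.ext
    have := key x q
    rw [hxy, key y q] at this
    exact this.symm
  · intro v
    have hv : v ∈ iSup gr := htop ▸ Submodule.mem_top
    rw [Submodule.iSup_eq_range_dfinsupp_lsum] at hv
    obtain ⟨x, hx⟩ := hv
    exact ⟨x, hx⟩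

/-- The isomorphism of a graded vector space with the direct sum of its homogeneous pieces. -/
noncomputable def splitEquiv {V : Type} [AddCommGroup V] [Module ℂ V] {gr : ℂ → Submodule ℂ V}
    (h : DirectSum.IsInternal gr) : (DirectSum ℂ fun q => gr q) ≃ₗ[ℂ] V :=
  have h' : Function.Bijective (DirectSum.coeLinearMap gr) := h
  LinearEquiv.ofBijective (DirectSum.coeLinearMap gr) h'

lemma splitEquiv_apply {V : Type} [AddCommGroup V] [Module ℂ V] {gr : ℂ → Submodule ℂ V}
    (h : DirectSum.IsInternal gr) (x : DirectSum ℂ fun q => gr q) :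
    splitEquiv h x = DirectSum.coeLinearMap gr x := rfl

/-- The linear map that splits a vector into its homogeneous components. -/
noncomputable def split {V : Type} [AddCommGroup V] [Module ℂ V] {gr : ℂ → Submodule ℂ V}
    (h : DirectSum.IsInternal gr) : V →ₗ[ℂ] (ℂ →₀ V) :=
  (DirectSum.toModule ℂ ℂ (ℂ →₀ V) fun q => Finsupp.lsingle q ∘ₗ (gr q).subtype) ∘ₗ
    (splitEquiv h).symm.toLinearMap

lemma split_apply {V : Type} [AddCommGroup V] [Module ℂ V] {gr : ℂ → Submodule ℂ V}
    (h : DirectSum.IsInternal gr) {q : ℂ} {v : V} (hv : v ∈ gr q) :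
    split h v = Finsupp.single q v := by
  have : (splitEquiv h).symm v =
      DirectSum.lof ℂ ℂ (fun q => gr q) q ⟨v, hv⟩ := by
    rw [LinearEquiv.symm_apply_eq, splitEquiv_apply]
    simp
  simp [split, this]

/-- An additive map between `ℂ[x, y]`-modules is linear if it commutes with constants, `x`, `y`. -/
lemma map_smul_of_gens {V V' : Type} [AddCommGroup V] [AddCommGroup V'] [Module Bi V] [Module Bi V']
    (f : V →+ V') (hC : ∀ (c : ℂ) v, f ((MvPolynomial.C c : Bi) • v) = (MvPolynomial.C c : Bi) • f v)
    (hX : ∀ i v, f ((MvPolynomial.X i : Bi) • v) = (MvPolynomial.X i : Bi) • f v)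
    (s : Bi) (v : V) : f (s • v) = s • f v := by
  induction s using MvPolynomial.induction_on generalizing v with
  | C c => exact hC c v
  | add p q hp hq => simp [add_smul, hp, hq]
  | mul_X p i hp => rw [mul_smul, hp, hX, mul_smul]

/-! ### The tensor product of bimodules -/

section Tensor

/-- `M` as a `ℂ[t]`-module through the right action, `t` acting by `y`. -/
def RightRes (M : Type) : Type := M

/-- `N` as a `ℂ[t]`-module through the left action, `t` acting by `x`. -/
def LeftRes (N : Type) : Type := N

instance (M : Type) [h : AddCommGroup M] : AddCommGroup (RightRes M) := h
instance (M : Type) [h : AddCommGroup M] : AddCommGroup (LeftRes M) := h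

noncomputable instance (M : Type) [AddCommGroup M] [Module Bi M] :
    Module (Polynomial ℂ) (RightRes M) :=
  letI I : Module (Polynomial ℂ) M := Module.compHom M
    (Polynomial.aeval (MvPolynomial.X 1 : Bi) : Polynomial ℂ →ₐ[ℂ] Bi).toRingHom
  I

noncomputable instance (N : Type) [AddCommGroup N] [Module Bi N] :
    Module (Polynomial ℂ) (LeftRes N) :=
  letI I : Module (Polynomial ℂ) N := Module.compHom N
    (Polynomial.aeval (MvPolynomial.X 0 : Bi) : Polynomial ℂ →ₐ[ℂ] Bi).toRingHom
  I

/-- The tensor product `M ⊗_{ℂ[t]} N` of bimodules, over the right action on `M` and the left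
action on `N`. -/
def BiTensor (M N : Type) [AddCommGroup M] [AddCommGroup N] [Module Bi M] [Module Bi N] : Type :=
  RightRes M ⊗[Polynomial ℂ] LeftRes N

variable {M N M' N' M'' N'' : Type} [AddCommGroup M] [AddCommGroup N] [Module Bi M] [Module Bi N]
  [AddCommGroup M'] [AddCommGroup N'] [Module Bi M'] [Module Bi N']
  [AddCommGroup M''] [AddCommGroup N''] [Module Bi M''] [Module Bi N'']

noncomputable instance : AddCommGroup (BiTensor M N) :=
  inferInstanceAs (AddCommGroup (RightRes M ⊗[Polynomial ℂ] LeftRes N))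

/-- The vector space structure. -/
noncomputable instance : Module ℂ (BiTensor M N) :=
  letI I : Module ℂ (RightRes M ⊗[Polynomial ℂ] LeftRes N) :=
    Module.compHom (RightRes M ⊗[Polynomial ℂ] LeftRes N) Polynomial.C
  I

/-- The pure tensor `m ⊗ n`. -/
noncomputable def tmk (m : M) (n : N) : BiTensor M N :=
  TensorProduct.tmul (Polynomial ℂ) (M := RightRes M) (N := LeftRes N) m n

lemma tmk_add_left (m m' : M) (n : N) : tmk (m + m') n = tmk m n + tmk m' n :=
  TensorProduct.add_tmul _ _ _

lemma tmk_add_right (m : M) (n n' : N) : tmk m (n + n') = tmk m n + tmk m n' :=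
  TensorProduct.tmul_add _ _ _

lemma zero_tmk (n : N) : tmk (0 : M) n = 0 :=
  TensorProduct.zero_tmul (R := Polynomial ℂ) (RightRes M) (N := LeftRes N) n

lemma tmk_zero (m : M) : tmk m (0 : N) = 0 :=
  TensorProduct.tmul_zero (R := Polynomial ℂ) (M := RightRes M) (LeftRes N) m

lemma tmk_balance (p : Polynomial ℂ) (m : M) (n : N) :
    tmk (Polynomial.aeval (MvPolynomial.X 1 : Bi) p • m) n =
      tmk m (Polynomial.aeval (MvPolynomial.X 0 : Bi) p • n) :=
  TensorProduct.smul_tmul (R := Polynomial ℂ) (M := RightRes M) (N := LeftRes N) p m n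

lemma tmk_X (m : M) (n : N) :
    tmk ((MvPolynomial.X 1 : Bi) • m) n = tmk m ((MvPolynomial.X 0 : Bi) • n) := by
  simpa using tmk_balance Polynomial.X m n

lemma tmk_C (c : ℂ) (m : M) (n : N) :
    tmk ((MvPolynomial.C c : Bi) • m) n = tmk m ((MvPolynomial.C c : Bi) • n) := by
  simpa [MvPolynomial.algebraMap_eq] using tmk_balance (Polynomial.C c) m n

lemma smulC_tmk (c : ℂ) (m : M) (n : N) :
    c • tmk m n = tmk ((MvPolynomial.C c : Bi) • m) n := by
  have : c • tmk m n = tmk (Polynomial.aeval (MvPolynomial.X 1 : Bi) (Polynomial.C c) • m) n := rfl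
  simpa [MvPolynomial.algebraMap_eq] using this

lemma tensor_induction {P : BiTensor M N → Prop} (h0 : P 0) (h1 : ∀ m n, P (tmk m n))
    (h2 : ∀ s t, P s → P t → P (s + t)) (t : BiTensor M N) : P t :=
  TensorProduct.induction_on (motive := P) t h0 h1 h2

/-- The universal property: balanced biadditive maps descend to the tensor product. -/
noncomputable def tlift {V : Type} [AddCommGroup V] (f : M →+ N →+ V)
    (hX : ∀ m n, f ((MvPolynomial.X 1 : Bi) • m) n = f m ((MvPolynomial.X 0 : Bi) • n))
    (hC : ∀ (c : ℂ) m n, f ((MvPolynomial.C c : Bi) • m) n = f m ((MvPolynomial.C c : Bi) • n)) :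
    BiTensor M N →+ V :=
  TensorProduct.liftAddHom (R := Polynomial ℂ) (M := RightRes M) (N := LeftRes N) f (by
    intro p m n
    revert m n
    suffices key : ∀ (m : M) (n : N), f (Polynomial.aeval (MvPolynomial.X 1 : Bi) p • m) n =
        f m (Polynomial.aeval (MvPolynomial.X 0 : Bi) p • n) from key
    intro m n
    induction p using Polynomial.induction_on generalizing m n with
    | C c => simpa [MvPolynomial.algebraMap_eq] using hC c m n
    | add p q hp hq => simp [add_smul, hp, hq]
    | monomial k c h =>
      rw [pow_succ, ← mul_assoc, map_mul _ _ Polynomial.X, map_mul _ _ Polynomial.X,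
        Polynomial.aeval_X, Polynomial.aeval_X, mul_smul, h, hX, ← mul_smul, mul_comm, mul_smul])

@[simp] lemma tlift_tmk {V : Type} [AddCommGroup V] (f : M →+ N →+ V) (hX hC) (m : M) (n : N) :
    tlift f hX hC (tmk m n) = f m n := rfl

lemma tensor_hom_ext {V : Type} [AddCommGroup V] {f g : BiTensor M N →+ V}
    (h : ∀ m n, f (tmk m n) = g (tmk m n)) : f = g := by
  ext t
  induction t using tensor_induction with
  | h0 => simp
  | h1 m n => exact h m n
  | h2 s t hs ht => simp [hs, ht]

/-- The pure tensor as a biadditive map. -/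
noncomputable def tmkHom : M →+ N →+ BiTensor M N :=
  AddMonoidHom.mk' (fun m => AddMonoidHom.mk' (fun n => tmk m n) (tmk_add_right m))
    (fun m m' => by ext n; exact tmk_add_left m m' n)

@[simp] lemma tmkHom_apply (m : M) (n : N) : tmkHom m n = tmk m n := rfl

/-- `f ⊗ g` on additive groups, for bimodule maps `f` and `g`. -/
noncomputable def tmapAdd (f : M →ₗ[Bi] M') (g : N →ₗ[Bi] N') : BiTensor M N →+ BiTensor M' N' :=
  tlift ((tmkHom.compl₂ g.toAddMonoidHom).comp f.toAddMonoidHom)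
    (by intro m n; simp [tmk_X]) (by intro c m n; simp [tmk_C])

@[simp] lemma tmapAdd_tmk (f : M →ₗ[Bi] M') (g : N →ₗ[Bi] N') (m : M) (n : N) :
    tmapAdd f g (tmk m n) = tmk (f m) (g n) := rfl

/-- `x` acts on `M ⊗ N` through the left action on `M`. -/
noncomputable def opL : Module.End ℂ (BiTensor M N) :=
  { tmapAdd (LinearMap.lsmul Bi M (MvPolynomial.X 0)) LinearMap.id with
    map_smul' := by
      intro c t
      induction t using tensor_induction with
      | h0 => simp
      | h1 m n => simp [smulC_tmk, smul_smul, mul_comm]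
      | h2 s t hs ht => simp_all }

/-- The second variable acts on `M ⊗ N` through the right action on `N`. -/
noncomputable def opR : Module.End ℂ (BiTensor M N) :=
  { tmapAdd LinearMap.id (LinearMap.lsmul Bi N (MvPolynomial.X 1)) with
    map_smul' := by
      intro c t
      induction t using tensor_induction with
      | h0 => simp
      | h1 m n => simp [smulC_tmk]
      | h2 s t hs ht => simp_all }

@[simp] lemma opL_tmk (m : M) (n : N) :
    opL (tmk m n) = tmk ((MvPolynomial.X 0 : Bi) • m) n := rfl

@[simp] lemma opR_tmk (m : M) (n : N) :
    opR (tmk m n) = tmk m ((MvPolynomial.X 1 : Bi) • n) := rfl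

lemma op_commute : Commute (opL : Module.End ℂ (BiTensor M N)) opR := by
  ext t
  induction t using tensor_induction with
  | h0 => simp
  | h1 m n => simp
  | h2 s t hs ht => rw [map_add, map_add, hs, ht]

/-- The action of `ℂ[x, y]` on `M ⊗ N`: `x` acts on the left of `M`, `y` on the right of `N`. -/
noncomputable def tact : Bi →ₐ[ℂ] Module.End ℂ (BiTensor M N) :=
  (Algebra.TensorProduct.lift (Polynomial.aeval (R := ℂ) opL) (Polynomial.aeval (R := ℂ) opR)
      (fun p q => by
        have h1 : Commute (opL : Module.End ℂ (BiTensor M N)) (Polynomial.aeval opR q) := by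
          induction q using Polynomial.induction_on' with
          | add p q hp hq => rw [map_add]; exact hp.add_right hq
          | monomial n a =>
            rw [Polynomial.aeval_monomial]
            exact Commute.mul_right (Algebra.commutes a _).symm (op_commute.pow_right n)
        induction p using Polynomial.induction_on' with
        | add p q hp hq => rw [map_add]; exact hp.add_left hq
        | monomial n a =>
          rw [Polynomial.aeval_monomial]
          exact Commute.mul_left (Algebra.commutes a _) (h1.pow_left n))).comp
    (MvPolynomial.aeval
      ![(Polynomial.X : Polynomial ℂ) ⊗ₜ[ℂ] (1 : Polynomial ℂ), 1 ⊗ₜ[ℂ] Polynomial.X])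

noncomputable instance : Module Bi (BiTensor M N) :=
  Module.compHom (BiTensor M N) (tact (M := M) (N := N)).toRingHom

lemma bi_smul_def (s : Bi) (t : BiTensor M N) : s • t = tact s t := rfl

@[simp] lemma C_smul (c : ℂ) (t : BiTensor M N) : (MvPolynomial.C c : Bi) • t = c • t := by
  have : (tact (MvPolynomial.C c) : Module.End ℂ (BiTensor M N)) = algebraMap ℂ _ c :=
    (tact (M := M) (N := N)).commutes c
  rw [bi_smul_def, this]; rfl

@[simp] lemma X0_smul_tmk (m : M) (n : N) :
    (MvPolynomial.X 0 : Bi) • tmk m n = tmk ((MvPolynomial.X 0 : Bi) • m) n := by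
  simp [bi_smul_def, tact]

@[simp] lemma X1_smul_tmk (m : M) (n : N) :
    (MvPolynomial.X 1 : Bi) • tmk m n = tmk m ((MvPolynomial.X 1 : Bi) • n) := by
  simp [bi_smul_def, tact]

instance : IsScalarTower ℂ Bi (BiTensor M N) where
  smul_assoc c s t := by
    rw [bi_smul_def, map_smul]; rfl

/-- An additive map out of `M ⊗ N` which respects the actions on pure tensors is linear. -/
noncomputable def mkBi {V : Type} [AddCommGroup V] [Module Bi V] (f : BiTensor M N →+ V)
    (hC : ∀ (c : ℂ) m n, f (tmk ((MvPolynomial.C c : Bi) • m) n) =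
      (MvPolynomial.C c : Bi) • f (tmk m n))
    (h0 : ∀ m n, f (tmk ((MvPolynomial.X 0 : Bi) • m) n) = (MvPolynomial.X 0 : Bi) • f (tmk m n))
    (h1 : ∀ m n, f (tmk m ((MvPolynomial.X 1 : Bi) • n)) = (MvPolynomial.X 1 : Bi) • f (tmk m n)) :
    BiTensor M N →ₗ[Bi] V :=
  { f with
    map_smul' := by
      apply map_smul_of_gens f
      · intro c t
        induction t using tensor_induction with
        | h0 => simp
        | h1 m n => rw [C_smul, smulC_tmk, hC]
        | h2 s t hs ht => simp_all
      · intro i t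
        induction t using tensor_induction with
        | h0 => simp
        | h1 m n =>
          fin_cases i
          · simpa using h0 m n
          · simpa using h1 m n
        | h2 s t hs ht => simp_all }

/-- The map `f ⊗ g` of bimodules. -/
noncomputable def tmap (f : M →ₗ[Bi] M') (g : N →ₗ[Bi] N') : BiTensor M N →ₗ[Bi] BiTensor M' N' :=
  mkBi (tmapAdd f g) (by intro c m n; simp [smulC_tmk]) (by intro m n; simp) (by intro m n; simp)

@[simp] lemma tmap_tmk (f : M →ₗ[Bi] M') (g : N →ₗ[Bi] N') (m : M) (n : N) :
    tmap f g (tmk m n) = tmk (f m) (g n) := rfl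

/-- `ℂ[x, y] → ℂ[x, z][y]`. -/
noncomputable def phiL : Bi →ₐ[ℂ] Polynomial Bi :=
  MvPolynomial.aeval ![Polynomial.C (MvPolynomial.X 0), Polynomial.X]

/-- `ℂ[y, z] → ℂ[x, z][y]`. -/
noncomputable def phiR : Bi →ₐ[ℂ] Polynomial Bi :=
  MvPolynomial.aeval ![Polynomial.X, Polynomial.C (MvPolynomial.X 1)]

/-- Coordinates of `M ⊗ N` with values in `ℂ[x, z][y]`, for bases of `M` and `N`. -/
noncomputable def tcoord {I J : Type} (b : Module.Basis I Bi M) (c : Module.Basis J Bi N)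
    (i : I) (j : J) : BiTensor M N →ₗ[Bi] Polynomial Bi :=
  mkBi (tlift ((AddMonoidHom.mul.compl₂ (phiR.toRingHom.toAddMonoidHom.comp
      (c.coord j).toAddMonoidHom)).comp
        (phiL.toRingHom.toAddMonoidHom.comp (b.coord i).toAddMonoidHom))
      (by intro m n; simp [phiL, phiR]; ring)
      (by intro c m n; simp; ring))
    (by intro c m n; simp [Polynomial.smul_eq_C_mul, mul_assoc,
      IsScalarTower.algebraMap_apply ℂ Bi (Polynomial Bi), MvPolynomial.algebraMap_eq])
    (by intro m n; simp [phiL, Polynomial.smul_eq_C_mul, mul_assoc])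
    (by intro m n; simp [phiR, Polynomial.smul_eq_C_mul]; ring)

lemma tcoord_tmk {I J : Type} (b : Module.Basis I Bi M) (c : Module.Basis J Bi N)
    (i : I) (j : J) (m : M) (n : N) :
    tcoord b c i j (tmk m n) = phiL (b.coord i m) * phiR (c.coord j n) := rfl

/-- The elements `y ^ k b_i ⊗ c_j`. -/
noncomputable def tbasisFun {I J : Type} (b : Module.Basis I Bi M) (c : Module.Basis J Bi N)
    (p : I × J × ℕ) : BiTensor M N :=
  tmk ((MvPolynomial.X 1 : Bi) ^ p.2.2 • b p.1) (c p.2.1)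

lemma tbasis_indep {I J : Type} (b : Module.Basis I Bi M) (c : Module.Basis J Bi N) :
    LinearIndependent Bi (tbasisFun b c) := by
  classical
  have key : ∀ p q : I × J × ℕ,
      (Polynomial.lcoeff Bi p.2.2 ∘ₗ tcoord b c p.1 p.2.1) (tbasisFun b c q) =
        if p = q then 1 else 0 := by
    rintro ⟨i, j, k⟩ ⟨i', j', k'⟩
    simp only [tbasisFun, LinearMap.comp_apply, tcoord_tmk, map_smul, Module.Basis.coord_apply,
      Module.Basis.repr_self, Finsupp.single_apply, Prod.mk.injEq]
    by_cases hi : i = i'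
    · by_cases hj : j = j'
      · subst hi hj
        simp [phiL, Polynomial.coeff_X_pow]
      · simp [hj, Ne.symm hj]
    · simp [hi, Ne.symm hi]
  refine LinearIndependent.of_pairwise_dual_eq_zero_one _
    (fun p : I × J × ℕ => Polynomial.lcoeff Bi p.2.2 ∘ₗ tcoord b c p.1 p.2.1) ?_ ?_
  · intro p q hpq
    rw [key, if_neg hpq]
  · intro p
    rw [key, if_pos rfl]

lemma tbasis_span {I J : Type} (b : Module.Basis I Bi M) (c : Module.Basis J Bi N) :
    ⊤ ≤ Submodule.span Bi (Set.range (tbasisFun b c)) := by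
  set S := Submodule.span Bi (Set.range (tbasisFun b c)) with hS
  have h1 : ∀ (i : I) (j : J) (s : Bi) (k : ℕ),
      tmk (s • (MvPolynomial.X 1 : Bi) ^ k • b i) (c j) ∈ S := by
    intro i j s
    induction s using MvPolynomial.induction_on with
    | C a =>
      intro k
      rw [← smulC_tmk, ← C_smul]
      exact S.smul_mem _ (Submodule.subset_span ⟨(i, j, k), rfl⟩)
    | add p q hp hq =>
      intro k
      rw [add_smul, tmk_add_left]
      exact S.add_mem (hp k) (hq k)
    | mul_X p l hp =>
      intro k
      fin_cases l
      · have := S.smul_mem (MvPolynomial.X 0) (hp k)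
        rwa [X0_smul_tmk, ← mul_smul, mul_comm] at this
      · have := hp (k + 1)
        rwa [pow_succ', mul_smul, ← mul_smul p] at this
  have h2 : ∀ (i : I) (j : J) (t s : Bi), tmk (s • b i) (t • c j) ∈ S := by
    intro i j t
    induction t using MvPolynomial.induction_on with
    | C a =>
      intro s
      rw [← tmk_C, ← mul_smul]
      simpa using h1 i j (MvPolynomial.C a * s) 0
    | add p q hp hq =>
      intro s
      rw [add_smul, tmk_add_right]
      exact S.add_mem (hp s) (hq s)
    | mul_X p l hp =>
      intro s
      fin_cases l
      · have := hp (MvPolynomial.X 1 * s)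
        rwa [mul_smul, tmk_X, ← mul_smul, mul_comm] at this
      · have := S.smul_mem (MvPolynomial.X 1) (hp s)
        rwa [X1_smul_tmk, ← mul_smul, mul_comm] at this
  have h3 : ∀ (m : M) (j : J) (t s : Bi), tmk (s • m) (t • c j) ∈ S := by
    intro m
    induction b.mem_span m using Submodule.span_induction with
    | mem x hx => obtain ⟨i, rfl⟩ := hx; exact h2 i
    | zero => intro j t s; rw [smul_zero]; rw [zero_tmk]; exact S.zero_mem
    | add x y _ _ hx hy =>
      intro j t s
      rw [smul_add, tmk_add_left]
      exact S.add_mem (hx j t s) (hy j t s)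
    | smul a x _ hx => intro j t s; rw [← mul_smul]; exact hx j t _
  have h4 : ∀ (n : N) (m : M) (t : Bi), tmk m (t • n) ∈ S := by
    intro n
    induction c.mem_span n using Submodule.span_induction with
    | mem x hx => obtain ⟨j, rfl⟩ := hx; intro m t; simpa using h3 m j t 1
    | zero => intro m t; rw [smul_zero]; rw [tmk_zero]; exact S.zero_mem
    | add x y _ _ hx hy =>
      intro m t
      rw [smul_add, tmk_add_right]
      exact S.add_mem (hx m t) (hy m t)
    | smul a x _ hx => intro m t; rw [← mul_smul]; exact hx m _
  intro t _
  induction t using tensor_induction with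
  | h0 => exact S.zero_mem
  | h1 m n => simpa using h4 n m 1
  | h2 s t hs ht => exact S.add_mem (hs trivial) (ht trivial)

instance [Module.Free Bi M] [Module.Free Bi N] : Module.Free Bi (BiTensor M N) :=
  Module.Free.of_basis (Module.Basis.mk
    (tbasis_indep (Module.Free.chooseBasis Bi M) (Module.Free.chooseBasis Bi N))
    (tbasis_span _ _))

/-- `(x ^ d - y ^ d) ⊗ 1 + 1 ⊗ (y ^ d - z ^ d)` is multiplication by `x ^ d - z ^ d`. -/
lemma potential_smul_tmk (d : ℕ) (m : M) (n : N) :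
    tmk (potential d • m) n + tmk m (potential d • n) = potential d • tmk m n := by
  have h0 : ∀ k : ℕ, (MvPolynomial.X 0 : Bi) ^ k • tmk m n =
      tmk ((MvPolynomial.X 0 : Bi) ^ k • m) n := by
    intro k
    induction k with
    | zero => simp
    | succ k ih => rw [pow_succ', mul_smul, ih, X0_smul_tmk, mul_smul]
  have h1 : ∀ k : ℕ, (MvPolynomial.X 1 : Bi) ^ k • tmk m n =
      tmk m ((MvPolynomial.X 1 : Bi) ^ k • n) := by
    intro k
    induction k with
    | zero => simp
    | succ k ih => rw [pow_succ', mul_smul, ih, X1_smul_tmk, mul_smul]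
  have h2 : tmk ((MvPolynomial.X 1 : Bi) ^ d • m) n = tmk m ((MvPolynomial.X 0 : Bi) ^ d • n) := by
    simpa using tmk_balance (Polynomial.X ^ d) m n
  have e1 : tmk (((MvPolynomial.X 0 : Bi) ^ d - MvPolynomial.X 1 ^ d) • m) n =
      tmk ((MvPolynomial.X 0 : Bi) ^ d • m) n - tmk ((MvPolynomial.X 1 : Bi) ^ d • m) n := by
    rw [sub_smul]; exact DFunLike.congr_fun (tmkHom.map_sub _ _) n
  have e2 : tmk m (((MvPolynomial.X 0 : Bi) ^ d - MvPolynomial.X 1 ^ d) • n) =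
      tmk m ((MvPolynomial.X 0 : Bi) ^ d • n) - tmk m ((MvPolynomial.X 1 : Bi) ^ d • n) := by
    rw [sub_smul]; exact (tmkHom m).map_sub _ _
  rw [potential, e1, e2, h2, sub_smul, h0, h1]
  abel

end Tensor

/-! ### Graded bimodules -/

/-- A `ℂ`-graded `ℂ[x]`-`ℂ[x]`-bimodule that is free as a `ℂ[x, y]`-module, where both variables
have degree `2 / d`: the module is the direct sum of its homogeneous pieces `gr q`, `q ∈ ℂ`, and
`q(s • m) = q(s) + q(m)` for homogeneous `s` and `m`. -/
structure GrBimod (d : ℕ) where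
  carrier : Type
  [addCommGroup : AddCommGroup carrier]
  [moduleC : Module ℂ carrier]
  [module : Module Bi carrier]
  [tower : IsScalarTower ℂ Bi carrier]
  [free : Module.Free Bi carrier]
  gr : ℂ → Submodule ℂ carrier
  internal : DirectSum.IsInternal gr
  smul_mem : ∀ {p q : ℂ} {s : Bi} {m : carrier},
    MvPolynomial.IsWeightedHomogeneous (wt d) s p → m ∈ gr q → s • m ∈ gr (p + q)

attribute [instance] GrBimod.addCommGroup GrBimod.moduleC GrBimod.module GrBimod.tower GrBimod.free

instance (d : ℕ) : CoeSort (GrBimod d) Type := ⟨GrBimod.carrier⟩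

lemma homog_induction {V : Type} [AddCommGroup V] [Module ℂ V] {gr : ℂ → Submodule ℂ V}
    (h : DirectSum.IsInternal gr) {P : V → Prop} (h0 : P 0) (h1 : ∀ q, ∀ v ∈ gr q, P v)
    (h2 : ∀ v w, P v → P w → P (v + w)) (v : V) : P v := by
  have hv : v ∈ iSup gr := h.submodule_iSup_eq_top ▸ Submodule.mem_top
  exact Submodule.iSup_induction gr (motive := P) hv h1 h0 h2

lemma smulC_eq {V : Type} [AddCommGroup V] [Module ℂ V] [Module Bi V] [IsScalarTower ℂ Bi V]
    (c : ℂ) (v : V) : (MvPolynomial.C c : Bi) • v = c • v := by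
  rw [← MvPolynomial.algebraMap_eq, algebraMap_smul]

lemma X_smul_mem {d : ℕ} (M : GrBimod d) (i : Fin 2) {q : ℂ} {m : M} (hm : m ∈ M.gr q) :
    (MvPolynomial.X i : Bi) • m ∈ M.gr (2 / d + q) :=
  M.smul_mem (MvPolynomial.isWeightedHomogeneous_X ℂ (wt d) i) hm

section TensorGrading

variable {d : ℕ} (M N : GrBimod d)

/-- The `ℂ`-grading on the tensor product: the degree is additive. -/
noncomputable def tgr (q : ℂ) : Submodule ℂ (BiTensor M N) :=
  Submodule.span ℂ {t | ∃ (a b : ℂ) (m : M) (n : N), a + b = q ∧ m ∈ M.gr a ∧ n ∈ N.gr b ∧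
    t = tmk m n}

variable {M N} in
lemma tmk_mem_tgr {a b : ℂ} {m : M} {n : N} (hm : m ∈ M.gr a) (hn : n ∈ N.gr b) :
    tmk m n ∈ tgr M N (a + b) :=
  Submodule.subset_span ⟨a, b, m, n, rfl, hm, hn, rfl⟩

/-- Auxiliary map adding degrees. -/
noncomputable def degAdd : (ℂ →₀ M) →+ (ℂ →₀ N) →+ (ℂ →₀ BiTensor M N) :=
  Finsupp.liftAddHom fun a => AddMonoidHom.flip (Finsupp.liftAddHom fun b =>
    AddMonoidHom.flip (tmkHom.compr₂ (Finsupp.singleAddHom (a + b))))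

lemma degAdd_single (a b : ℂ) (m : M) (n : N) :
    degAdd M N (Finsupp.single a m) (Finsupp.single b n) = Finsupp.single (a + b) (tmk m n) := by
  simp [degAdd]

/-- Auxiliary biadditive map. -/
noncomputable def tsplitAux : M →+ N →+ (ℂ →₀ BiTensor M N) :=
  ((degAdd M N).compl₂ (split N.internal).toAddMonoidHom).comp (split M.internal).toAddMonoidHom

variable {M N} in
lemma tsplitAux_apply {a b : ℂ} {m : M} {n : N} (hm : m ∈ M.gr a) (hn : n ∈ N.gr b) :
    tsplitAux M N m n = Finsupp.single (a + b) (tmk m n) := by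
  simp [tsplitAux, split_apply M.internal hm, split_apply N.internal hn, degAdd_single]

lemma tsplitAux_ext {V : Type} [AddCommGroup V] {f g : M →+ N →+ V}
    (h : ∀ a b, ∀ m ∈ M.gr a, ∀ n ∈ N.gr b, f m n = g m n) : f = g := by
  ext m n
  induction m using homog_induction M.internal with
  | h0 => simp
  | h2 v w hv hw => simp [hv, hw]
  | h1 a m hm =>
    induction n using homog_induction N.internal with
    | h0 => simp
    | h2 v w hv hw => simp [hv, hw]
    | h1 b n hn => exact h a b m hm n hn

/-- The map that splits the elements of the tensor product into homogeneous components. -/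
noncomputable def tsplit : BiTensor M N →ₗ[ℂ] (ℂ →₀ BiTensor M N) :=
  let f : BiTensor M N →+ (ℂ →₀ BiTensor M N) := tlift (tsplitAux M N)
    (by
      let F : M →+ N →+ (ℂ →₀ BiTensor M N) :=
        (tsplitAux M N).comp (LinearMap.lsmul Bi M (MvPolynomial.X 1)).toAddMonoidHom
      let G : M →+ N →+ (ℂ →₀ BiTensor M N) :=
        (tsplitAux M N).compl₂ (LinearMap.lsmul Bi N (MvPolynomial.X 0)).toAddMonoidHom
      have : F = G := by
        apply tsplitAux_ext
        intro a b m hm n hn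
        change tsplitAux M N ((MvPolynomial.X 1 : Bi) • m) n =
          tsplitAux M N m ((MvPolynomial.X 0 : Bi) • n)
        rw [tsplitAux_apply (X_smul_mem M 1 hm) hn, tsplitAux_apply hm (X_smul_mem N 0 hn), tmk_X,
          add_left_comm, add_assoc]
      intro m n
      exact DFunLike.congr_fun (DFunLike.congr_fun this m) n)
    (by
      intro c
      let F : M →+ N →+ (ℂ →₀ BiTensor M N) :=
        (tsplitAux M N).comp (LinearMap.lsmul Bi M (MvPolynomial.C c)).toAddMonoidHom
      let G : M →+ N →+ (ℂ →₀ BiTensor M N) :=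
        (tsplitAux M N).compl₂ (LinearMap.lsmul Bi N (MvPolynomial.C c)).toAddMonoidHom
      have : F = G := by
        apply tsplitAux_ext
        intro a b m hm n hn
        change tsplitAux M N ((MvPolynomial.C c : Bi) • m) n =
          tsplitAux M N m ((MvPolynomial.C c : Bi) • n)
        rw [smulC_eq, smulC_eq, tsplitAux_apply (Submodule.smul_mem _ c hm) hn,
          tsplitAux_apply hm (Submodule.smul_mem _ c hn), ← smulC_eq, tmk_C, ← smulC_eq c n]
      intro m n
      exact DFunLike.congr_fun (DFunLike.congr_fun this m) n)
  { f with
    map_smul' := by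
      intro c t
      change f (c • t) = c • f t
      induction t using tensor_induction with
      | h0 => simp
      | h2 s t hs ht => rw [smul_add, map_add, map_add, hs, ht, smul_add]
      | h1 m n =>
        let F : M →+ N →+ (ℂ →₀ BiTensor M N) :=
          (tsplitAux M N).comp (LinearMap.lsmul Bi M (MvPolynomial.C c)).toAddMonoidHom
        let G : M →+ N →+ (ℂ →₀ BiTensor M N) :=
          (tsplitAux M N).compr₂ (LinearMap.lsmul ℂ (ℂ →₀ BiTensor M N) c).toAddMonoidHom
        have : F = G := by
          apply tsplitAux_ext
          intro a b m hm n hn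
          change tsplitAux M N ((MvPolynomial.C c : Bi) • m) n = c • tsplitAux M N m n
          rw [smulC_eq, tsplitAux_apply (Submodule.smul_mem _ c hm) hn, tsplitAux_apply hm hn,
            Finsupp.smul_single, smulC_tmk, smulC_eq]
        rw [smulC_tmk]
        exact DFunLike.congr_fun (DFunLike.congr_fun this m) n }

lemma tsplit_tmk (m : M) (n : N) : tsplit M N (tmk m n) = tsplitAux M N m n := rfl

lemma tgr_internal : DirectSum.IsInternal (tgr M N) := by
  refine isInternal_of_split _ (tsplit M N) ?_ ?_
  · intro q v hv
    induction hv using Submodule.span_induction with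
    | mem x hx =>
      obtain ⟨a, b, m, n, rfl, hm, hn, rfl⟩ := hx
      rw [tsplit_tmk, tsplitAux_apply hm hn]
    | zero => simp
    | add x y _ _ hx hy => simp [hx, hy]
    | smul c x _ hx => rw [map_smul, hx, Finsupp.smul_single]
  · rw [eq_top_iff]
    intro t ht
    clear ht
    induction t using tensor_induction with
    | h0 => exact zero_mem _
    | h2 s t hs ht => exact add_mem hs ht
    | h1 m n =>
      induction m using homog_induction M.internal with
      | h0 => rw [zero_tmk]; exact zero_mem _
      | h2 v w hv hw => rw [tmk_add_left]; exact add_mem hv hw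
      | h1 a m hm =>
        induction n using homog_induction N.internal with
        | h0 => rw [tmk_zero]; exact zero_mem _
        | h2 v w hv hw => rw [tmk_add_right]; exact add_mem hv hw
        | h1 b n hn => exact Submodule.mem_iSup_of_mem (a + b) (tmk_mem_tgr hm hn)

lemma X_smul_mem_tgr (i : Fin 2) {q : ℂ} {t : BiTensor M N} (ht : t ∈ tgr M N q) :
    (MvPolynomial.X i : Bi) • t ∈ tgr M N (2 / d + q) := by
  induction ht using Submodule.span_induction with
  | mem x hx =>
    obtain ⟨a, b, m, n, rfl, hm, hn, rfl⟩ := hx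
    fin_cases i
    · simp only [Fin.zero_eta, X0_smul_tmk]
      rw [← add_assoc]
      exact tmk_mem_tgr (X_smul_mem M 0 hm) hn
    · simp only [Fin.mk_one, X1_smul_tmk]
      rw [add_left_comm]
      exact tmk_mem_tgr hm (X_smul_mem N 1 hn)
  | zero => simp
  | add x y _ _ hx hy => rw [smul_add]; exact add_mem hx hy
  | smul c x _ hx => rw [smul_comm]; exact Submodule.smul_mem _ c hx

/-- Compatibility of a grading with the action can be checked on the two variables. -/
lemma smul_mem_of_X {V : Type} [AddCommGroup V] [Module ℂ V] [Module Bi V] [IsScalarTower ℂ Bi V]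
    (gr : ℂ → Submodule ℂ V)
    (hX : ∀ (i : Fin 2) (q : ℂ), ∀ v ∈ gr q, (MvPolynomial.X i : Bi) • v ∈ gr (2 / d + q))
    {p q : ℂ} {s : Bi} {v : V} (hs : MvPolynomial.IsWeightedHomogeneous (wt d) s p)
    (hv : v ∈ gr q) : s • v ∈ gr (p + q) := by
  have hpow : ∀ (i : Fin 2) (k : ℕ) (q : ℂ), ∀ v ∈ gr q,
      (MvPolynomial.X i : Bi) ^ k • v ∈ gr (k * (2 / d) + q) := by
    intro i k
    induction k with
    | zero => intro q v hv; simpa using hv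
    | succ k ih =>
      intro q v hv
      have := hX i _ _ (ih q v hv)
      rw [← mul_smul, ← pow_succ'] at this
      convert this using 2
      push_cast; ring
  rw [MvPolynomial.as_sum s, Finset.sum_smul]
  refine Submodule.sum_mem _ fun e he => ?_
  have hw := hs (MvPolynomial.mem_support_iff.mp he)
  rw [← mul_one (MvPolynomial.coeff e s), ← MvPolynomial.C_mul_monomial, mul_smul, smulC_eq]
  refine Submodule.smul_mem _ _ ?_
  have hmon : (MvPolynomial.monomial e (1 : ℂ) : Bi) =
      MvPolynomial.X 0 ^ e 0 * MvPolynomial.X 1 ^ e 1 := by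
    rw [MvPolynomial.monomial_eq, Finsupp.prod_fintype _ _ (by simp)]
    simp
  have hp : p = (e 0 : ℂ) * (2 / d) + (e 1 : ℂ) * (2 / d) := by
    rw [← hw, Finsupp.weight_apply, Finsupp.sum_fintype _ _ (by simp)]
    simp [wt]
  rw [hmon, hp, mul_smul, add_assoc]
  exact hpow 0 _ _ _ (hpow 1 _ _ _ hv)

/-- The tensor product `M ⊗_{ℂ[t]} N` of graded bimodules. -/
noncomputable abbrev GrBimod.tensor : GrBimod d where
  carrier := BiTensor M N
  gr := tgr M N
  internal := tgr_internal M N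
  smul_mem := smul_mem_of_X _ fun i _ _ hv => X_smul_mem_tgr M N i hv

/-- The direct sum of two graded bimodules. -/
noncomputable abbrev GrBimod.prod : GrBimod d where
  carrier := M × N
  gr q := (M.gr q).prod (N.gr q)
  internal := by
    refine isInternal_of_split _
      (Finsupp.mapRange.linearMap (LinearMap.inl ℂ M N) ∘ₗ split M.internal ∘ₗ
          LinearMap.fst ℂ M N +
        Finsupp.mapRange.linearMap (LinearMap.inr ℂ M N) ∘ₗ split N.internal ∘ₗ
          LinearMap.snd ℂ M N) ?_ ?_
    · rintro q ⟨m, n⟩ ⟨hm, hn⟩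
      simp [split_apply M.internal hm, split_apply N.internal hn, ← Finsupp.single_add]
    · rw [eq_top_iff]
      rintro ⟨m, n⟩ hmn
      clear hmn
      have h1 : ((m, 0) : M × N) ∈ ⨆ q, (M.gr q).prod (N.gr q) := by
        induction m using homog_induction M.internal with
        | h0 => exact zero_mem _
        | h1 q v hv => exact Submodule.mem_iSup_of_mem q ⟨hv, zero_mem _⟩
        | h2 v w hv hw => simpa using add_mem hv hw
      have h2 : ((0, n) : M × N) ∈ ⨆ q, (M.gr q).prod (N.gr q) := by
        induction n using homog_induction N.internal with
        | h0 => exact zero_mem _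
        | h1 q v hv => exact Submodule.mem_iSup_of_mem q ⟨zero_mem _, hv⟩
        | h2 v w hv hw => simpa using add_mem hv hw
      simpa using add_mem h1 h2
  smul_mem hs hm := And.intro (M.smul_mem hs hm.1) (N.smul_mem hs hm.2)

end TensorGrading

/-- `ℂ[x, y]{α}`: the bimodule `ℂ[x, y]`, graded so that `1` has degree `α`. -/
noncomputable abbrev GrBimod.poly (d : ℕ) (α : ℂ) : GrBimod d where
  carrier := Bi
  gr q := MvPolynomial.weightedHomogeneousSubmodule ℂ (wt d) (q - α)
  internal := by
    classical
    have h0 : DirectSum.IsInternal (MvPolynomial.weightedHomogeneousSubmodule ℂ (wt d)) :=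
      letI := MvPolynomial.weightedDecomposition ℂ (wt d)
      DirectSum.Decomposition.isInternal _
    refine isInternal_of_split _
      ((Finsupp.lmapDomain Bi ℂ (fun q : ℂ => q + α)) ∘ₗ split h0) ?_ ?_
    · intro q v hv
      simp [split_apply h0 hv]
    · rw [eq_top_iff]
      intro v hv
      clear hv
      induction v using homog_induction h0 with
      | h0 => exact zero_mem _
      | h1 q v hv =>
        refine Submodule.mem_iSup_of_mem (q + α) ?_
        simpa using hv
      | h2 v w hv hw => exact add_mem hv hw
  smul_mem hs hm := by
    rw [add_sub_assoc]
    exact MvPolynomial.IsWeightedHomogeneous.mul hs hm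

/-! ### Graded matrix bifactorizations -/

/-- A `ℂ`-graded matrix bifactorization of `x ^ d - y ^ d`: a `ℤ/2`-graded, `ℂ`-graded free bimodule
`M0 ⊕ M1` with a twisted differential of `ℤ/2`-degree `1` and `ℂ`-degree `1` squaring to
multiplication by `x ^ d - y ^ d`.  The rank may be infinite. -/
structure GrMF (d : ℕ) where
  M0 : GrBimod d
  M1 : GrBimod d
  d0 : M0 →ₗ[Bi] M1
  d1 : M1 →ₗ[Bi] M0
  d1_d0 : ∀ m, d1 (d0 m) = potential d • m
  d0_d1 : ∀ m, d0 (d1 m) = potential d • m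
  d0_mem : ∀ q, ∀ m ∈ M0.gr q, d0 m ∈ M1.gr (q + 1)
  d1_mem : ∀ q, ∀ m ∈ M1.gr q, d1 m ∈ M0.gr (q + 1)

section Hom

variable {d : ℕ}

/-- The space of morphisms `M → N`: pairs of bimodule maps of `ℤ/2`-degree `0`, commuting with the
differentials and of `ℂ`-degree `0`. -/
def zHom (M N : GrMF d) : Submodule ℂ ((M.M0 →ₗ[Bi] N.M0) × (M.M1 →ₗ[Bi] N.M1)) where
  carrier := {f | (∀ m, f.1 (M.d1 m) = N.d1 (f.2 m)) ∧ (∀ m, f.2 (M.d0 m) = N.d0 (f.1 m)) ∧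
    (∀ q, ∀ m ∈ M.M0.gr q, f.1 m ∈ N.M0.gr q) ∧ (∀ q, ∀ m ∈ M.M1.gr q, f.2 m ∈ N.M1.gr q)}
  zero_mem' := by simp
  add_mem' := by
    rintro f g ⟨h1, h2, h3, h4⟩ ⟨k1, k2, k3, k4⟩
    refine ⟨fun m => ?_, fun m => ?_, fun q m hm => ?_, fun q m hm => ?_⟩
    · simp [h1, k1]
    · simp [h2, k2]
    · exact add_mem (h3 q m hm) (k3 q m hm)
    · exact add_mem (h4 q m hm) (k4 q m hm)
  smul_mem' := by
    rintro c f ⟨h1, h2, h3, h4⟩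
    refine ⟨fun m => ?_, fun m => ?_, fun q m hm => ?_, fun q m hm => ?_⟩
    · simp only [Prod.smul_fst, Prod.smul_snd, LinearMap.smul_apply, h1, ← smulC_eq, map_smul]
    · simp only [Prod.smul_fst, Prod.smul_snd, LinearMap.smul_apply, h2, ← smulC_eq, map_smul]
    · exact Submodule.smul_mem _ c (h3 q m hm)
    · exact Submodule.smul_mem _ c (h4 q m hm)

/-- The category `ZMF^gr_bi`. -/
noncomputable instance : Category (GrMF d) where
  Hom M N := zHom M N
  id M := ⟨(LinearMap.id, LinearMap.id), by simp [zHom]⟩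
  comp {M N L} f g := ⟨(g.1.1 ∘ₗ f.1.1, g.1.2 ∘ₗ f.1.2), by
    obtain ⟨f, h1, h2, h3, h4⟩ := f
    obtain ⟨g, k1, k2, k3, k4⟩ := g
    exact ⟨fun m => by simp [h1, k1], fun m => by simp [h2, k2],
      fun q m hm => k3 q _ (h3 q m hm), fun q m hm => k4 q _ (h4 q m hm)⟩⟩

noncomputable instance : Preadditive (GrMF d) where
  homGroup M N := inferInstanceAs (AddCommGroup (zHom M N))
  add_comp := by
    intro M N L f f' g
    apply Subtype.ext
    exact Prod.ext (LinearMap.comp_add _ _ _) (LinearMap.comp_add _ _ _)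
  comp_add := by
    intro M N L f g g'
    apply Subtype.ext
    exact Prod.ext (LinearMap.add_comp _ _ _) (LinearMap.add_comp _ _ _)

noncomputable instance : Linear ℂ (GrMF d) where
  homModule M N := inferInstanceAs (Module ℂ (zHom M N))
  smul_comp := by
    intro M N L c f g
    apply Subtype.ext
    refine Prod.ext (LinearMap.ext fun m => ?_) (LinearMap.ext fun m => ?_)
    · change g.1.1 (c • f.1.1 m) = c • g.1.1 (f.1.1 m)
      rw [← smulC_eq, map_smul, smulC_eq]
    · change g.1.2 (c • f.1.2 m) = c • g.1.2 (f.1.2 m)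
      rw [← smulC_eq, map_smul, smulC_eq]
  comp_smul := by
    intro M N L f c g
    rfl

/-- Two morphisms are identified if they differ by `δ(h) = d h + h d` for an odd bimodule map
`h = (h0, h1)` of `ℂ`-degree `-1`. -/
def Homotopic (d : ℕ) : HomRel (GrMF d) := fun M N (f g : zHom M N) =>
  ∃ (h0 : M.M0 →ₗ[Bi] N.M1) (h1 : M.M1 →ₗ[Bi] N.M0),
    (∀ q, ∀ m ∈ M.M0.gr q, h0 m ∈ N.M1.gr (q - 1)) ∧
    (∀ q, ∀ m ∈ M.M1.gr q, h1 m ∈ N.M0.gr (q - 1)) ∧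
    (∀ m, f.1.1 m - g.1.1 m = N.d1 (h0 m) + h1 (M.d0 m)) ∧
    (∀ m, f.1.2 m - g.1.2 m = N.d0 (h1 m) + h0 (M.d1 m))

lemma Homotopic.add {M N : GrMF d} {f f' g g' : M ⟶ N} (h : Homotopic d f f')
    (k : Homotopic d g g') : Homotopic d (f + g) (f' + g') := by
  obtain ⟨h0, h1, a, b, c, e⟩ := h
  obtain ⟨k0, k1, a', b', c', e'⟩ := k
  refine ⟨h0 + k0, h1 + k1, fun q m hm => add_mem (a q m hm) (a' q m hm),
    fun q m hm => add_mem (b q m hm) (b' q m hm), fun m => ?_, fun m => ?_⟩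
  · change (f.1.1 m + g.1.1 m) - (f'.1.1 m + g'.1.1 m) = _
    rw [add_sub_add_comm, c, c']
    simp only [LinearMap.add_apply, map_add]
    abel
  · change (f.1.2 m + g.1.2 m) - (f'.1.2 m + g'.1.2 m) = _
    rw [add_sub_add_comm, e, e']
    simp only [LinearMap.add_apply, map_add]
    abel

lemma Homotopic.smul (c : ℂ) {M N : GrMF d} {f g : M ⟶ N} (h : Homotopic d f g) :
    Homotopic d (c • f) (c • g) := by
  obtain ⟨h0, h1, a, b, k, e⟩ := h
  refine ⟨c • h0, c • h1, fun q m hm => Submodule.smul_mem _ c (a q m hm),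
    fun q m hm => Submodule.smul_mem _ c (b q m hm), fun m => ?_, fun m => ?_⟩
  · change c • f.1.1 m - c • g.1.1 m = _
    rw [← smul_sub, k, smul_add]
    simp only [LinearMap.smul_apply, ← smulC_eq, map_smul]
  · change c • f.1.2 m - c • g.1.2 m = _
    rw [← smul_sub, e, smul_add]
    simp only [LinearMap.smul_apply, ← smulC_eq, map_smul]

lemma Homotopic.refl {M N : GrMF d} (f : M ⟶ N) : Homotopic d f f :=
  ⟨0, 0, by simp, by simp, by simp, by simp⟩

instance : Congruence (Homotopic d) where
  equivalence := by
    intro M N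
    refine ⟨Homotopic.refl, ?_, ?_⟩
    · intro f g h
      have := (h.smul (-1)).add (Homotopic.refl (f + g))
      simpa using this
    · intro f g k h h'
      have := (h.add h').add (Homotopic.refl (-g))
      simpa [add_assoc] using this
  comp_left := by
    rintro M N L f g g' ⟨h0, h1, a, b, c, e⟩
    obtain ⟨f, k1, k2, k3, k4⟩ := f
    refine ⟨h0 ∘ₗ f.1, h1 ∘ₗ f.2, fun q m hm => a q _ (k3 q m hm),
      fun q m hm => b q _ (k4 q m hm), fun m => ?_, fun m => ?_⟩
    · refine (c (f.1 m)).trans ?_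
      simp [k2]
    · refine (e (f.2 m)).trans ?_
      simp [k1]
  comp_right := by
    rintro M N L f f' g ⟨h0, h1, a, b, c, e⟩
    obtain ⟨g, k1, k2, k3, k4⟩ := g
    refine ⟨g.2 ∘ₗ h0, g.1 ∘ₗ h1, fun q m hm => k4 _ _ (a q m hm),
      fun q m hm => k3 _ _ (b q m hm), fun m => ?_, fun m => ?_⟩
    · change g.1 (f.1.1 m) - g.1 (f'.1.1 m) = _
      rw [← map_sub, c, map_add, k1]
      rfl
    · change g.2 (f.1.2 m) - g.2 (f'.1.2 m) = _
      rw [← map_sub, e, map_add, k2]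
      rfl

/-- The category `HMF^gr_bi`: graded matrix bifactorizations of `x ^ d - y ^ d` and morphisms of
`ℂ`-degree `0`, up to homotopy. -/
abbrev HMF (d : ℕ) : Type 1 := CategoryTheory.Quotient (Homotopic d)

noncomputable instance : Preadditive (HMF d) :=
  Quotient.preadditive (Homotopic d) fun _ _ _ _ _ _ h k => h.add k

instance : (Quotient.functor (Homotopic d)).Additive where
  map_add := rfl

noncomputable instance : Linear ℂ (HMF d) :=
  Quotient.linear ℂ (Homotopic d) fun c _ _ _ _ h => h.smul c

end Hom

/-! ### Tensor products -/

section TensorAux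

variable {d : ℕ} {A A' B B' : GrBimod d}

lemma tmap_mem_left {f : A →ₗ[Bi] A'} (hf : ∀ q, ∀ m ∈ A.gr q, f m ∈ A'.gr (q + 1)) {q : ℂ}
    {t : BiTensor A B} (ht : t ∈ tgr A B q) :
    tmap f (LinearMap.id : B →ₗ[Bi] B) t ∈ tgr A' B (q + 1) := by
  induction ht using Submodule.span_induction with
  | mem x hx =>
    obtain ⟨a, b, m, n, rfl, hm, hn, rfl⟩ := hx
    rw [tmap_tmk, add_right_comm]
    exact tmk_mem_tgr (hf a m hm) hn
  | zero => simp
  | add x y _ _ hx hy => rw [map_add]; exact add_mem hx hy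
  | smul c x _ hx => rw [← smulC_eq, map_smul, smulC_eq]; exact Submodule.smul_mem _ c hx

lemma tmap_mem_right {g : B →ₗ[Bi] B'} (hg : ∀ q, ∀ m ∈ B.gr q, g m ∈ B'.gr (q + 1)) {q : ℂ}
    {t : BiTensor A B} (ht : t ∈ tgr A B q) :
    tmap (LinearMap.id : A →ₗ[Bi] A) g t ∈ tgr A B' (q + 1) := by
  induction ht using Submodule.span_induction with
  | mem x hx =>
    obtain ⟨a, b, m, n, rfl, hm, hn, rfl⟩ := hx
    rw [tmap_tmk, add_assoc]
    exact tmk_mem_tgr hm (hg b n hn)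
  | zero => simp
  | add x y _ _ hx hy => rw [map_add]; exact add_mem hx hy
  | smul c x _ hx => rw [← smulC_eq, map_smul, smulC_eq]; exact Submodule.smul_mem _ c hx

variable (f : A →ₗ[Bi] A') (f' : A' →ₗ[Bi] A) (g : B →ₗ[Bi] B') (g' : B' →ₗ[Bi] B)

lemma tmap_swap (t : BiTensor A B) :
    tmap f LinearMap.id (tmap LinearMap.id g t) = tmap LinearMap.id g (tmap f LinearMap.id t) := by
  induction t using tensor_induction with
  | h0 => simp
  | h1 m n => simp
  | h2 s t hs ht => simp [hs, ht]

lemma tmap_sq (hf : ∀ m, f' (f m) = potential d • m) (hg : ∀ n, g' (g n) = potential d • n) (t : BiTensor A B) :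
    tmap f' LinearMap.id (tmap f LinearMap.id t) + tmap LinearMap.id g' (tmap LinearMap.id g t) =
      potential d • t := by
  induction t using tensor_induction with
  | h0 => simp
  | h1 m n => simp [hf, hg, potential_smul_tmk]
  | h2 s t hs ht =>
    simp only [map_add, smul_add, ← hs, ← ht]
    abel

end TensorAux

/-- The tensor product of matrix bifactorizations, with differential `d ⊗ 1 + 1 ⊗ d` subject to the
Koszul sign rule `(1 ⊗ d) (m ⊗ n) = (-1) ^ |m| m ⊗ d n`. -/
noncomputable abbrev GrMF.tensor {d : ℕ} (M N : GrMF d) : GrMF d where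
  M0 := (M.M0.tensor N.M0).prod (M.M1.tensor N.M1)
  M1 := (M.M1.tensor N.M0).prod (M.M0.tensor N.M1)
  d0 := ((tmap M.d0 LinearMap.id).coprod (-tmap LinearMap.id N.d1)).prod
    ((tmap LinearMap.id N.d0).coprod (tmap M.d1 LinearMap.id))
  d1 := ((tmap M.d1 LinearMap.id).coprod (tmap LinearMap.id N.d1)).prod
    ((-tmap LinearMap.id N.d0).coprod (tmap M.d0 LinearMap.id))
  d1_d0 := by
    rintro ⟨u, v⟩
    apply Prod.ext
    · change tmap M.d1 LinearMap.id (tmap M.d0 LinearMap.id u + -tmap LinearMap.id N.d1 v) +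
        tmap LinearMap.id N.d1 (tmap LinearMap.id N.d0 u + tmap M.d1 LinearMap.id v) =
          potential d • u
      rw [← tmap_sq M.d0 M.d1 N.d0 N.d1 M.d1_d0 N.d1_d0]
      simp only [map_add, map_neg, tmap_swap]
      abel
    · change -tmap LinearMap.id N.d0 (tmap M.d0 LinearMap.id u + -tmap LinearMap.id N.d1 v) +
        tmap M.d0 LinearMap.id (tmap LinearMap.id N.d0 u + tmap M.d1 LinearMap.id v) =
          potential d • v
      rw [← tmap_sq M.d1 M.d0 N.d1 N.d0 M.d0_d1 N.d0_d1]
      simp only [map_add, map_neg, tmap_swap]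
      abel
  d0_d1 := by
    rintro ⟨u, v⟩
    apply Prod.ext
    · change tmap M.d0 LinearMap.id (tmap M.d1 LinearMap.id u + tmap LinearMap.id N.d1 v) +
        -tmap LinearMap.id N.d1 (-tmap LinearMap.id N.d0 u + tmap M.d0 LinearMap.id v) =
          potential d • u
      rw [← tmap_sq M.d1 M.d0 N.d0 N.d1 M.d0_d1 N.d1_d0]
      simp only [map_add, map_neg, tmap_swap]
      abel
    · change tmap LinearMap.id N.d0 (tmap M.d1 LinearMap.id u + tmap LinearMap.id N.d1 v) +
        tmap M.d1 LinearMap.id (-tmap LinearMap.id N.d0 u + tmap M.d0 LinearMap.id v) =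
          potential d • v
      rw [← tmap_sq M.d0 M.d1 N.d1 N.d0 M.d1_d0 N.d0_d1]
      simp only [map_add, map_neg, tmap_swap]
      abel
  d0_mem := by
    rintro q ⟨u, v⟩ ⟨hu, hv⟩
    refine And.intro (add_mem (tmap_mem_left M.d0_mem hu) (neg_mem (tmap_mem_right N.d1_mem hv)))
      (add_mem (tmap_mem_right N.d0_mem hu) (tmap_mem_left M.d1_mem hv))
  d1_mem := by
    rintro q ⟨u, v⟩ ⟨hu, hv⟩
    refine And.intro (add_mem (tmap_mem_left M.d1_mem hu) (tmap_mem_right N.d1_mem hv))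
      (add_mem (neg_mem (tmap_mem_right N.d0_mem hu)) (tmap_mem_left M.d0_mem hv))

/-- The tensor product on objects of `HMF^gr_bi`. -/
noncomputable def HMF.tensor {d : ℕ} (X Y : HMF d) : HMF d := ⟨X.as.tensor Y.as⟩

/-! ### Permutation-type bifactorizations -/

section Perm

variable (d : ℕ)

/-- `η = exp (2 π i / d)`. -/
noncomputable def eta : ℂ := Complex.exp (2 * Real.pi * Complex.I / d)

/-- `∏_{i ∈ S} (x - η ^ i y)`. -/
noncomputable def permPoly (S : Finset (ZMod d)) : Bi :=
  ∏ i ∈ S, (MvPolynomial.X 0 - MvPolynomial.C (eta d ^ i.val) * MvPolynomial.X 1)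

lemma permPoly_homog (S : Finset (ZMod d)) :
    MvPolynomial.IsWeightedHomogeneous (wt d) (permPoly d S) (2 / d * S.card) := by
  have h := MvPolynomial.IsWeightedHomogeneous.prod (w := wt d) S
    (fun i => (MvPolynomial.X 0 - MvPolynomial.C (eta d ^ i.val) * MvPolynomial.X 1 : Bi))
    (fun _ => (2 / d : ℂ)) (fun i _ =>
      (MvPolynomial.isWeightedHomogeneous_X ℂ (wt d) 0).sub
        ((MvPolynomial.isWeightedHomogeneous_X ℂ (wt d) 1).C_mul _))
  rw [Finset.sum_const, nsmul_eq_mul, mul_comm] at h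
  exact h

variable [NeZero d]

lemma eta_primitive : IsPrimitiveRoot (eta d) d :=
  Complex.isPrimitiveRoot_exp d (NeZero.ne d)

lemma permPoly_univ : permPoly d Finset.univ = potential d := by
  have h : IsPrimitiveRoot (MvPolynomial.C (eta d) : Bi) d :=
    (eta_primitive d).map_of_injective (MvPolynomial.C_injective _ _)
  have hpos : 0 < d := Nat.pos_of_ne_zero (NeZero.ne d)
  rw [potential, h.pow_sub_pow_eq_prod_sub_mul _ _ hpos, permPoly]
  have himg : Polynomial.nthRootsFinset d (1 : Bi) =
      Finset.univ.image fun i : ZMod d => (MvPolynomial.C (eta d ^ i.val) : Bi) := by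
    symm
    apply Finset.eq_of_subset_of_card_le
    · intro z hz
      obtain ⟨i, -, rfl⟩ := Finset.mem_image.mp hz
      rw [Polynomial.mem_nthRootsFinset hpos, ← map_pow, ← pow_mul, mul_comm, pow_mul,
        (eta_primitive d).pow_eq_one, one_pow, map_one]
    · rw [h.card_nthRootsFinset, Finset.card_image_of_injective, Finset.card_univ, ZMod.card]
      intro i j hij
      exact ZMod.val_injective d ((eta_primitive d).pow_inj (ZMod.val_lt i) (ZMod.val_lt j)
        (MvPolynomial.C_injective _ _ hij))
  rw [himg, Finset.prod_image]
  intro i _ j _ hij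
  exact ZMod.val_injective d ((eta_primitive d).pow_inj (ZMod.val_lt i) (ZMod.val_lt j)
    (MvPolynomial.C_injective _ _ hij))

lemma permPoly_mul_compl (S : Finset (ZMod d)) : permPoly d S * permPoly d Sᶜ = potential d := by
  rw [← permPoly_univ, permPoly, permPoly, permPoly, Finset.prod_mul_prod_compl]

/-- Multiplication by `p` as a map `ℂ[x, y]{α} → ℂ[x, y]{β}`. -/
noncomputable def mulMap (α β : ℂ) (p : Bi) : GrBimod.poly d α →ₗ[Bi] GrBimod.poly d β :=
  (LinearMap.lsmul Bi Bi p : Bi →ₗ[Bi] Bi)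

/-- The graded permutation-type bifactorization `P_S{α}`, with `d1 = ∏_{i ∈ S} (x - η ^ i y)` and
`d0 = ∏_{i ∉ S} (x - η ^ i y)`, where `1` has degree `α` in the even part. -/
noncomputable abbrev permMF (S : Finset (ZMod d)) (α : ℂ) : GrMF d where
  M0 := GrBimod.poly d α
  M1 := GrBimod.poly d (α + 2 / d * S.card - 1)
  d0 := mulMap d _ _ (permPoly d Sᶜ)
  d1 := mulMap d _ _ (permPoly d S)
  d1_d0 (m : Bi) := by
    change permPoly d S * (permPoly d Sᶜ * (m : Bi)) = potential d * (m : Bi)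
    rw [← mul_assoc, permPoly_mul_compl]
  d0_d1 (m : Bi) := by
    change permPoly d Sᶜ * (permPoly d S * (m : Bi)) = potential d * (m : Bi)
    rw [← mul_assoc, mul_comm (permPoly d Sᶜ), permPoly_mul_compl]
  d0_mem q (m : Bi) hm := by
    have h : MvPolynomial.IsWeightedHomogeneous (wt d) (permPoly d Sᶜ * (m : Bi)) _ :=
      (permPoly_homog d Sᶜ).mul hm
    have e : (2 / d * (Sᶜ.card : ℂ) + (q - α)) = q + 1 - (α + 2 / d * S.card - 1) := by
      have hd : (d : ℂ) ≠ 0 := NeZero.ne _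
      have hc : (S.card : ℂ) + Sᶜ.card = d := by
        rw [← Nat.cast_add, Finset.card_add_card_compl, ZMod.card]
      rw [← eq_sub_iff_add_eq'] at hc
      rw [hc]
      field_simp
      ring
    rw [e] at h
    exact h
  d1_mem q (m : Bi) hm := by
    have h : MvPolynomial.IsWeightedHomogeneous (wt d) (permPoly d S * (m : Bi)) _ :=
      (permPoly_homog d S).mul hm
    have e : (2 / d * (S.card : ℂ) + (q - (α + 2 / d * S.card - 1))) = q + 1 - α := by ring
    rw [e] at h
    exact h

/-- `P̂_S = P_S{(1 - |S|) / d}`. -/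
noncomputable def hatP (S : Finset (ZMod d)) : HMF d := ⟨permMF d S ((1 - S.card) / d)⟩

/-- `P̂_{a:l} = P̂_{{a, a + 1, …, a + l}}`, for `a ∈ ℤ/d` and `l ∈ {0, …, d - 2}`. -/
noncomputable def hatPI (a : ZMod d) (l : Fin (d - 1)) : HMF d :=
  hatP d ((Finset.range (l + 1)).image fun k : ℕ => a + k)

end Perm

/-! ### The category `PT_d^gr` and semisimplicity -/

/-- `X` is isomorphic to the direct sum (biproduct) of the finite family `F`. -/
def IsDirectSum {C : Type*} [Category C] [Preadditive C] {J : Type} [Finite J] (X : C)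
    (F : J → C) : Prop :=
  ∃ b : Bicone F, Nonempty b.IsBilimit ∧ Nonempty (X ≅ b.pt)

lemma isDirectSum_self {C : Type*} [Category C] [Preadditive C] (X : C) :
    IsDirectSum X fun _ : Fin 1 => X :=
  ⟨(limitBiconeOfUnique fun _ : Fin 1 => X).bicone, ⟨(limitBiconeOfUnique _).isBilimit⟩, ⟨Iso.refl _⟩⟩

/-- The objects of `HMF^gr_bi` isomorphic to finite direct sums of the `P̂_{a:l}`. -/
def isPT (d : ℕ) [NeZero d] : ObjectProperty (HMF d) := fun X =>
  ∃ (n : ℕ) (F : Fin n → ZMod d × Fin (d - 1)), IsDirectSum X fun i => hatPI d (F i).1 (F i).2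

/-- The category `PT_d^gr`, a full subcategory of `HMF^gr_bi`. -/
abbrev PT (d : ℕ) [NeZero d] : Type 1 := (isPT d).FullSubcategory

/-- `P̂_{a:l}` as an object of `PT_d^gr`. -/
noncomputable def PT.P (d : ℕ) [NeZero d] (a : ZMod d) (l : Fin (d - 1)) : PT d :=
  ⟨hatPI d a l, 1, fun _ => (a, l), isDirectSum_self _⟩

/-- A preadditive category is semisimple if it is abelian and each object is a finite direct sum
of simple objects. -/
def IsSemisimpleCategory (C : Type*) [Category C] [inst : Preadditive C] : Prop :=
  (∃ h : Abelian C, h.toPreadditive = inst) ∧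
  ∀ X : C, ∃ (n : ℕ) (F : Fin n → C), (∀ i, Simple (F i)) ∧ IsDirectSum X F

/-- `ν ∈ {|l - m|, |l - m| + 2, …, min (l + m, 2 d - 4 - l - m)}`. -/
def Fusion (d : ℕ) (l m ν : Fin (d - 1)) : Prop :=
  |(l : ℤ) - m| ≤ ν ∧ (ν : ℤ) ≤ min ((l : ℤ) + m) (2 * d - 4 - l - m) ∧
    (2 : ℤ) ∣ ν - |(l : ℤ) - m|

end LG

/-! Write f_S(x,y) for the product of the factors x - η^j y with j ∈ S, and q = η. The tensor
product of P_S and P_T has infinite rank over ℂ[x,z], because the middle variable y survives. As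
f_S(x,y) is monic in y up to a unit, ℂ[x,z][y]/f_S(x,y) is free of rank |S| over ℂ[x,z], and the
tensor product contracts onto two copies of this module, with multiplication by f_T(y,z) as one half
of the differential. A splitting therefore amounts to diagonalizing f_T(y,z) modulo f_S(x,y):
homogeneous bases g_i, h_i of the quotient with f_{U_i}(x,z) g_i ≡ f_T(y,z) h_i. Each such pair
splits off a P_{U_i} (`isDirectSum_tensor_permMF`), and division by f_S supplies the contracting
homotopy.

For arcs the products f are q-shifted powers. Write (x;y)_k for ∏_{j<k} (x - q^j y), and expand
polynomials of degree D in the products (x;y)_k (y;z)_{D-k}. Multiplication by x - q^D z then acts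
on coefficient sequences by one operator E = `qRaise` (`mul_qExpand`). In the expansion of f_U g the
terms with small k are divisible by f_T(y,z) and those with large k by f_S(x,y). The congruence
holds once the i coefficients in between vanish, which is i linear equations for the i + 1
coefficients of g (`qPoch_dvd_sub`, `exists_qClebschGordan`).

The delicate point is that g and h contain a pure power of y, without which they would not be part
of a basis. The coefficient of that power is the pairing with `qSign`, whose kernel is the image of
E. If it vanished, E could be cancelled and a nonzero sequence would have too long a window of zeros
after raising. This is excluded by `eq_zero_of_qRaise_iterate_window`, a consequence of the relation
D E = 1 + q E D for the Jackson derivative D = `qDeriv` and of the invertibility of the q-integers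
[1], …, [d-1]. The indices i outside the fusion range give U_i = ∅ or U_i = ℤ/d, hence contractible
summands, and the others give the stated arcs.

Semisimplicity comes from the grading. A morphism between two P̂_S, P̂_T is a pair of polynomials in
x, y of degrees (|T| - |S|)/2 and (|S| - |T|)/2, which leaves only scalars for S = T and nothing for
S ≠ T (`hom_hatP_eq_zero`, `exists_eq_smul_id_permMF`). A nullhomotopy of the identity would need
components of negative degree (`id_permMF_ne_zero`). Hence X ↦ (Hom(P̂_{a:λ}, X)) is an equivalence
from the category of finite direct sums to families of finite-dimensional vector spaces over a
finite index set, which is abelian. Closure under tensor products follows from the fusion rule,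
because both tensor functors are additive. -/

namespace LG

/-! ### The `q`-raising operator on coefficient sequences -/

section QRaise

open Polynomial

variable (q : ℂ)

/-- The raising operator `a(X) ↦ X a(X) + a(q X)`. -/
noncomputable def qRaise : ℂ[X] →ₗ[ℂ] ℂ[X] :=
  LinearMap.mulLeft ℂ X + (Polynomial.aeval (C q * X : ℂ[X])).toLinearMap

/-- The Jackson derivative, `X ^ (n + 1) ↦ (1 + q + ⋯ + q ^ n) X ^ n`. -/
noncomputable def qDeriv : ℂ[X] →ₗ[ℂ] ℂ[X] where
  toFun a := ∑ k ∈ a.support, C ((∑ i ∈ Finset.range k, q ^ i) * a.coeff k) * X ^ (k - 1)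
  map_add' a b := by
    have := Polynomial.sum_add_index a b
      (fun k c => C ((∑ i ∈ Finset.range k, q ^ i) * c) * X ^ (k - 1)) (by simp)
      (by intros; simp [mul_add, add_mul])
    exact this
  map_smul' c a := by
    have := Polynomial.sum_smul_index a c
      (fun k c => C ((∑ i ∈ Finset.range k, q ^ i) * c) * X ^ (k - 1)) (by simp)
    refine Eq.trans this ?_
    rw [Polynomial.sum_def, RingHom.id_apply, Finset.smul_sum]
    refine Finset.sum_congr rfl fun k _ => ?_
    rw [Polynomial.smul_eq_C_mul]
    simp only [C_mul]
    ring

lemma coeff_qRaise_zero (a : ℂ[X]) : (qRaise q a).coeff 0 = a.coeff 0 := by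
  have : (aeval (C q * X : ℂ[X]) a) = a.comp (C q * X) := rfl
  simp [qRaise, this, comp_C_mul_X_coeff]

lemma coeff_qRaise_succ (a : ℂ[X]) (k : ℕ) :
    (qRaise q a).coeff (k + 1) = a.coeff k + q ^ (k + 1) * a.coeff (k + 1) := by
  have : (aeval (C q * X : ℂ[X]) a) = a.comp (C q * X) := rfl
  simp [qRaise, this, comp_C_mul_X_coeff, mul_comm (a.coeff _)]

lemma coeff_qDeriv (a : ℂ[X]) (k : ℕ) :
    (qDeriv q a).coeff k = (∑ i ∈ Finset.range (k + 1), q ^ i) * a.coeff (k + 1) := by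
  change (∑ k ∈ a.support, C ((∑ i ∈ Finset.range k, q ^ i) * a.coeff k) * X ^ (k - 1)).coeff k = _
  rw [finsetSum_coeff, Finset.sum_eq_single (k + 1)]
  · rw [Nat.add_sub_cancel, coeff_C_mul, coeff_X_pow_self, mul_one]
  · intro b _ hb
    rw [coeff_C_mul, coeff_X_pow]
    split_ifs with h
    · obtain rfl : b = 0 := by omega
      simp
    · simp
  · intro h
    simp [notMem_support_iff.mp h]

/-- The q-Heisenberg relation D E = 1 + q E D. On coefficients it is the recursion [k+2] = 1 + q
[k+1] for q-integers. -/
lemma qDeriv_qRaise (a : ℂ[X]) : qDeriv q (qRaise q a) = a + q • qRaise q (qDeriv q a) := by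
  ext k
  rw [coeff_qDeriv, coeff_qRaise_succ, coeff_add, coeff_smul, smul_eq_mul]
  rcases k with _ | k
  · rw [coeff_qRaise_zero, coeff_qDeriv]
    simp
  · have h := Finset.sum_range_succ' (fun i => q ^ i) (k + 1)
    simp only [pow_succ, ← Finset.sum_mul, pow_zero] at h
    rw [coeff_qRaise_succ, coeff_qDeriv, coeff_qDeriv, h]
    ring

variable {q}

/-- The operator E is lower triangular on coefficient sequences, with the nonzero diagonal entries
q^k. The first coefficients of `a` are therefore determined by the first coefficients of any
iterate. -/
lemma eq_zero_of_qRaise_iterate_low (hq : q ≠ 0) {j : ℕ} (n : ℕ) {a : ℂ[X]}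
    (h : ∀ k ≤ j, ((qRaise q)^[n] a).coeff k = 0) : ∀ k ≤ j, a.coeff k = 0 := by
  induction n with
  | zero => exact h
  | succ n ih =>
    apply ih
    rw [Function.iterate_succ_apply'] at h
    intro k
    induction k with
    | zero =>
      intro hk
      rw [← coeff_qRaise_zero q]
      exact h 0 hk
    | succ k ihk =>
      intro hk
      have h1 := h (k + 1) hk
      rw [coeff_qRaise_succ, ihk (by omega), zero_add] at h1
      exact (mul_eq_zero.mp h1).resolve_left (pow_ne_zero _ hq)

lemma qRaise_high {j : ℕ} {a : ℂ[X]} (h : ∀ k, j < k → a.coeff k = 0) :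
    ∀ k, j + 1 < k → (qRaise q a).coeff k = 0 := by
  intro k hk
  obtain ⟨k, rfl⟩ : ∃ l, k = l + 1 := ⟨k - 1, by omega⟩
  rw [coeff_qRaise_succ, h k (by omega), h (k + 1) (by omega)]
  simp

lemma qRaise_iterate_high {j : ℕ} (n : ℕ) {a : ℂ[X]} (h : ∀ k, j < k → a.coeff k = 0) :
    ∀ k, j + n < k → ((qRaise q)^[n] a).coeff k = 0 := by
  induction n with
  | zero => exact h
  | succ n ih => rw [Function.iterate_succ_apply']; exact qRaise_high ih

/-- The entries of E just below the diagonal are 1, so each application raises the degree by exactly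
one and keeps the leading coefficient. -/
lemma qRaise_iterate_top {j : ℕ} (n : ℕ) {a : ℂ[X]} (h : ∀ k, j < k → a.coeff k = 0) :
    ((qRaise q)^[n] a).coeff (j + n) = a.coeff j := by
  induction n with
  | zero => rfl
  | succ n ih =>
    rw [Function.iterate_succ_apply', ← add_assoc, coeff_qRaise_succ, ih,
      qRaise_iterate_high n h _ (Nat.lt_succ_self _), mul_zero, add_zero]

lemma qRaise_injective : Function.Injective (qRaise q) := by
  rw [injective_iff_map_eq_zero]
  intro a ha
  by_contra h
  have h1 := qRaise_iterate_top (q := q) 1 (a := a) (j := a.natDegree)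
    fun k hk => coeff_eq_zero_of_natDegree_lt hk
  rw [Function.iterate_one, ha] at h1
  exact h (leadingCoeff_eq_zero.mp h1.symm)

/-- A Jackson derivative uses up one raising without enlarging the degree bound on the argument: D E
a = a + q E D a, where D lowers the degree and E restores it. If D E^(n+1) a = E^(n+1-1) b, then D
E^(n+2) a = E^(n+1) (a + q b), again by the commutation relation. -/
lemma qDeriv_qRaise_iterate {j : ℕ} (n : ℕ) {a : ℂ[X]} (h : ∀ k, j < k → a.coeff k = 0) :
    ∃ b : ℂ[X], (∀ k, j < k → b.coeff k = 0) ∧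
      qDeriv q ((qRaise q)^[n + 1] a) = (qRaise q)^[n] b := by
  induction n with
  | zero =>
    refine ⟨a + q • qRaise q (qDeriv q a), fun k hk => ?_, qDeriv_qRaise q a⟩
    obtain ⟨k, rfl⟩ : ∃ l, k = l + 1 := ⟨k - 1, by omega⟩
    rw [coeff_add, coeff_smul, coeff_qRaise_succ, coeff_qDeriv, coeff_qDeriv, h _ hk,
      h _ (hk.trans (Nat.lt_succ_self _))]
    simp
  | succ n ih =>
    obtain ⟨b, hb, e⟩ := ih
    refine ⟨a + q • b, fun k hk => by simp [h k hk, hb k hk], ?_⟩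
    rw [Function.iterate_succ_apply' _ (n + 1), qDeriv_qRaise, e, ← Module.End.pow_apply,
      ← Module.End.pow_apply, ← Module.End.pow_apply, map_add, map_smul, Module.End.pow_apply,
      Module.End.pow_apply, Module.End.pow_apply, Function.iterate_succ_apply' _ n b]

lemma qDeriv_iterate_qRaise_iterate {j : ℕ} (m n : ℕ) {a : ℂ[X]}
    (h : ∀ k, j < k → a.coeff k = 0) :
    ∃ b : ℂ[X], (∀ k, j < k → b.coeff k = 0) ∧
      (qDeriv q)^[m] ((qRaise q)^[m + n] a) = (qRaise q)^[n] b := by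
  induction m generalizing n with
  | zero => exact ⟨a, h, by simp⟩
  | succ m ih =>
    obtain ⟨b, hb, e⟩ := ih (n + 1)
    obtain ⟨c, hc, e'⟩ := qDeriv_qRaise_iterate (q := q) n hb
    refine ⟨c, hc, ?_⟩
    rw [Function.iterate_succ_apply', show m + 1 + n = m + (n + 1) by ring, e, e']

/-- D^m shifts the sequence down by m places up to products of q-integers. A window starting at m is
thereby moved to the beginning of the sequence. -/
lemma coeff_qDeriv_iterate (m k : ℕ) (a : ℂ[X]) :
    ((qDeriv q)^[m] a).coeff k =
      (∏ s ∈ Finset.range m, ∑ i ∈ Finset.range (k + s + 1), q ^ i) * a.coeff (k + m) := by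
  induction m generalizing k with
  | zero => simp
  | succ m ih =>
    rw [Function.iterate_succ_apply', coeff_qDeriv, ih, Finset.prod_range_succ', ← mul_assoc,
      mul_comm (∑ i ∈ Finset.range (k + 1), q ^ i)]
    simp only [add_assoc, add_comm 1, add_zero]

lemma qInt_ne_zero {d : ℕ} (hq : IsPrimitiveRoot q d) {k : ℕ} (h0 : 0 < k) (hk : k < d) :
    ∑ i ∈ Finset.range k, q ^ i ≠ 0 := by
  intro h
  have := mul_geom_sum q k
  rw [h, mul_zero, eq_comm, sub_eq_zero] at this
  exact hq.pow_ne_one_of_pos_of_lt h0.ne' hk this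

/-- A power of the raising operator is injective even after deleting a window of coefficients. -/
lemma eq_zero_of_qRaise_iterate_window {d : ℕ} (hq : IsPrimitiveRoot q d) {j s n : ℕ}
    (hd : s + n + j < d) {a : ℂ[X]} (h : ∀ k, j < k → a.coeff k = 0)
    (hw : ∀ k, s ≤ k → k ≤ s + j → ((qRaise q)^[s + n] a).coeff k = 0) : a = 0 := by
  have hq0 : q ≠ 0 := hq.ne_zero (by omega)
  set F := (qRaise q)^[s + n] a with hF
  obtain ⟨b, hb, e⟩ := qDeriv_iterate_qRaise_iterate (q := q) s n h
  -- The window of F = E^(s+n) a sits, up to factors, at the start of D^s F = E^n b. Triangularity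
  -- of E^n then kills the coefficients 0, …, j of b, and b has no others.
  have hb0 : b = 0 := by
    ext k
    rcases Nat.lt_or_ge j k with hk | hk
    · exact hb k hk
    · refine eq_zero_of_qRaise_iterate_low hq0 n (fun k hk => ?_) k hk
      rw [← e, coeff_qDeriv_iterate, ← hF, hw (k + s) (by omega) (by omega), mul_zero]
  -- Now D^s F = 0. The q-integers that relate it to F have index at most j + s + n < d and are
  -- invertible, so F vanishes from s onwards, although its leading coefficient is that of `a`.
  have hFk : ∀ k, s ≤ k → F.coeff k = 0 := by
    intro k hk
    rcases Nat.lt_or_ge (j + (s + n)) k with hk' | hk'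
    · exact qRaise_iterate_high _ h _ hk'
    · have h1 := coeff_qDeriv_iterate (q := q) s (k - s) F
      rw [hF, e, hb0, ← Module.End.pow_apply, map_zero, coeff_zero, Nat.sub_add_cancel hk] at h1
      refine (mul_eq_zero.mp h1.symm).resolve_left (Finset.prod_ne_zero_iff.mpr fun t ht => ?_)
      rw [Finset.mem_range] at ht
      exact qInt_ne_zero hq (by omega) (by omega)
  by_contra ha
  have h1 := qRaise_iterate_top (q := q) (s + n) (a := a) (j := a.natDegree)
    fun k hk => coeff_eq_zero_of_natDegree_lt hk
  rw [← hF, hFk _ (by omega)] at h1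
  exact ha (leadingCoeff_eq_zero.mp h1.symm)

variable (q) in
/-- `(-1) ^ k q ^ (k (k - 1) / 2)`. -/
noncomputable def qSign (k : ℕ) : ℂ := ∏ j ∈ Finset.range k, (-q ^ j)

lemma qSign_succ (k : ℕ) : qSign q (k + 1) = qSign q k * -q ^ k := Finset.prod_range_succ _ _

lemma qSign_ne_zero (hq : q ≠ 0) (k : ℕ) : qSign q k ≠ 0 :=
  Finset.prod_ne_zero_iff.mpr fun _ _ => neg_ne_zero.mpr (pow_ne_zero _ hq)

/-- The sum telescopes. Behind this lies the meaning of the pairing as the value at x = z = 0 of the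
element with the given coefficients: E is multiplication by x - q^D z, which is zero there. -/
lemma sum_qSign_qRaise {M : ℕ} {a : ℂ[X]} (h : ∀ k, M < k → a.coeff k = 0) :
    ∑ k ∈ Finset.range (M + 2), (qRaise q a).coeff k * qSign q k = 0 := by
  have h1 : ∀ k, (qRaise q a).coeff (k + 1) * qSign q (k + 1) =
      q ^ (k + 1) * a.coeff (k + 1) * qSign q (k + 1) - q ^ k * a.coeff k * qSign q k := by
    intro k
    rw [coeff_qRaise_succ, qSign_succ]
    ring
  rw [Finset.sum_range_succ', Finset.sum_congr rfl fun k _ => h1 k,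
    Finset.sum_range_sub fun k => q ^ k * a.coeff k * qSign q k, coeff_qRaise_zero,
    h (M + 1) (Nat.lt_succ_self _)]
  ring

/-- The pairing with `qSign` is the only obstruction to lying in the image of E. Since E(X^M) =
X^(M+1) + q^M X^M, the top coefficient can be removed step by step. The preimage keeps the lower end
of the support and loses one place at the upper end, and both bounds matter for the window argument
in `exists_qClebschGordan`. -/
lemma exists_eq_qRaise (hq : q ≠ 0) {m : ℕ} (M : ℕ) {c : ℂ[X]} (hm : ∀ k, k < m → c.coeff k = 0)
    (hM : ∀ k, M < k → c.coeff k = 0)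
    (hc : ∑ k ∈ Finset.range (M + 1), c.coeff k * qSign q k = 0) :
    ∃ b : ℂ[X], (∀ k, k < m → b.coeff k = 0) ∧ (∀ k, M ≤ k → b.coeff k = 0) ∧
      qRaise q b = c := by
  induction M generalizing c with
  | zero =>
    refine ⟨0, by simp, by simp, ?_⟩
    rw [map_zero]
    ext k
    rcases k with _ | k
    · simpa [qSign, eq_comm] using hc
    · simp [hM]
  | succ M ih =>
    -- If M < m, only the coefficient at M + 1 can be nonzero, and the pairing forces it to vanish.
    -- Otherwise X^M is an admissible term of the preimage.
    rcases Nat.lt_or_ge M m with hmM | hmM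
    · refine ⟨0, by simp, by simp, ?_⟩
      have h1 : c.coeff (M + 1) * qSign q (M + 1) = 0 := by
        rw [Finset.sum_range_succ, Finset.sum_eq_zero, zero_add] at hc
        · exact hc
        · intro k hk
          rw [Finset.mem_range] at hk
          rw [hm k (by omega), zero_mul]
      have h2 := (mul_eq_zero.mp h1).resolve_right (qSign_ne_zero hq _)
      rw [map_zero]
      ext k
      rcases lt_trichotomy k (M + 1) with hk | rfl | hk
      · simp [hm k (by omega)]
      · simp [h2]
      · simp [hM k hk]
    · have hX : ∀ k, M < k → (X ^ M : ℂ[X]).coeff k = 0 := fun k hk => by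
        rw [coeff_X_pow, if_neg hk.ne']
      have htop : (qRaise q (X ^ M)).coeff (M + 1) = 1 := by
        rw [coeff_qRaise_succ, hX _ (Nat.lt_succ_self _), coeff_X_pow_self]
        simp
      have hlow : ∀ k, k < M → (qRaise q (X ^ M)).coeff k = 0 := by
        intro k hk
        rcases k with _ | k
        · rw [coeff_qRaise_zero, coeff_X_pow, if_neg (by omega)]
        · rw [coeff_qRaise_succ, coeff_X_pow, coeff_X_pow, if_neg (by omega), if_neg (by omega)]
          simp
      obtain ⟨b, hb, hb', e⟩ := ih (c := c - c.coeff (M + 1) • qRaise q (X ^ M)) (by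
          intro k hk
          simp [hm k hk, hlow k (by omega)]) (by
          intro k hk
          rcases eq_or_lt_of_le (Nat.succ_le_of_lt hk) with h | h
          · subst h
            simp [htop]
          · simp [hM k h, qRaise_high hX k h]) (by
          have h1 := sum_qSign_qRaise (q := q) hX
          have h2 : (c - c.coeff (M + 1) • qRaise q (X ^ M)).coeff (M + 1) = 0 := by simp [htop]
          have h3 : ∑ k ∈ Finset.range (M + 2),
              (c - c.coeff (M + 1) • qRaise q (X ^ M)).coeff k * qSign q k = 0 := by
            simp only [coeff_sub, coeff_smul, smul_eq_mul, sub_mul, mul_assoc,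
              Finset.sum_sub_distrib, ← Finset.mul_sum, h1]
            rw [hc]
            ring
          rwa [Finset.sum_range_succ, h2, zero_mul, add_zero] at h3)
      refine ⟨b + c.coeff (M + 1) • X ^ M, ?_, ?_, ?_⟩
      · intro k hk
        rw [coeff_add, hb k hk, coeff_smul, coeff_X_pow, if_neg (by omega)]
        simp
      · intro k hk
        rw [coeff_add, hb' k (by omega), coeff_smul, coeff_X_pow, if_neg (by omega)]
        simp
      · rw [map_add, map_smul, e]
        ring

/-- The coefficients of a `q`-Clebsch-Gordan vector. -/
lemma exists_qClebschGordan {d : ℕ} (hq : IsPrimitiveRoot q d) {i u v : ℕ}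
    (hd : i + u + v + 1 < d) :
    ∃ a : ℂ[X], (∀ k, i < k → a.coeff k = 0) ∧
      (∀ k, u < k → k ≤ u + i → ((qRaise q)^[u + v + 1] a).coeff k = 0) ∧
      ∑ k ∈ Finset.range (i + 1), a.coeff k * qSign q k ≠ 0 ∧
      ∑ k ∈ Finset.range (u + 1), ((qRaise q)^[u + v + 1] a).coeff k * qSign q k ≠ 0 := by
  have hq0 : q ≠ 0 := hq.ne_zero (by omega)
  obtain ⟨a, ha, hai, hw⟩ : ∃ a : ℂ[X], a ≠ 0 ∧ (∀ k, i < k → a.coeff k = 0) ∧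
      ∀ k, u < k → k ≤ u + i → ((qRaise q)^[u + v + 1] a).coeff k = 0 := by
    -- The i coefficients at u + 1, …, u + i are linear functions on a space of dimension i + 1, so
    -- they have a common nonzero zero.
    let f : degreeLT ℂ (i + 1) →ₗ[ℂ] (Fin i → ℂ) :=
      (LinearMap.pi fun s : Fin i => lcoeff ℂ (u + 1 + s) ∘ₗ (qRaise q ^ (u + v + 1))) ∘ₗ
        (degreeLT ℂ (i + 1)).subtype
    have hf : LinearMap.ker f ≠ ⊥ := by
      apply LinearMap.ker_ne_bot_of_finrank_lt
      rw [(degreeLTEquiv ℂ (i + 1)).finrank_eq]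
      simp
    obtain ⟨⟨a, hadeg⟩, hker, hne⟩ := (Submodule.ne_bot_iff _).mp hf
    refine ⟨a, fun h => hne (Subtype.ext h), fun k hk => ?_, fun k h1 h2 => ?_⟩
    · rw [mem_degreeLT] at hadeg
      exact coeff_eq_zero_of_degree_lt (hadeg.trans_le (by exact_mod_cast hk))
    · have := congrFun (LinearMap.mem_ker.mp hker) ⟨k - (u + 1), by omega⟩
      have e : u + 1 + (k - (u + 1)) = k := by omega
      simpa [f, e, Module.End.pow_apply] using this
  set c := (qRaise q)^[u + v + 1] a with hc
  refine ⟨a, hai, hw, fun h => ha ?_, fun h => ha ?_⟩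
  -- If the pairing with `a` vanished, then a = E b with b supported below i. The sequence E^(u+v+2)
  -- b would have i consecutive zeros, as many as b has coefficients.
  · obtain ⟨b, -, hb, e⟩ := exists_eq_qRaise hq0 (m := 0) i (by simp) hai h
    suffices b = 0 by rw [← e, this, map_zero]
    rcases i with _ | j
    · ext k
      simpa using hb k (Nat.zero_le _)
    · refine eq_zero_of_qRaise_iterate_window hq (j := j) (s := u + 1) (n := v + 1) (by omega)
        (fun k hk => hb k hk) fun k h1 h2 => ?_
      rw [show u + 1 + (v + 1) = (u + v + 1) + 1 by ring, Function.iterate_succ_apply, e]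
      exact hw k (by omega) (by omega)
  -- Here c = E^(u+v+1) a is a low part on 0, …, u plus a high part beyond u + i. The total pairing
  -- is zero because c lies in the image of E, so if the low part pairs to zero, so does the high
  -- part, and both are images under E.
  · have hctop : ∀ k, u + v + 1 + i < k → c.coeff k = 0 := fun k hk =>
      qRaise_iterate_high _ hai k (by omega)
    have htot : ∑ k ∈ Finset.range (i + (u + v) + 2), c.coeff k * qSign q k = 0 := by
      rw [hc, Function.iterate_succ_apply']
      exact sum_qSign_qRaise (qRaise_iterate_high _ hai)
    set lo : ℂ[X] := ∑ k ∈ Finset.range (u + 1), C (c.coeff k) * X ^ k with hlo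
    have hlok : ∀ k, lo.coeff k = if k < u + 1 then c.coeff k else 0 := by
      intro k
      simp [hlo, finsetSum_coeff, coeff_X_pow]
    obtain ⟨b, -, hb, e⟩ := exists_eq_qRaise hq0 (m := 0) (c := lo) u (by simp)
      (fun k hk => by rw [hlok, if_neg (by omega)])
      (by
        rw [← h]
        refine Finset.sum_congr rfl fun k hk => ?_
        rw [hlok, if_pos (Finset.mem_range.mp hk)])
    obtain ⟨b', hb1, hb2, e'⟩ := exists_eq_qRaise hq0 (m := u + i + 1) (c := c - lo)
      (i + (u + v) + 1)
      (fun k hk => by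
        rw [coeff_sub, hlok]
        split_ifs with hu
        · simp
        · rw [hw k (by omega) (by omega), sub_zero])
      (fun k hk => by
        rw [coeff_sub, hlok, if_neg (by omega), hctop k (by omega), sub_zero])
      (by
        simp only [coeff_sub, sub_mul, Finset.sum_sub_distrib]
        rw [htot, zero_sub, neg_eq_zero, ← h, ← Finset.sum_subset
          (Finset.range_mono (show u + 1 ≤ i + (u + v) + 1 + 1 by omega))]
        · refine Finset.sum_congr rfl fun k hk => ?_
          rw [hlok, if_pos (Finset.mem_range.mp hk)]
        · intro k _ hk
          rw [hlok, if_neg (by simpa using hk), zero_mul])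
    -- Cancelling one E moves the gap: b lives below u and b' beyond u + i, which leaves the i + 1
    -- zeros u, …, u + i in E^(u+v) a. That is one zero too many.
    have hbb : (qRaise q)^[u + v] a = b + b' := by
      apply qRaise_injective (q := q)
      rw [map_add, e, e', add_sub_cancel, hc, Function.iterate_succ_apply']
    refine eq_zero_of_qRaise_iterate_window hq (j := i) (s := u) (n := v) (by omega) hai
      fun k h1 h2 => ?_
    rw [hbb, coeff_add, hb k h1, hb1 k (by omega), add_zero]

end QRaise
end LG

namespace LG

/-! ### Shifted `q`-powers -/

section QPoch

open Polynomial

variable (q : ℂ) {A : Type} [CommRing A] [Algebra ℂ A]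

/-- `∏_{j < n} (a - q ^ j b)`. -/
noncomputable def qPoch (a b : A) (n : ℕ) : A := ∏ j ∈ Finset.range n, (a - q ^ j • b)

variable {q}

lemma qPoch_succ (a b : A) (n : ℕ) : qPoch q a b (n + 1) = qPoch q a b n * (a - q ^ n • b) :=
  Finset.prod_range_succ _ _

lemma qPoch_add (a b : A) (m n : ℕ) :
    qPoch q a b (m + n) = qPoch q a b m * qPoch q a (q ^ m • b) n := by
  rw [qPoch, Finset.prod_range_add]
  congr 1
  refine Finset.prod_congr rfl fun k _ => ?_
  rw [smul_smul, ← pow_add, add_comm k]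

lemma qPoch_smul (c : ℂ) (a b : A) (n : ℕ) :
    qPoch q (c • a) (c • b) n = c ^ n • qPoch q a b n := by
  induction n with
  | zero => simp [qPoch]
  | succ n ih =>
    rw [qPoch_succ, qPoch_succ, ih, smul_comm _ c, ← smul_sub, smul_mul_smul_comm, pow_succ]

lemma qPoch_zero_left (b : A) (n : ℕ) : qPoch q 0 b n = qSign q n • b ^ n := by
  induction n with
  | zero => simp [qPoch, qSign]
  | succ n ih =>
    rw [qPoch_succ, ih, qSign_succ, pow_succ b, zero_sub, ← neg_smul, smul_mul_smul_comm]

lemma qPoch_zero_right (a : A) (n : ℕ) : qPoch q a 0 n = a ^ n := by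
  simp [qPoch]

lemma map_qPoch {B : Type} [CommRing B] [Algebra ℂ B] (f : A →ₐ[ℂ] B) (a b : A) (n : ℕ) :
    f (qPoch q a b n) = qPoch q (f a) (f b) n := by
  simp [qPoch]

variable (q) in
/-- The element `∑ k, a_k (x; y)_k (y; z)_{D - k}` with coefficient sequence `a`. -/
noncomputable def qExpand (x y z : A) (D : ℕ) (a : ℂ[X]) : A :=
  ∑ k ∈ Finset.range (D + 1), a.coeff k • (qPoch q x y k * qPoch q y z (D - k))

/-- Splitting x - q^D z as (x - q^k y) + q^k (y - q^(D-k) z) extends either the first or the second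
factor of the k-th product by one. The two contributions are the two terms of `qRaise`. -/
lemma mul_qExpand (x y z : A) {D : ℕ} {a : ℂ[X]} (h : ∀ k, D < k → a.coeff k = 0) :
    (x - q ^ D • z) * qExpand q x y z D a = qExpand q x y z (D + 1) (qRaise q a) := by
  have h1 : ∀ k ∈ Finset.range (D + 1), (x - q ^ D • z) * (a.coeff k • (qPoch q x y k *
      qPoch q y z (D - k))) =
      a.coeff k • (qPoch q x y (k + 1) * qPoch q y z (D + 1 - (k + 1))) +
      (q ^ k * a.coeff k) • (qPoch q x y k * qPoch q y z (D + 1 - k)) := by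
    intro k hk
    rw [Finset.mem_range] at hk
    have e : x - q ^ D • z = (x - q ^ k • y) + q ^ k • (y - q ^ (D - k) • z) := by
      rw [smul_sub, smul_smul, ← pow_add, show k + (D - k) = D by omega]
      abel
    rw [e, show D + 1 - k = (D - k) + 1 by omega, Nat.add_sub_add_right, qPoch_succ, qPoch_succ]
    simp only [Algebra.smul_def, map_mul]
    ring
  rw [qExpand, qExpand, Finset.mul_sum, Finset.sum_congr rfl h1, Finset.sum_add_distrib,
    Finset.sum_range_succ' (fun k => (qRaise q a).coeff k • _), coeff_qRaise_zero]
  simp only [coeff_qRaise_succ, add_smul, Finset.sum_add_distrib]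
  rw [add_assoc, Finset.sum_range_succ (fun k => (q ^ (k + 1) * a.coeff (k + 1)) • _),
    h (D + 1) (Nat.lt_succ_self _), mul_zero, zero_smul, add_zero,
    Finset.sum_range_succ' (fun k => (q ^ k * a.coeff k) • _)]
  simp

lemma qPoch_mul_qExpand (x y z : A) {i : ℕ} (n : ℕ) {a : ℂ[X]} (h : ∀ k, i < k → a.coeff k = 0) :
    qPoch q x (q ^ i • z) n * qExpand q x y z i a = qExpand q x y z (i + n) ((qRaise q)^[n] a) := by
  induction n with
  | zero => simp [qPoch]
  | succ n ih =>
    rw [qPoch_succ, mul_comm (qPoch _ _ _ _), mul_assoc, ih, Function.iterate_succ_apply',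
      ← add_assoc,
      ← mul_qExpand x y z (qRaise_iterate_high n h), smul_smul, ← pow_add, add_comm n]

/-- In the expansion of the first product, the terms with k ≤ u contain (y;z)_{i+v+1} and add up
exactly to the subtracted product. Those with u < k ≤ u + i vanish by `hw`. The remaining ones
contain (x;y)_{i+u+1}. -/
lemma qPoch_dvd_sub (x y z : A) {i u v : ℕ} {a : ℂ[X]} (h : ∀ k, i < k → a.coeff k = 0)
    (hw : ∀ k, u < k → k ≤ u + i → ((qRaise q)^[u + v + 1] a).coeff k = 0) :
    qPoch q x y (i + u + 1) ∣ qPoch q x (q ^ i • z) (u + v + 1) * qExpand q x y z i a -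
      qPoch q y z (i + v + 1) *
        qExpand q x y (q ^ (i + v + 1) • z) u ((qRaise q)^[u + v + 1] a) := by
  rw [qPoch_mul_qExpand x y z _ h, qExpand, qExpand, Finset.mul_sum,
    show i + (u + v + 1) + 1 = (u + 1) + (i + v + 1) by ring, Finset.sum_range_add,
      add_sub_right_comm]
  refine dvd_add ?_ (Finset.dvd_sum fun k hk => ?_)
  · rw [← Finset.sum_sub_distrib, Finset.sum_eq_zero]
    · exact dvd_zero _
    · intro k hk
      rw [Finset.mem_range] at hk
      rw [show i + (u + v + 1) - k = (i + v + 1) + (u - k) by omega, qPoch_add y z,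
        mul_smul_comm, mul_left_comm, sub_self]
  · rcases Nat.lt_or_ge k i with hki | hki
    · rw [hw _ (by omega) (by omega), zero_smul]
      exact dvd_zero _
    · obtain ⟨e, he⟩ : ∃ e, u + 1 + k = (i + u + 1) + e := ⟨k - i, by omega⟩
      rw [he, qPoch_add x y (i + u + 1) e, mul_assoc]
      rw [Algebra.smul_def]
      exact (dvd_mul_right _ _).mul_left _

/-- This identifies the pairing with `qSign` as the coefficient of the pure power y^D. -/
lemma qExpand_zero_zero (y : A) (D : ℕ) (a : ℂ[X]) :
    qExpand q 0 y 0 D a = (∑ k ∈ Finset.range (D + 1), a.coeff k * qSign q k) • y ^ D := by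
  rw [qExpand, Finset.sum_smul]
  refine Finset.sum_congr rfl fun k hk => ?_
  rw [Finset.mem_range] at hk
  rw [qPoch_zero_left, qPoch_zero_right, smul_mul_assoc, ← pow_add, smul_smul,
    show k + (D - k) = D by omega]

lemma map_qExpand {B : Type} [CommRing B] [Algebra ℂ B] (f : A →ₐ[ℂ] B) (x y z : A) (D : ℕ)
    (a : ℂ[X]) : f (qExpand q x y z D a) = qExpand q (f x) (f y) (f z) D a := by
  simp [qExpand, map_qPoch]

end QPoch
end LG

namespace LG

/-! ### Linear maps that respect gradings -/

/-- An injective graded map detects degrees. -/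
lemma mem_of_injective_of_mem {V W : Type} [AddCommGroup V] [Module ℂ V] [AddCommGroup W]
    [Module ℂ W] {gV : ℂ → Submodule ℂ V} {gW : ℂ → Submodule ℂ W} (hV : iSup gV = ⊤)
    (hW : DirectSum.IsInternal gW) (f : V →ₗ[ℂ] W) (hf : Function.Injective f) (c : ℂ)
    (hfg : ∀ q, ∀ v ∈ gV q, f v ∈ gW (q + c)) {q : ℂ} {v : V} (hv : f v ∈ gW (q + c)) :
    v ∈ gV q := by
  obtain ⟨x, rfl⟩ : ∃ x : DirectSum ℂ fun q => gV q, DirectSum.coeLinearMap gV x = v := by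
    have : v ∈ iSup gV := hV ▸ Submodule.mem_top
    rwa [Submodule.iSup_eq_range_dfinsupp_lsum] at this
  have key : ∀ (x : DirectSum ℂ fun q => gV q) (r : ℂ),
      split hW (f (DirectSum.coeLinearMap gV x)) (r + c) = f (x r) := by
    intro x r
    induction x using DirectSum.induction_on with
    | zero => simp
    | of i v =>
      rw [DirectSum.coeLinearMap_of, split_apply hW (hfg i v v.2), DirectSum.coe_of_apply,
        Finsupp.single_apply]
      simp only [add_left_inj]
      split_ifs <;> simp
    | add x y hx hy => simp [hx, hy]
  have hx : DirectSum.coeLinearMap gV x = x q := by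
    apply hf
    have := key x q
    rwa [split_apply hW hv, Finsupp.single_eq_same] at this
  rw [hx]
  exact (x q).2

lemma iSup_eq_top_of_forall {V : Type} [AddCommGroup V] [Module ℂ V] {gV : ℂ → Submodule ℂ V}
    (h : ∀ v, v ∈ iSup gV) : iSup gV = ⊤ := eq_top_iff.mpr fun v _ => h v

/-! ### Coordinates on the tensor product of two copies of `ℂ[x, y]` -/

section Coordinates

open Polynomial

/-- `ℂ[x, y] ⊗ ℂ[y, z] ≅ ℂ[x, z][y]`. -/
noncomputable def tensorToPoly : BiTensor Bi Bi →ₗ[Bi] Polynomial Bi :=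
  tcoord (Module.Basis.singleton Unit Bi) (Module.Basis.singleton Unit Bi) () ()

lemma tensorToPoly_tmk (m n : Bi) : tensorToPoly (tmk m n) = phiL m * phiR n := by
  rw [tensorToPoly, tcoord_tmk]
  simp

@[simp] lemma phiL_X0 : phiL (MvPolynomial.X 0) = C (MvPolynomial.X 0) := by simp [phiL]
@[simp] lemma phiL_X1 : phiL (MvPolynomial.X 1) = X := by simp [phiL]
@[simp] lemma phiR_X0 : phiR (MvPolynomial.X 0) = X := by simp [phiR]
@[simp] lemma phiR_X1 : phiR (MvPolynomial.X 1) = C (MvPolynomial.X 1) := by simp [phiR]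

/-- The inverse of `tensorToPoly`. -/
noncomputable def polyToTensor : Polynomial Bi →ₗ[Bi] BiTensor Bi Bi :=
  Polynomial.lsum fun k => LinearMap.toSpanSingleton Bi _ (tmk ((MvPolynomial.X 1 : Bi) ^ k) 1)

lemma polyToTensor_monomial (k : ℕ) (p : Bi) :
    polyToTensor (monomial k p) = p • tmk ((MvPolynomial.X 1 : Bi) ^ k) 1 := by
  simp [polyToTensor, Polynomial.lsum_apply]

lemma tensorToPoly_X_pow (k : ℕ) :
    tensorToPoly (tmk ((MvPolynomial.X 1 : Bi) ^ k) 1) = X ^ k := by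
  simp [tensorToPoly_tmk]

/-- `ℂ[x, y] ⊗ ℂ[y, z] ≅ ℂ[x, z][y]`. -/
noncomputable def tensorEquiv : BiTensor Bi Bi ≃ₗ[Bi] Polynomial Bi :=
  LinearEquiv.ofLinearMap tensorToPoly polyToTensor
    (by
      apply Polynomial.lhom_ext'
      intro k
      apply LinearMap.ext
      intro p
      simp [polyToTensor_monomial, tensorToPoly_X_pow, smul_X_eq_monomial])
    (by
      apply (Module.Basis.mk (tbasis_indep (Module.Basis.singleton Unit Bi)
        (Module.Basis.singleton Unit Bi)) (tbasis_span _ _)).ext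
      rintro ⟨i, j, k⟩
      have h1 : tbasisFun (Module.Basis.singleton Unit Bi) (Module.Basis.singleton Unit Bi)
          (i, j, k) = tmk ((MvPolynomial.X 1 : Bi) ^ k) 1 := by
        simp [tbasisFun]
      rw [Module.Basis.mk_apply, h1, LinearMap.comp_apply, tensorToPoly_X_pow,
        ← monomial_one_right_eq_X_pow, polyToTensor_monomial, one_smul]
      rfl)

@[simp] lemma tensorEquiv_tmk (m n : Bi) : tensorEquiv (tmk m n) = phiL m * phiR n :=
  tensorToPoly_tmk m n

lemma tensorEquiv_symm_monomial (k : ℕ) (p : Bi) :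
    tensorEquiv.symm (monomial k p) = p • tmk ((MvPolynomial.X 1 : Bi) ^ k) 1 :=
  polyToTensor_monomial k p

lemma tensorEquiv_tmap_left (p : Bi) (t : BiTensor Bi Bi) :
    tensorEquiv (tmap (LinearMap.lsmul Bi Bi p) LinearMap.id t) = phiL p * tensorEquiv t := by
  induction t using tensor_induction with
  | h0 => simp
  | h1 m n => simp [mul_assoc]
  | h2 s t hs ht => simp only [map_add, hs, ht, mul_add]

lemma tensorEquiv_tmap_right (p : Bi) (t : BiTensor Bi Bi) :
    tensorEquiv (tmap LinearMap.id (LinearMap.lsmul Bi Bi p) t) = phiR p * tensorEquiv t := by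
  induction t using tensor_induction with
  | h0 => simp
  | h1 m n => simp [mul_left_comm]
  | h2 s t hs ht => simp only [map_add, hs, ht, mul_add]

variable (d : ℕ)

/-- Polynomials in `x, y, z` of degree `c`, where all variables have degree `2 / d`. -/
noncomputable def pgr (c : ℂ) : Submodule ℂ (Polynomial Bi) where
  carrier := {P | ∀ k : ℕ, MvPolynomial.IsWeightedHomogeneous (wt d) (P.coeff k) (c - 2 / d * k)}
  zero_mem' k := by
    rw [coeff_zero]
    exact MvPolynomial.isWeightedHomogeneous_zero _ _ _
  add_mem' hP hQ k := by
    rw [coeff_add]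
    exact (hP k).add (hQ k)
  smul_mem' a P hP k := by
    rw [coeff_smul]
    exact (MvPolynomial.weightedHomogeneousSubmodule ℂ (wt d) _).smul_mem a (hP k)

variable {d}

lemma monomial_mem_pgr {c : ℂ} {p : Bi} (hp : MvPolynomial.IsWeightedHomogeneous (wt d) p c)
    (k : ℕ) : monomial k p ∈ pgr d (c + 2 / d * k) := by
  intro l
  rw [coeff_monomial]
  split_ifs with h
  · subst h; rwa [add_sub_cancel_right]
  · exact MvPolynomial.isWeightedHomogeneous_zero _ _ _

lemma C_mem_pgr {c : ℂ} {p : Bi} (hp : MvPolynomial.IsWeightedHomogeneous (wt d) p c) :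
    C p ∈ pgr d c := by
  simpa using monomial_mem_pgr hp 0

lemma one_mem_pgr : (1 : Polynomial Bi) ∈ pgr d 0 :=
  C_mem_pgr (MvPolynomial.isWeightedHomogeneous_one ℂ (wt d))

lemma X_mem_pgr : (X : Polynomial Bi) ∈ pgr d (2 / d) := by
  simpa [monomial_one_one_eq_X] using
    monomial_mem_pgr (MvPolynomial.isWeightedHomogeneous_one ℂ (wt d)) 1

lemma mul_mem_pgr {a b : ℂ} {P Q : Polynomial Bi} (hP : P ∈ pgr d a) (hQ : Q ∈ pgr d b) :
    P * Q ∈ pgr d (a + b) := by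
  intro k
  rw [coeff_mul]
  refine MvPolynomial.IsWeightedHomogeneous.sum _ _ _ fun x hx => ?_
  have e : a + b - 2 / d * k = (a - 2 / d * x.1) + (b - 2 / d * x.2) := by
    rw [← Finset.HasAntidiagonal.mem_antidiagonal.mp hx]
    push_cast
    ring
  rw [e]
  exact (hP _).mul (hQ _)

lemma prod_mem_pgr {ι : Type} (s : Finset ι) (f : ι → Polynomial Bi) {c : ℂ}
    (h : ∀ i ∈ s, f i ∈ pgr d c) : ∏ i ∈ s, f i ∈ pgr d (c * s.card) := by
  classical
  induction s using Finset.induction_on with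
  | empty => simpa using one_mem_pgr
  | insert i s hi ih =>
    rw [Finset.prod_insert hi, Finset.card_insert_of_notMem hi]
    have := mul_mem_pgr (h i (by simp)) (ih fun j hj => h j (by simp [hj]))
    convert this using 2
    push_cast
    ring

lemma pow_mem_pgr {P : Polynomial Bi} {c : ℂ} (h : P ∈ pgr d c) (n : ℕ) :
    P ^ n ∈ pgr d (c * n) := by
  simpa using prod_mem_pgr (Finset.range n) (fun _ => P) fun _ _ => h

lemma exists_sum_homog (p : Bi) :
    p ∈ ⨆ c : ℂ, MvPolynomial.weightedHomogeneousSubmodule ℂ (wt d) c := by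
  rw [p.as_sum]
  exact Submodule.sum_mem _ fun m _ => Submodule.mem_iSup_of_mem _
    (MvPolynomial.isWeightedHomogeneous_monomial (wt d) m _ rfl)

lemma algHom_mem_pgr (f : Bi →ₐ[ℂ] Polynomial Bi)
    (hf : ∀ i, f (MvPolynomial.X i) ∈ pgr d (2 / d)) {c : ℂ} {p : Bi}
    (hp : MvPolynomial.IsWeightedHomogeneous (wt d) p c) : f p ∈ pgr d c := by
  rw [MvPolynomial.as_sum p, map_sum]
  refine Submodule.sum_mem _ fun e he => ?_
  have hmon : (MvPolynomial.monomial e (p.coeff e) : Bi) =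
      p.coeff e • (MvPolynomial.X 0 ^ e 0 * MvPolynomial.X 1 ^ e 1) := by
    rw [MvPolynomial.monomial_eq, Finsupp.prod_fintype _ _ (by simp), MvPolynomial.smul_eq_C_mul]
    simp
  have hc : c = 2 / d * (e 0 : ℂ) + 2 / d * (e 1 : ℂ) := by
    rw [← hp (MvPolynomial.mem_support_iff.mp he), Finsupp.weight_apply,
      Finsupp.sum_fintype _ _ (by simp)]
    simp [wt, mul_comm]
  rw [hmon, hc, map_smul, map_mul, map_pow, map_pow]
  exact Submodule.smul_mem _ _ (mul_mem_pgr (pow_mem_pgr (hf 0) _) (pow_mem_pgr (hf 1) _))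

lemma C_X_mem_pgr (i : Fin 2) : (C (MvPolynomial.X i) : Polynomial Bi) ∈ pgr d (2 / d) :=
  C_mem_pgr (MvPolynomial.isWeightedHomogeneous_X ℂ (wt d) i)

lemma phiL_mem_pgr {c : ℂ} {p : Bi} (hp : MvPolynomial.IsWeightedHomogeneous (wt d) p c) :
    phiL p ∈ pgr d c := by
  refine algHom_mem_pgr _ (fun i => ?_) hp
  fin_cases i
  · simpa using C_X_mem_pgr 0
  · simpa using X_mem_pgr

lemma phiR_mem_pgr {c : ℂ} {p : Bi} (hp : MvPolynomial.IsWeightedHomogeneous (wt d) p c) :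
    phiR p ∈ pgr d c := by
  refine algHom_mem_pgr _ (fun i => ?_) hp
  fin_cases i
  · simpa using X_mem_pgr
  · simpa using C_X_mem_pgr 1

lemma pgr_iSup : (⨆ c, pgr d c) = ⊤ := by
  refine iSup_eq_top_of_forall fun P => ?_
  rw [P.as_sum_support]
  refine Submodule.sum_mem _ fun k _ => ?_
  refine Submodule.iSup_induction _ (motive := fun p => monomial k p ∈ _)
    (exists_sum_homog (d := d) (P.coeff k)) (fun c p hp => ?_) (by simp) (fun p r hp hr => ?_)
  · exact Submodule.mem_iSup_of_mem _ (monomial_mem_pgr hp k)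
  · rw [map_add]; exact add_mem hp hr

lemma tensorEquiv_mem_pgr {α β q : ℂ} {t : BiTensor Bi Bi}
    (ht : t ∈ tgr (GrBimod.poly d α) (GrBimod.poly d β) q) :
    tensorEquiv t ∈ pgr d (q - α - β) := by
  induction ht using Submodule.span_induction with
  | mem x hx =>
    obtain ⟨a, b, m, n, rfl, hm, hn, rfl⟩ := hx
    have := mul_mem_pgr (phiL_mem_pgr hm) (phiR_mem_pgr hn)
    rw [show a - α + (b - β) = a + b - α - β by ring] at this
    rw [tensorEquiv_tmk]
    exact this
  | zero => rw [map_zero]; exact zero_mem _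
  | add x y _ _ hx hy => rw [map_add]; exact add_mem hx hy
  | smul c x _ hx => 
    rw [← smulC_eq, map_smul, smulC_eq]
    exact Submodule.smul_mem _ c hx

lemma tensorEquiv_symm_mem {α β q : ℂ} {P : Polynomial Bi} (hP : P ∈ pgr d (q - α - β)) :
    tensorEquiv.symm P ∈ tgr (GrBimod.poly d α) (GrBimod.poly d β) q := by
  rw [P.as_sum_support, map_sum]
  refine Submodule.sum_mem _ fun k _ => ?_
  have h1 : (MvPolynomial.X 1 : Bi) ^ k ∈ (GrBimod.poly d α).gr (2 / d * k + α) := by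
    change MvPolynomial.IsWeightedHomogeneous (wt d) _ _
    have := (MvPolynomial.isWeightedHomogeneous_X ℂ (wt d) (1 : Fin 2)).pow k
    simpa [wt, mul_comm] using this
  have h2 : (1 : Bi) ∈ (GrBimod.poly d β).gr β := by
    change MvPolynomial.IsWeightedHomogeneous (wt d) _ _
    rw [sub_self]
    exact MvPolynomial.isWeightedHomogeneous_one ℂ (wt d)
  have h3 := ((GrBimod.poly d α).tensor (GrBimod.poly d β)).smul_mem (hP k) (tmk_mem_tgr h1 h2)
  rw [tensorEquiv_symm_monomial]
  rw [show q - α - β - 2 / d * k + (2 / d * k + α + β) = q by ring] at h3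
  exact h3

/-- The decomposition is carried over from the tensor product of two unshifted copies of ℂ[x,y]
through `tensorEquiv`. -/
lemma pgr_internal : DirectSum.IsInternal (pgr d) := by
  have h0 := tgr_internal (GrBimod.poly d 0) (GrBimod.poly d 0)
  refine isInternal_of_split _
    ((Finsupp.mapRange.linearMap ((tensorEquiv.toLinearMap.restrictScalars ℂ))) ∘ₗ split h0 ∘ₗ
      (tensorEquiv.symm.toLinearMap.restrictScalars ℂ)) (fun q v hv => ?_) pgr_iSup
  have h1 : tensorEquiv.symm v ∈ tgr (GrBimod.poly d 0) (GrBimod.poly d 0) q :=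
    tensorEquiv_symm_mem (by simpa using hv)
  have h2 := split_apply h0 h1
  simp [h2]

/-- A nonzero homogeneous factor of a homogeneous polynomial has a homogeneous cofactor. -/
lemma mem_pgr_of_mul_mem {a c : ℂ} {P Q : Polynomial Bi} (hP : P ∈ pgr d a) (hP0 : P ≠ 0)
    (h : P * Q ∈ pgr d (c + a)) : Q ∈ pgr d c :=
  mem_of_injective_of_mem pgr_iSup pgr_internal (LinearMap.mulLeft ℂ P)
    (fun _ _ h => mul_left_cancel₀ hP0 h) a
    (fun q v hv => by rw [add_comm]; exact mul_mem_pgr hP hv) h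

end Coordinates
end LG

namespace LG

/-! ### Homogeneous polynomials that are monic in y up to a scalar, and division by them -/

section Top

open Polynomial

/-- Setting `x = z = 0`. -/
noncomputable def evTop : Polynomial Bi →ₐ[ℂ] ℂ[X] :=
  Polynomial.mapAlgHom (MvPolynomial.aeval (fun _ => (0 : ℂ)))

@[simp] lemma evTop_C_X (i : Fin 2) : evTop (C (MvPolynomial.X i)) = 0 := by
  simp [evTop]

@[simp] lemma evTop_X : evTop X = X := by simp [evTop]

lemma coeff_evTop (P : Polynomial Bi) (k : ℕ) :
    (evTop P).coeff k = MvPolynomial.constantCoeff (P.coeff k) := by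
  simp [evTop, MvPolynomial.constantCoeff_eq, MvPolynomial.eval_zero']

variable (d : ℕ)

/-- `P` is homogeneous of degree `e` in `x, y, z`, and `y ^ e` occurs in `P`. -/
def HasTop (e : ℕ) (P : Polynomial Bi) : Prop :=
  P ∈ pgr d (2 / d * e) ∧ ∃ c : ℂ, c ≠ 0 ∧ evTop P = c • X ^ e

variable {d}

lemma HasTop.mul {e f : ℕ} {P Q : Polynomial Bi} (hP : HasTop d e P) (hQ : HasTop d f Q) :
    HasTop d (e + f) (P * Q) := by
  obtain ⟨h1, c, hc, h2⟩ := hP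
  obtain ⟨k1, b, hb, k2⟩ := hQ
  refine ⟨?_, c * b, mul_ne_zero hc hb, by rw [map_mul, h2, k2, smul_mul_smul_comm, pow_add]⟩
  rw [Nat.cast_add, mul_add]
  exact mul_mem_pgr h1 k1

lemma hasTop_one : HasTop d 0 1 := ⟨by simpa using one_mem_pgr, 1, one_ne_zero, by simp⟩

lemma hasTop_X : HasTop d 1 X := ⟨by simpa using X_mem_pgr, 1, one_ne_zero, by simp⟩

lemma hasTop_X_pow (e : ℕ) : HasTop d e (X ^ e) := by
  induction e with
  | zero => simpa using hasTop_one
  | succ e ih => rw [pow_succ]; exact ih.mul hasTop_X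

lemma hasTop_prod {ι : Type} (s : Finset ι) (f : ι → Polynomial Bi)
    (h : ∀ i ∈ s, HasTop d 1 (f i)) : HasTop d s.card (∏ i ∈ s, f i) := by
  classical
  induction s using Finset.induction_on with
  | empty => simpa using hasTop_one
  | insert i s hi ih =>
    rw [Finset.prod_insert hi, Finset.card_insert_of_notMem hi, add_comm]
    exact (h i (by simp)).mul (ih fun j hj => h j (by simp [hj]))

lemma degree_eq_of_coeff_ne_zero [NeZero d] {p : Bi} {r : ℂ}
    (hp : MvPolynomial.IsWeightedHomogeneous (wt d) p (2 / d * r)) {m : Fin 2 →₀ ℕ}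
    (hm : p.coeff m ≠ 0) : ((m 0 + m 1 : ℕ) : ℂ) = r := by
  have h := hp hm
  rw [Finsupp.weight_apply, Finsupp.sum_fintype _ _ (by simp)] at h
  simp only [wt, Fin.sum_univ_two, nsmul_eq_mul] at h
  have hd : (d : ℂ) ≠ 0 := NeZero.ne _
  rw [← add_mul, mul_comm] at h
  push_cast
  exact mul_left_cancel₀ (div_ne_zero two_ne_zero hd) h

/-- The degrees that occur in ℂ[x,y] are the natural multiples of 2/d. All vanishing of morphisms
and homotopies below comes from a degree that is not of this kind. -/
lemma eq_zero_of_degree [NeZero d] {p : Bi} {r : ℂ}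
    (hp : MvPolynomial.IsWeightedHomogeneous (wt d) p (2 / d * r))
    (hr : ∀ n : ℕ, (n : ℂ) ≠ r) : p = 0 := by
  ext m
  by_contra h
  exact hr _ (degree_eq_of_coeff_ne_zero hp h)

lemma eq_C_of_degree_zero [NeZero d] {p : Bi}
    (hp : MvPolynomial.IsWeightedHomogeneous (wt d) p 0) :
    p = MvPolynomial.C (MvPolynomial.constantCoeff p) := by
  ext m
  rw [MvPolynomial.coeff_C]
  split_ifs with h
  · rw [← h, MvPolynomial.constantCoeff_eq]
  · by_contra hm
    rw [← mul_zero (2 / d : ℂ)] at hp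
    have := degree_eq_of_coeff_ne_zero hp hm
    apply h
    have h2 : m 0 + m 1 = 0 := by exact_mod_cast this
    ext i
    fin_cases i <;> simp <;> omega

lemma HasTop.coeff_eq_zero [NeZero d] {e : ℕ} {P : Polynomial Bi} (hP : HasTop d e P) {k : ℕ}
    (hk : e < k) : P.coeff k = 0 := by
  have h := hP.1 k
  rw [← mul_sub] at h
  refine eq_zero_of_degree h fun n hn => ?_
  have h2 : ((n + k : ℕ) : ℂ) = e := by push_cast; rw [hn]; ring
  have h3 : n + k = e := by exact_mod_cast h2
  omega

/-- By homogeneity the coefficient of y^e has degree 0 in the outer variables, so it is a constant,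
which is seen at x = z = 0. This makes division with remainder over ℂ[x,z] possible. -/
lemma HasTop.coeff_top [NeZero d] {e : ℕ} {P : Polynomial Bi} (hP : HasTop d e P) :
    ∃ c : ℂ, c ≠ 0 ∧ P.coeff e = MvPolynomial.C c := by
  obtain ⟨h, c, hc, h2⟩ := hP
  refine ⟨c, hc, ?_⟩
  have h3 := h e
  rw [sub_self] at h3
  rw [eq_C_of_degree_zero h3, ← coeff_evTop, h2]
  simp

lemma HasTop.natDegree_eq [NeZero d] {e : ℕ} {P : Polynomial Bi} (hP : HasTop d e P) :
    P.natDegree = e := by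
  obtain ⟨c, hc, h⟩ := hP.coeff_top
  apply le_antisymm
  · exact natDegree_le_iff_coeff_eq_zero.mpr fun k hk => hP.coeff_eq_zero hk
  · apply le_natDegree_of_ne_zero
    rw [h]
    exact (map_ne_zero_iff _ (MvPolynomial.C_injective _ _)).mpr hc

lemma HasTop.ne_zero [NeZero d] {e : ℕ} {P : Polynomial Bi} (hP : HasTop d e P) : P ≠ 0 := by
  rintro rfl
  obtain ⟨c, hc, h⟩ := hP.coeff_top
  rw [coeff_zero, eq_comm, MvPolynomial.C_eq_zero] at h
  exact hc h

/-- `(b, u) ↦ ∑ i, b_i g_i + R u`. -/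
noncomputable def divMap {n : ℕ} (g : Fin n → Polynomial Bi) (R : Polynomial Bi) :
    ((Fin n → Bi) × Polynomial Bi) →ₗ[Bi] Polynomial Bi :=
  (Fintype.linearCombination Bi g).coprod (LinearMap.mulLeft Bi R)

lemma divMap_apply {n : ℕ} (g : Fin n → Polynomial Bi) (R : Polynomial Bi)
    (b : Fin n → Bi) (u : Polynomial Bi) : divMap g R (b, u) = ∑ i, b i • g i + R * u := by
  simp [divMap, Fintype.linearCombination_apply]

variable [NeZero d] {n : ℕ} {g : Fin n → Polynomial Bi} {R : Polynomial Bi} {σ : Equiv.Perm (Fin n)}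

/-- The g_i have distinct y-degrees below n and R has y-degree n, each with invertible leading
coefficient. The leading term of R u cannot be cancelled by the g_i, and among the g_i with nonzero
coefficient the one of largest y-degree cannot be cancelled by the others. -/
lemma divMap_injective (hg : ∀ i, HasTop d (σ i) (g i)) (hR : HasTop d n R) :
    Function.Injective (divMap g R) := by
  rw [injective_iff_map_eq_zero]
  rintro ⟨b, u⟩ h
  rw [divMap_apply] at h
  have hu : u = 0 := by
    by_contra hu
    have h1 := congrArg (fun P => P.coeff (R.natDegree + u.natDegree)) h
    simp only [coeff_add, coeff_mul_degree_add_degree, finsetSum_coeff, coeff_smul,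
      coeff_zero] at h1
    rw [Finset.sum_eq_zero, zero_add] at h1
    · exact mul_ne_zero (leadingCoeff_ne_zero.mpr hR.ne_zero) (leadingCoeff_ne_zero.mpr hu) h1
    · intro i _
      rw [hR.natDegree_eq, (hg i).coeff_eq_zero (by omega), smul_zero]
  subst hu
  refine Prod.ext (funext fun i => ?_) rfl
  by_contra hi
  obtain ⟨j, hj, hmax⟩ := Finset.exists_max_image (Finset.univ.filter fun i => b i ≠ 0) σ
    ⟨i, by simpa using hi⟩
  rw [Finset.mem_filter] at hj
  have h1 := congrArg (fun P => P.coeff (σ j)) h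
  simp only [mul_zero, add_zero, finsetSum_coeff, coeff_smul,
      coeff_zero] at h1
  obtain ⟨c, hc, e⟩ := (hg j).coeff_top
  rw [Finset.sum_eq_single j, e, smul_eq_mul] at h1
  · exact mul_ne_zero hj.2 ((map_ne_zero_iff _ (MvPolynomial.C_injective _ _)).mpr hc) h1
  · intro k _ hk
    by_cases hbk : b k = 0
    · rw [hbk, zero_smul]
    · have h2 := hmax k (by simpa using hbk)
      have h3 : σ k ≠ σ j := fun h => hk (σ.injective h)
      rw [(hg k).coeff_eq_zero (by omega), smul_zero]
  · simp

/-- The range contains an element with invertible leading coefficient in each y-degree k: one of the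
g_i for k < n and R y^(k-n) otherwise. Strong induction then produces all powers of y. -/
lemma divMap_surjective (hg : ∀ i, HasTop d (σ i) (g i)) (hR : HasTop d n R) :
    Function.Surjective (divMap g R) := by
  rw [← LinearMap.range_eq_top]
  set N := LinearMap.range (divMap g R) with hN
  have key : ∀ k, ∃ P ∈ N, HasTop d k P := by
    intro k
    rcases Nat.lt_or_ge k n with hk | hk
    · refine ⟨g (σ.symm ⟨k, hk⟩), ⟨(Pi.single (σ.symm ⟨k, hk⟩) 1, 0), ?_⟩, ?_⟩
      · rw [divMap_apply, Finset.sum_eq_single (σ.symm ⟨k, hk⟩)]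
        · simp
        · intro j _ hj
          rw [Pi.single_eq_of_ne hj, zero_smul]
        · simp
      · simpa using hg (σ.symm ⟨k, hk⟩)
    · refine ⟨R * X ^ (k - n), ⟨(0, X ^ (k - n)), ?_⟩, ?_⟩
      · rw [divMap_apply]; simp
      · have := hR.mul (hasTop_X_pow (k - n))
        rwa [Nat.add_sub_cancel' hk] at this
  have hX : ∀ k, (X ^ k : Polynomial Bi) ∈ N := by
    intro k
    induction k using Nat.strong_induction_on with
    | _ k ih =>
      obtain ⟨P, hP, hT⟩ := key k
      obtain ⟨c, hc, e⟩ := hT.coeff_top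
      have h1 := P.as_sum_range_C_mul_X_pow
      rw [hT.natDegree_eq, Finset.sum_range_succ, e] at h1
      have h2 : (MvPolynomial.C c : Bi) • (X ^ k : Polynomial Bi) ∈ N := by
        rw [Polynomial.smul_eq_C_mul, eq_sub_of_add_eq' h1.symm]
        refine sub_mem hP (Submodule.sum_mem _ fun l hl => ?_)
        rw [← Polynomial.smul_eq_C_mul]
        exact N.smul_mem _ (ih l (Finset.mem_range.mp hl))
      have h3 := N.smul_mem (MvPolynomial.C c⁻¹ : Bi) h2
      rwa [← mul_smul, ← map_mul, inv_mul_cancel₀ hc, map_one, one_smul] at h3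
  rw [eq_top_iff]
  intro P _
  rw [P.as_sum_support_C_mul_X_pow]
  refine Submodule.sum_mem _ fun k _ => ?_
  rw [← Polynomial.smul_eq_C_mul]
  exact N.smul_mem _ (hX k)

/-- Division by `R` with remainder expressed in the basis `g`. -/
noncomputable def divEquiv (hg : ∀ i, HasTop d (σ i) (g i)) (hR : HasTop d n R) :
    ((Fin n → Bi) × Polynomial Bi) ≃ₗ[Bi] Polynomial Bi :=
  LinearEquiv.ofBijective (divMap g R) ⟨divMap_injective hg hR, divMap_surjective hg hR⟩

lemma divEquiv_symm_mem (hg : ∀ i, HasTop d (σ i) (g i)) (hR : HasTop d n R) {q : ℂ}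
    {P : Polynomial Bi} (hP : P ∈ pgr d q) :
    (∀ i, MvPolynomial.IsWeightedHomogeneous (wt d) (((divEquiv hg hR).symm P).1 i)
      (q - 2 / d * (σ i : ℕ))) ∧ ((divEquiv hg hR).symm P).2 ∈ pgr d (q - 2 / d * n) := by
  -- The shifts are the degrees of g_i and R, so that `divMap` preserves degrees. Being injective,
  -- it also detects them.
  let gV : ℂ → Submodule ℂ ((Fin n → Bi) × Polynomial Bi) := fun q =>
    (Submodule.pi Set.univ fun i =>
      MvPolynomial.weightedHomogeneousSubmodule ℂ (wt d) (q - 2 / d * (σ i : ℕ))).prod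
        (pgr d (q - 2 / d * n))
  have hgV : iSup gV = ⊤ := by
    refine iSup_eq_top_of_forall ?_
    rintro ⟨b, u⟩
    have h1 : (b, u) = (b, 0) + (0, u) := by simp
    rw [h1]
    refine add_mem ?_ ?_
    · have h2 : (b, (0 : Polynomial Bi)) = ∑ i, (Pi.single i (b i), 0) := by
        refine Prod.ext ?_ ?_
        · rw [Prod.fst_sum, Finset.univ_sum_single]
        · rw [Prod.snd_sum, Finset.sum_const_zero]
      rw [h2]
      refine Submodule.sum_mem _ fun i _ => ?_
      refine Submodule.iSup_induction _ 
        (motive := fun p => ((Pi.single i p : Fin n → Bi), (0 : Polynomial Bi)) ∈ iSup gV)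
        (exists_sum_homog (d := d) (b i)) (fun c p hp => ?_) ?_ (fun p r hp hr => ?_)
      · refine Submodule.mem_iSup_of_mem (c + 2 / d * (σ i : ℕ)) ⟨fun j _ => ?_, zero_mem _⟩
        rcases eq_or_ne j i with rfl | hj
        · simpa using hp
        · change (Pi.single i p : Fin n → Bi) j ∈ _
          rw [Pi.single_eq_of_ne hj]
          exact zero_mem _
      · rw [Pi.single_zero]; exact zero_mem _
      · rw [Pi.single_add]
        simpa using add_mem hp hr
    · refine Submodule.iSup_induction _ (motive := fun u => (0, u) ∈ iSup gV)
        (pgr_iSup (d := d) ▸ Submodule.mem_top : u ∈ ⨆ c, pgr d c) (fun c p hp => ?_) ?_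
        (fun p r hp hr => ?_)
      · exact Submodule.mem_iSup_of_mem (c + 2 / d * n) ⟨zero_mem _, by simpa using hp⟩
      · exact zero_mem _
      · simpa using add_mem hp hr
  have h := mem_of_injective_of_mem hgV pgr_internal ((divMap g R).restrictScalars ℂ)
    (divMap_injective hg hR) 0 (fun q v hv => by
      obtain ⟨b, u⟩ := v
      rw [LinearMap.restrictScalars_apply, divMap_apply]
      refine add_mem (Submodule.sum_mem _ fun i _ => ?_) ?_
      · rw [Polynomial.smul_eq_C_mul]
        have := mul_mem_pgr (C_mem_pgr (hv.1 i trivial)) (hg i).1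
        simpa using this
      · have := mul_mem_pgr hR.1 hv.2
        simpa using this) (q := q) (v := (divEquiv hg hR).symm P)
    (by
      have := (divEquiv hg hR).apply_symm_apply P
      change divMap g R _ = _ at this
      rw [LinearMap.restrictScalars_apply, this, add_zero]
      exact hP)
  exact ⟨fun i => h.1 i trivial, h.2⟩

lemma divEquiv_symm_spec (hg : ∀ i, HasTop d (σ i) (g i)) (hR : HasTop d n R) (P : Polynomial Bi) :
    ∑ i, ((divEquiv hg hR).symm P).1 i • g i + R * ((divEquiv hg hR).symm P).2 = P := by
  rw [← divMap_apply]
  exact (divEquiv hg hR).apply_symm_apply P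

lemma divEquiv_symm_eq (hg : ∀ i, HasTop d (σ i) (g i)) (hR : HasTop d n R) {P : Polynomial Bi}
    {b : Fin n → Bi} {u : Polynomial Bi} (h : ∑ i, b i • g i + R * u = P) :
    (divEquiv hg hR).symm P = (b, u) := by
  rw [LinearEquiv.symm_apply_eq, ← h, ← divMap_apply]
  rfl

end Top
end LG

namespace LG

/-! ### Direct sums in preadditive categories -/

section DirectSum

variable {C : Type*} [Category C] [Preadditive C]

lemma IsDirectSum.of_total {J : Type} [Fintype J] {X : C} {F : J → C} (ι : ∀ j, F j ⟶ X)
    (π : ∀ j, X ⟶ F j) (h1 : ∀ j, ι j ≫ π j = 𝟙 _) (h0 : ∀ j k, j ≠ k → ι j ≫ π k = 0)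
    (ht : ∑ j, π j ≫ ι j = 𝟙 X) : IsDirectSum X F := by
  classical
  let b : Bicone F :=
    { pt := X
      π := π
      ι := ι
      ι_π := fun j j' => by
        split_ifs with h
        · subst h; simpa using h1 j
        · exact h0 j j' h }
  exact ⟨b, ⟨isBilimitOfTotal b ht⟩, ⟨Iso.refl _⟩⟩

lemma IsDirectSum.exists_total {J : Type} [Fintype J] {X : C} {F : J → C} (h : IsDirectSum X F) :
    ∃ (ι : ∀ j, F j ⟶ X) (π : ∀ j, X ⟶ F j), (∀ j, ι j ≫ π j = 𝟙 _) ∧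
      (∀ j k, j ≠ k → ι j ≫ π k = 0) ∧ ∑ j, π j ≫ ι j = 𝟙 X := by
  classical
  obtain ⟨b, ⟨hb⟩, ⟨e⟩⟩ := h
  refine ⟨fun j => b.ι j ≫ e.inv, fun j => e.hom ≫ b.π j, fun j => ?_, fun j k hjk => ?_, ?_⟩
  · simp
  · simp [bicone_ι_π_ne b hjk]
  · have := IsBilimit.total hb
    calc ∑ j, (e.hom ≫ b.π j) ≫ b.ι j ≫ e.inv = e.hom ≫ (∑ j, b.π j ≫ b.ι j) ≫ e.inv := by
          simp [Preadditive.sum_comp, Preadditive.comp_sum]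
      _ = 𝟙 X := by rw [this]; simp

lemma IsDirectSum.reindex {J K : Type} [Finite J] [Finite K] {X : C} {F : J → C}
    (h : IsDirectSum X F) (e : K ≃ J) : IsDirectSum X (fun k => F (e k)) := by
  classical
  have := Fintype.ofFinite J
  have := Fintype.ofFinite K
  obtain ⟨ι, π, h1, h0, ht⟩ := h.exists_total
  refine .of_total (fun k => ι (e k)) (fun k => π (e k)) (fun k => h1 _)
    (fun j k hjk => h0 _ _ fun h => hjk (e.injective h)) ?_
  rw [← ht]
  exact e.sum_comp fun j => π j ≫ ι j

/-- Zero objects may be omitted from a direct sum. -/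
lemma IsDirectSum.restrict {J K : Type} [Finite J] [Finite K] {X : C} {F : J → C}
    (h : IsDirectSum X F) (e : K → J) (he : Function.Injective e)
    (hz : ∀ j, j ∉ Set.range e → 𝟙 (F j) = 0) : IsDirectSum X (fun k => F (e k)) := by
  classical
  have := Fintype.ofFinite J
  have := Fintype.ofFinite K
  obtain ⟨ι, π, h1, h0, ht⟩ := h.exists_total
  refine .of_total (fun k => ι (e k)) (fun k => π (e k)) (fun k => h1 _)
    (fun j k hjk => h0 _ _ fun h => hjk (he h)) ?_
  rw [← ht, ← Finset.sum_image (f := fun j => π j ≫ ι j) (g := e) (s := Finset.univ)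
    fun _ _ _ _ h => he h]
  refine Finset.sum_subset (Finset.subset_univ _) fun j _ hj => ?_
  rw [← Category.id_comp (ι j), hz j (by simpa using hj), zero_comp, comp_zero]

lemma IsDirectSum.sigma {J : Type} [Finite J] {K : J → Type} [∀ j, Finite (K j)] {X : C}
    {F : J → C} {G : ∀ j, K j → C} (h : IsDirectSum X F) (hG : ∀ j, IsDirectSum (F j) (G j)) :
    IsDirectSum X (fun p : Σ j, K j => G p.1 p.2) := by
  classical
  have := Fintype.ofFinite J
  have := fun j => Fintype.ofFinite (K j)
  obtain ⟨ι, π, h1, h0, ht⟩ := h.exists_total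
  choose ι' π' h1' h0' ht' using fun j => (hG j).exists_total
  refine .of_total (fun p => ι' p.1 p.2 ≫ ι p.1) (fun p => π p.1 ≫ π' p.1 p.2) ?_ ?_ ?_
  · rintro ⟨j, k⟩
    simp [reassoc_of% (h1 j), h1']
  · rintro ⟨j, k⟩ ⟨j', k'⟩ hne
    by_cases hj : j = j'
    · subst hj
      have hk : k ≠ k' := fun h => hne (by rw [h])
      simp [reassoc_of% (h1 j), h0' j k k' hk]
    · simp [reassoc_of% (h0 j j' hj)]
  · rw [← ht, Fintype.sum_sigma]
    refine Finset.sum_congr rfl fun j _ => ?_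
    have : ∀ k, (π j ≫ π' j k) ≫ ι' j k ≫ ι j = π j ≫ (π' j k ≫ ι' j k) ≫ ι j := by simp
    rw [Finset.sum_congr rfl fun k _ => this k, ← Preadditive.comp_sum, ← Preadditive.sum_comp,
      ht', Category.id_comp]

lemma IsDirectSum.map {D : Type*} [Category D] [Preadditive D] (Φ : C ⥤ D) [Φ.Additive]
    {J : Type} [Finite J] {X : C} {F : J → C} (h : IsDirectSum X F) :
    IsDirectSum (Φ.obj X) (fun j => Φ.obj (F j)) := by
  have := Fintype.ofFinite J
  obtain ⟨ι, π, h1, h0, ht⟩ := h.exists_total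
  refine .of_total (fun j => Φ.map (ι j)) (fun j => Φ.map (π j)) (fun j => ?_)
    (fun j k hjk => ?_) ?_
  · rw [← Φ.map_comp, h1, Φ.map_id]
  · rw [← Φ.map_comp, h0 j k hjk, Φ.map_zero]
  · simp_rw [← Φ.map_comp]
    rw [← Φ.map_sum, ht, Φ.map_id]

lemma IsDirectSum.of_iso {J : Type} [Finite J] {X : C} {F G : J → C} (h : IsDirectSum X F)
    (e : ∀ j, F j ≅ G j) : IsDirectSum X G := by
  have := Fintype.ofFinite J
  obtain ⟨ι, π, h1, h0, ht⟩ := h.exists_total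
  refine .of_total (fun j => (e j).inv ≫ ι j) (fun j => π j ≫ (e j).hom) (fun j => ?_)
    (fun j k hjk => ?_) ?_
  · simp [reassoc_of% (h1 j)]
  · simp [reassoc_of% (h0 j k hjk)]
  · simpa using ht

end DirectSum

/-! ### Components of morphisms, and direct sums up to homotopy -/

section Homs

variable {d : ℕ}

/-- The even component of a morphism. -/
noncomputable def evenPart (M N : GrMF d) : (M ⟶ N) →+ (M.M0 →ₗ[Bi] N.M0) :=
  (LinearMap.fst ℂ _ _ ∘ₗ (zHom M N).subtype).toAddMonoidHom

/-- The odd component of a morphism. -/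
noncomputable def oddPart (M N : GrMF d) : (M ⟶ N) →+ (M.M1 →ₗ[Bi] N.M1) :=
  (LinearMap.snd ℂ _ _ ∘ₗ (zHom M N).subtype).toAddMonoidHom

lemma hom_ext' {M N : GrMF d} {f g : M ⟶ N} (h0 : ∀ m, evenPart M N f m = evenPart M N g m)
    (h1 : ∀ m, oddPart M N f m = oddPart M N g m) : f = g :=
  Subtype.ext (Prod.ext (LinearMap.ext h0) (LinearMap.ext h1))

/-- In the application the inclusions and projections are strictly orthogonal. Only the
decomposition of the identity, which has to discard an infinite-rank contractible part, holds up to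
homotopy. -/
lemma isDirectSum_of_homotopic {J : Type} [Fintype J] {M : GrMF d} {N : J → GrMF d}
    (ι : ∀ j, N j ⟶ M) (π : ∀ j, M ⟶ N j) (h1 : ∀ j, ι j ≫ π j = 𝟙 _)
    (h0 : ∀ j k, j ≠ k → ι j ≫ π k = 0) (ht : Homotopic d (𝟙 M) (∑ j, π j ≫ ι j)) :
    IsDirectSum (⟨M⟩ : HMF d) (fun j => (⟨N j⟩ : HMF d)) := by
  let Q := Quotient.functor (Homotopic d)
  refine .of_total (fun j => Q.map (ι j)) (fun j => Q.map (π j)) (fun j => ?_)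
    (fun j k hjk => ?_) ?_
  · rw [← Q.map_comp, h1, Q.map_id]; rfl
  · rw [← Q.map_comp, h0 j k hjk, Q.map_zero]
  · simp_rw [← Q.map_comp]
    have h := CategoryTheory.Quotient.sound (Homotopic d) ht
    rw [← Q.map_sum]
    exact h.symm

end Homs
end LG

namespace LG

/-! ### Linear factors in the middle variable, and cofactors -/

section Decomposition

open Polynomial

variable {d : ℕ}

lemma phiL_add_phiR_potential : phiL (potential d) + phiR (potential d) = C (potential d) := by
  simp [potential]

lemma hasTop_phiR (S : Finset (ZMod d)) : HasTop d S.card (phiR (permPoly d S)) := by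
  rw [permPoly, map_prod]
  refine hasTop_prod S _ fun i _ => ⟨?_, 1, one_ne_zero, ?_⟩
  · rw [Nat.cast_one, mul_one]
    exact phiR_mem_pgr ((MvPolynomial.isWeightedHomogeneous_X ℂ (wt d) 0).sub
        ((MvPolynomial.isWeightedHomogeneous_X ℂ (wt d) 1).C_mul _))
  · rw [← MvPolynomial.algebraMap_eq]
    simp only [map_sub, map_mul, AlgHom.commutes, phiR_X0, phiR_X1, evTop_C_X, evTop_X]
    simp

variable [NeZero d]

lemma hasTop_phiL (S : Finset (ZMod d)) : HasTop d S.card (phiL (permPoly d S)) := by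
  rw [permPoly, map_prod]
  refine hasTop_prod S _ fun i _ => ⟨?_, -(eta d ^ i.val), ?_, ?_⟩
  · rw [Nat.cast_one, mul_one]
    exact phiL_mem_pgr ((MvPolynomial.isWeightedHomogeneous_X ℂ (wt d) 0).sub
        ((MvPolynomial.isWeightedHomogeneous_X ℂ (wt d) 1).C_mul _))
  · exact neg_ne_zero.mpr (pow_ne_zero _ ((eta_primitive d).ne_zero (NeZero.ne d)))
  · rw [← MvPolynomial.algebraMap_eq]
    simp only [map_sub, map_mul, AlgHom.commutes, phiL_X0, phiL_X1, evTop_C_X, evTop_X]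
    simp [Algebra.smul_def]

lemma permPoly_ne_zero (S : Finset (ZMod d)) : permPoly d S ≠ 0 := by
  intro h
  exact (hasTop_phiL S).ne_zero (by rw [h, map_zero])

/-- Evaluation at the point `(x, y, z) = (w, 1, 0)`. -/
noncomputable def evPoint (w : ℂ) : Polynomial Bi →+* ℂ :=
  (Polynomial.evalRingHom 1).comp (Polynomial.mapRingHom (MvPolynomial.eval ![w, 0]))

/-- The factors x - w y are prime, and none divides a product of factors y - η^j z: at (x,y,z) =
(w,1,0) the former vanishes and the latter is 1. The factors of f_S can thus be cancelled one at a
time. -/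
lemma phiL_dvd_of_dvd_mul (S T : Finset (ZMod d)) {Q : Polynomial Bi}
    (h : phiL (permPoly d S) ∣ phiR (permPoly d T) * Q) : phiL (permPoly d S) ∣ Q := by
  classical
  induction S using Finset.induction_on with
  | empty => simp [permPoly]
  | insert i S hi ih =>
    set w := eta d ^ i.val with hw
    have hw0 : w ≠ 0 := pow_ne_zero _ ((eta_primitive d).ne_zero (NeZero.ne d))
    set f : Polynomial Bi := phiL (MvPolynomial.X 0 - MvPolynomial.C w * MvPolynomial.X 1) with hf
    have hins : phiL (permPoly d (insert i S)) = f * phiL (permPoly d S) := by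
      rw [permPoly, Finset.prod_insert hi, map_mul, permPoly]
    have hfe : f = C (MvPolynomial.X 0) - C (MvPolynomial.C w) * X := by
      rw [hf, ← MvPolynomial.algebraMap_eq]
      simp only [map_sub, map_mul, AlgHom.commutes, phiL_X0, phiL_X1]
      rfl
    have hprime : Prime f := by
      have hu : IsUnit (C (MvPolynomial.C (-w)) : Polynomial Bi) :=
        ((IsUnit.mk0 (-w) (neg_ne_zero.mpr hw0)).map MvPolynomial.C).map C
      have e : f = C (MvPolynomial.C (-w)) * (X - C (MvPolynomial.C w⁻¹ * MvPolynomial.X 0)) := by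
        rw [hfe, mul_sub, ← C_mul, ← mul_assoc, ← MvPolynomial.C_mul, neg_mul, mul_inv_cancel₀ hw0]
        simp only [map_neg, map_one, C_mul]
        ring
      rw [e]
      exact ((associated_isUnit_mul_left_iff hu).mpr (Associated.refl _)).symm.prime
        (prime_X_sub_C _)
    have hnd : ¬ f ∣ phiR (permPoly d T) := by
      intro hdvd
      have h1 := map_dvd (evPoint w) hdvd
      have h2 : evPoint w f = 0 := by rw [hfe]; simp [evPoint]
      have h3 : evPoint w (phiR (permPoly d T)) = 1 := by
        rw [permPoly, map_prod, map_prod]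
        refine Finset.prod_eq_one fun j _ => ?_
        simp [evPoint]
      rw [h2, h3, zero_dvd_iff] at h1
      exact one_ne_zero h1
    rw [hins] at h ⊢
    obtain ⟨Q', rfl⟩ := ih ((dvd_mul_left _ _).trans h)
    rw [mul_comm f]
    refine mul_dvd_mul_left _ ?_
    rw [mul_left_comm, mul_comm f] at h
    exact (hprime.dvd_or_dvd ((mul_dvd_mul_iff_left (hasTop_phiL S).ne_zero).mp h)).resolve_left hnd

lemma map_permPoly_mul_compl {B : Type} [CommRing B] (f : Bi →+* B) (S : Finset (ZMod d)) :
    f (permPoly d S) * f (permPoly d Sᶜ) = f (potential d) := by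
  rw [← map_mul, permPoly_mul_compl]

lemma card_compl_eq (S : Finset (ZMod d)) : (Sᶜ.card : ℂ) = d - S.card := by
  rw [eq_sub_iff_add_eq', ← Nat.cast_add, Finset.card_add_card_compl, ZMod.card]

lemma two_div_mul_self : (2 / d : ℂ) * d = 2 := by
  have hd : (d : ℂ) ≠ 0 := NeZero.ne _
  field_simp

/-- Completion of a pair `(g, h)` to the four components of a morphism into a tensor product. -/
lemma exists_cofactors {S T U : Finset (ZMod d)} {s t : ℕ} {g h : Polynomial Bi}
    (hg : HasTop d s g) (hh : HasTop d t h) (hdeg : T.card + t = U.card + s)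
    (hdvd : phiL (permPoly d S) ∣ C (permPoly d U) * g - phiR (permPoly d T) * h) :
    ∃ k w : Polynomial Bi, k ∈ pgr d (2 / d * (U.card + s - S.card)) ∧
      w ∈ pgr d (2 / d * (s - T.card - S.card) + 2) ∧
      C (permPoly d U) * g = phiR (permPoly d T) * h + phiL (permPoly d S) * k ∧
      phiR (permPoly d Tᶜ) * g = C (permPoly d Uᶜ) * h + phiL (permPoly d S) * w ∧
      phiL (permPoly d Sᶜ) * g + phiR (permPoly d T) * w = C (permPoly d Uᶜ) * k ∧
      C (permPoly d U) * w = phiR (permPoly d Tᶜ) * k - phiL (permPoly d Sᶜ) * h := by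
  obtain ⟨k, hk⟩ := hdvd
  have eS : phiL (permPoly d S) * phiL (permPoly d Sᶜ) = phiL (potential d) :=
    map_permPoly_mul_compl phiL.toRingHom S
  have eT : phiR (permPoly d T) * phiR (permPoly d Tᶜ) = phiR (potential d) :=
    map_permPoly_mul_compl phiR.toRingHom T
  have eU : C (permPoly d U) * C (permPoly d Uᶜ) = C (potential d) := map_permPoly_mul_compl C U
  have hW := phiL_add_phiR_potential (d := d)
  have hS0 := (hasTop_phiL S).ne_zero
  -- After multiplication by f_T(y,z), the right side becomes (y^d - z^d) g - (x^d - z^d) g + f_{Uᶜ}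
  -- f_S k = f_S (f_{Uᶜ} k - f_{Sᶜ} g). Then f_T is cancelled.
  obtain ⟨w, hw⟩ : phiL (permPoly d S) ∣ phiR (permPoly d Tᶜ) * g - C (permPoly d Uᶜ) * h := by
    apply phiL_dvd_of_dvd_mul S T
    refine ⟨C (permPoly d Uᶜ) * k - phiL (permPoly d Sᶜ) * g, ?_⟩
    linear_combination g * eT + C (permPoly d Uᶜ) * hk + g * eS - g * eU + hW * g
  have h1 : C (permPoly d U) * g = phiR (permPoly d T) * h + phiL (permPoly d S) * k := by
    linear_combination hk
  have h2 : phiR (permPoly d Tᶜ) * g = C (permPoly d Uᶜ) * h + phiL (permPoly d S) * w := by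
    linear_combination hw
  refine ⟨k, w, ?_, ?_, h1, h2, ?_, ?_⟩
  · refine mem_pgr_of_mul_mem (hasTop_phiL S).1 hS0 ?_
    rw [← hk]
    refine sub_mem ?_ ?_
    · convert mul_mem_pgr (C_mem_pgr (permPoly_homog d U)) hg.1 using 2
      ring
    · convert mul_mem_pgr (hasTop_phiR T).1 hh.1 using 2
      have : (T.card + t : ℂ) = U.card + s := by exact_mod_cast hdeg
      linear_combination (-(2 / d : ℂ)) * this
  · refine mem_pgr_of_mul_mem (hasTop_phiL S).1 hS0 ?_
    rw [← hw]
    refine sub_mem ?_ ?_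
    · convert mul_mem_pgr (hasTop_phiR Tᶜ).1 hg.1 using 2
      rw [card_compl_eq]
      linear_combination (-1 : ℂ) * two_div_mul_self (d := d)
    · convert mul_mem_pgr (C_mem_pgr (permPoly_homog d Uᶜ)) hh.1 using 2
      rw [card_compl_eq]
      have : (T.card + t : ℂ) = U.card + s := by exact_mod_cast hdeg
      linear_combination (-1 : ℂ) * two_div_mul_self (d := d) - (2 / d : ℂ) * this
  -- The last two relations follow from the first two after multiplication by the nonzero f_S, using
  -- (x^d - y^d) + (y^d - z^d) = x^d - z^d.
  · apply mul_left_cancel₀ hS0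
    linear_combination g * eS - phiR (permPoly d T) * h2 + g * eT + C (permPoly d Uᶜ) * h1 -
      g * eU + hW * g
  · apply mul_left_cancel₀ hS0
    linear_combination h * eS - C (permPoly d U) * h2 + h * eT + phiR (permPoly d Tᶜ) * h1 -
      h * eU + hW * h

end Decomposition
end LG

namespace LG

/-! ### Splitting the tensor product of two permutation-type bifactorizations -/

section Decomposition

open Polynomial

variable {d : ℕ}

lemma mem_poly_gr {α q : ℂ} {p : Bi} : p ∈ (GrBimod.poly d α).gr q ↔
    MvPolynomial.IsWeightedHomogeneous (wt d) p (q - α) := Iff.rfl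

variable [NeZero d]

/-- The morphism from a permutation-type bifactorization that sends the generators to `u`, `a`. -/
noncomputable def permHom (U : Finset (ZMod d)) (α : ℂ) (M : GrMF d) (u : M.M0) (a : M.M1)
    (hu : u ∈ M.M0.gr α) (ha : a ∈ M.M1.gr (α + 2 / d * U.card - 1))
    (h1 : M.d1 a = permPoly d U • u) (h0 : M.d0 u = permPoly d Uᶜ • a) : permMF d U α ⟶ M :=
  ⟨(LinearMap.toSpanSingleton Bi M.M0 u, LinearMap.toSpanSingleton Bi M.M1 a), by
    refine ⟨fun (m : Bi) => ?_, fun (m : Bi) => ?_, fun q (m : Bi) hm => ?_,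
      fun q (m : Bi) hm => ?_⟩
    · change (permPoly d U * m : Bi) • u = M.d1 ((m : Bi) • a)
      rw [map_smul, h1, smul_smul, mul_comm]
    · change (permPoly d Uᶜ * m : Bi) • a = M.d0 ((m : Bi) • u)
      rw [map_smul, h0, smul_smul, mul_comm]
    · have := M.M0.smul_mem (mem_poly_gr.mp hm) hu
      rwa [sub_add_cancel] at this
    · have := M.M1.smul_mem (mem_poly_gr.mp hm) ha
      rwa [sub_add_cancel] at this⟩

variable {S T : Finset (ZMod d)} {α β : ℂ}

/-- The morphism to a permutation-type bifactorization given by two linear maps. -/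
noncomputable def tensorHom (U : Finset (ZMod d)) (γ : ℂ) (r r' : Polynomial Bi →ₗ[Bi] Bi)
    (hr : ∀ q, ∀ P ∈ pgr d (q - α - β), MvPolynomial.IsWeightedHomogeneous (wt d) (r P) (q - γ))
    (hr' : ∀ q, ∀ P ∈ pgr d (q - α - (β + 2 / d * T.card - 1)),
      MvPolynomial.IsWeightedHomogeneous (wt d) (r' P) (q - (γ + 2 / d * U.card - 1)))
    (h1 : ∀ A B, r (phiL (permPoly d S) * A + phiR (permPoly d T) * B) = permPoly d U * r' B)
    (h0 : ∀ A B, r' (phiR (permPoly d Tᶜ) * A + phiL (permPoly d S) * B) = permPoly d Uᶜ * r A) :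
    (permMF d S α).tensor (permMF d T β) ⟶ permMF d U γ :=
  ⟨((r ∘ₗ tensorEquiv.toLinearMap) ∘ₗ LinearMap.fst Bi (BiTensor Bi Bi) (BiTensor Bi Bi),
    (r' ∘ₗ tensorEquiv.toLinearMap) ∘ₗ LinearMap.snd Bi (BiTensor Bi Bi) (BiTensor Bi Bi)), by
    refine ⟨?_, ?_, ?_, ?_⟩
    · rintro ⟨a, b⟩
      change r (tensorEquiv (tmap (LinearMap.lsmul Bi Bi (permPoly d S)) LinearMap.id a +
        tmap LinearMap.id (LinearMap.lsmul Bi Bi (permPoly d T)) b)) =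
          permPoly d U * r' (tensorEquiv b)
      rw [map_add, tensorEquiv_tmap_left, tensorEquiv_tmap_right, h1]
    · rintro ⟨a, b⟩
      change r' (tensorEquiv (tmap LinearMap.id (LinearMap.lsmul Bi Bi (permPoly d Tᶜ)) a +
        tmap (LinearMap.lsmul Bi Bi (permPoly d S)) LinearMap.id b)) =
          permPoly d Uᶜ * r (tensorEquiv a)
      rw [map_add, tensorEquiv_tmap_left, tensorEquiv_tmap_right, h0]
    · rintro q ⟨a, b⟩ ⟨ha, -⟩
      exact hr q _ (tensorEquiv_mem_pgr ha)
    · rintro q ⟨a, b⟩ ⟨-, hb⟩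
      exact hr' q _ (tensorEquiv_mem_pgr hb)⟩

/-- Decomposition of the tensor product of two permutation-type bifactorizations according to a
diagonalization of multiplication by `∏_{j ∈ T} (y - η ^ j z)` modulo `∏_{j ∈ S} (x - η ^ j y)`. -/
theorem isDirectSum_tensor_permMF {n : ℕ} (hn : S.card = n) (U : Fin n → Finset (ZMod d))
    (g h : Fin n → Polynomial Bi) (σ τ : Equiv.Perm (Fin n))
    (hg : ∀ i, HasTop d (σ i) (g i)) (hh : ∀ i, HasTop d (τ i) (h i))
    (hdeg : ∀ i, T.card + τ i = (U i).card + σ i)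
    (hdvd : ∀ i, phiL (permPoly d S) ∣ C (permPoly d (U i)) * g i - phiR (permPoly d T) * h i) :
    IsDirectSum (⟨(permMF d S α).tensor (permMF d T β)⟩ : HMF d)
      (fun i => (⟨permMF d (U i) (α + β + 2 / d * (σ i : ℕ))⟩ : HMF d)) := by
  classical
  have hR : HasTop d n (phiL (permPoly d S)) := hn ▸ hasTop_phiL S
  choose k w hk hw e1 e2 e3 e4 using fun i => exists_cofactors (hg i) (hh i) (hdeg i) (hdvd i)
  have hdegC : ∀ i, (T.card + (τ i : ℕ) : ℂ) = (U i).card + (σ i : ℕ) := fun i => by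
    exact_mod_cast hdeg i
  set G := divEquiv hg hR with hG
  set H := divEquiv hh hR with hH
  -- Modulo f_S(x,y), multiplication by f_T(y,z) sends the coordinates with respect to h to those
  -- with respect to g diagonally, with entries f_{U_i}(x,z). The companion `hHsymm` is the same for
  -- the complements.
  have hGsymm : ∀ A B, G.symm (phiL (permPoly d S) * A + phiR (permPoly d T) * B) =
      (fun i => permPoly d (U i) * (H.symm B).1 i,
        A - ∑ i, (H.symm B).1 i • k i + phiR (permPoly d T) * (H.symm B).2) := by
    intro A B
    apply divEquiv_symm_eq hg hR
    conv_rhs => rw [← divEquiv_symm_spec hh hR B]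
    rw [mul_add, mul_sub, mul_add, Finset.mul_sum, Finset.mul_sum]
    have h2 : ∀ i, (permPoly d (U i) * (H.symm B).1 i) • g i =
        phiR (permPoly d T) * (H.symm B).1 i • h i +
          phiL (permPoly d S) * (H.symm B).1 i • k i := by
      intro i
      simp only [Polynomial.smul_eq_C_mul, C_mul]
      linear_combination C ((H.symm B).1 i) * e1 i
    rw [Finset.sum_congr rfl fun i _ => h2 i, Finset.sum_add_distrib]
    ring
  have hHsymm : ∀ A B, H.symm (phiR (permPoly d Tᶜ) * A + phiL (permPoly d S) * B) =
      (fun i => permPoly d (U i)ᶜ * (G.symm A).1 i,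
        ∑ i, (G.symm A).1 i • w i + phiR (permPoly d Tᶜ) * (G.symm A).2 + B) := by
    intro A B
    apply divEquiv_symm_eq hh hR
    conv_rhs => rw [← divEquiv_symm_spec hg hR A]
    rw [mul_add, mul_add, mul_add, Finset.mul_sum, Finset.mul_sum]
    have h2 : ∀ i, phiR (permPoly d Tᶜ) * (G.symm A).1 i • g i =
        (permPoly d (U i)ᶜ * (G.symm A).1 i) • h i +
          phiL (permPoly d S) * (G.symm A).1 i • w i := by
      intro i
      simp only [Polynomial.smul_eq_C_mul, C_mul]
      linear_combination C ((G.symm A).1 i) * e2 i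
    rw [Finset.sum_congr rfl fun i _ => h2 i, Finset.sum_add_distrib]
    ring
  have hGg : ∀ i (b : Bi), G.symm (b • g i) = (Pi.single i b, 0) := by
    intro i b
    apply divEquiv_symm_eq hg hR
    rw [Finset.sum_eq_single i]
    · simp
    · intro j _ hj
      rw [Pi.single_eq_of_ne hj, zero_smul]
    · simp
  have hHh : ∀ i (b : Bi), H.symm (b • h i) = (Pi.single i b, 0) := by
    intro i b
    apply divEquiv_symm_eq hh hR
    rw [Finset.sum_eq_single i]
    · simp
    · intro j _ hj
      rw [Pi.single_eq_of_ne hj, zero_smul]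
    · simp
  let r : Fin n → Polynomial Bi →ₗ[Bi] Bi := fun i =>
    LinearMap.proj i ∘ₗ LinearMap.fst Bi _ _ ∘ₗ G.symm.toLinearMap
  let r' : Fin n → Polynomial Bi →ₗ[Bi] Bi := fun i =>
    LinearMap.proj i ∘ₗ LinearMap.fst Bi _ _ ∘ₗ H.symm.toLinearMap
  -- The even generator must lift g_i and the odd one h_i. The other components k_i and -w_i are
  -- forced by compatibility with the differential, whose four components are the relations of
  -- `exists_cofactors`. The sign of w_i reflects the Koszul sign.
  let ι : ∀ i, permMF d (U i) (α + β + 2 / d * (σ i : ℕ)) ⟶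
      (permMF d S α).tensor (permMF d T β) := fun i =>
    permHom (U i) _ ((permMF d S α).tensor (permMF d T β))
      ((tensorEquiv.symm (g i), tensorEquiv.symm (-w i)) : BiTensor Bi Bi × BiTensor Bi Bi)
      ((tensorEquiv.symm (k i), tensorEquiv.symm (h i)) : BiTensor Bi Bi × BiTensor Bi Bi)
      (by
        refine And.intro (tensorEquiv_symm_mem ?_) (tensorEquiv_symm_mem (neg_mem ?_))
        · convert (hg i).1 using 2
          ring
        · convert hw i using 2
          ring)
      (by
        refine And.intro (tensorEquiv_symm_mem ?_) (tensorEquiv_symm_mem ?_)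
        · convert hk i using 2
          ring
        · convert (hh i).1 using 2
          linear_combination (-(2 / d : ℂ)) * hdegC i)
      (by
        refine Prod.ext ?_ ?_
        · apply tensorEquiv.injective
          change tensorEquiv (tmap (LinearMap.lsmul Bi Bi (permPoly d S)) LinearMap.id
            (tensorEquiv.symm (k i)) + tmap LinearMap.id (LinearMap.lsmul Bi Bi (permPoly d T))
              (tensorEquiv.symm (h i))) =
            tensorEquiv (permPoly d (U i) • tensorEquiv.symm (g i))
          rw [map_add, tensorEquiv_tmap_left, tensorEquiv_tmap_right, map_smul]
          simp only [LinearEquiv.apply_symm_apply, Polynomial.smul_eq_C_mul]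
          rw [e1, add_comm]
        · apply tensorEquiv.injective
          change tensorEquiv (-tmap LinearMap.id (LinearMap.lsmul Bi Bi (permPoly d Tᶜ))
            (tensorEquiv.symm (k i)) + tmap (LinearMap.lsmul Bi Bi (permPoly d Sᶜ)) LinearMap.id
              (tensorEquiv.symm (h i))) =
            tensorEquiv (permPoly d (U i) • tensorEquiv.symm (-w i))
          rw [map_add, map_neg, tensorEquiv_tmap_left, tensorEquiv_tmap_right, map_smul]
          simp only [LinearEquiv.apply_symm_apply, Polynomial.smul_eq_C_mul]
          linear_combination e4 i)
      (by
        refine Prod.ext ?_ ?_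
        · apply tensorEquiv.injective
          change tensorEquiv (tmap (LinearMap.lsmul Bi Bi (permPoly d Sᶜ)) LinearMap.id
            (tensorEquiv.symm (g i)) + -tmap LinearMap.id (LinearMap.lsmul Bi Bi (permPoly d T))
              (tensorEquiv.symm (-w i))) =
            tensorEquiv (permPoly d (U i)ᶜ • tensorEquiv.symm (k i))
          rw [map_add, map_neg, tensorEquiv_tmap_left, tensorEquiv_tmap_right, map_smul]
          simp only [LinearEquiv.apply_symm_apply, Polynomial.smul_eq_C_mul]
          linear_combination e3 i
        · apply tensorEquiv.injective
          change tensorEquiv (tmap LinearMap.id (LinearMap.lsmul Bi Bi (permPoly d Tᶜ))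
            (tensorEquiv.symm (g i)) + tmap (LinearMap.lsmul Bi Bi (permPoly d S)) LinearMap.id
              (tensorEquiv.symm (-w i))) =
            tensorEquiv (permPoly d (U i)ᶜ • tensorEquiv.symm (h i))
          rw [map_add, tensorEquiv_tmap_left, tensorEquiv_tmap_right, map_smul]
          simp only [LinearEquiv.apply_symm_apply, Polynomial.smul_eq_C_mul]
          linear_combination e2 i)
  -- The projection drops the summands with odd left factor and reads the i-th coordinate of the
  -- rest modulo f_S(x,y). The dropped components k_i and w_i therefore play no role in `ι i ≫ π j`.
  let π : ∀ i, (permMF d S α).tensor (permMF d T β) ⟶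
      permMF d (U i) (α + β + 2 / d * (σ i : ℕ)) := fun i =>
    tensorHom (U i) _ (r i) (r' i)
      (fun q P hP => by
        have := (divEquiv_symm_mem hg hR hP).1 i
        rw [show q - α - β - 2 / d * (σ i : ℕ) = q - (α + β + 2 / d * (σ i : ℕ)) by ring] at this
        exact this)
      (fun q P hP => by
        have := (divEquiv_symm_mem hh hR hP).1 i
        rw [show q - α - (β + 2 / d * T.card - 1) - 2 / d * (τ i : ℕ) =
          q - (α + β + 2 / d * (σ i : ℕ) + 2 / d * (U i).card - 1) by
            linear_combination (-(2 / d : ℂ)) * hdegC i] at this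
        exact this)
      (fun A B => congrFun (congrArg Prod.fst (hGsymm A B)) i)
      (fun A B => congrFun (congrArg Prod.fst (hHsymm A B)) i)
  have hι0 : ∀ i (b : Bi), evenPart _ _ (ι i) b =
      ((tensorEquiv.symm (b • g i), tensorEquiv.symm (b • -w i)) :
        BiTensor Bi Bi × BiTensor Bi Bi) := by
    intro i b
    rw [map_smul, map_smul]
    rfl
  have hι1 : ∀ i (b : Bi), oddPart _ _ (ι i) b =
      ((tensorEquiv.symm (b • k i), tensorEquiv.symm (b • h i)) :
        BiTensor Bi Bi × BiTensor Bi Bi) := by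
    intro i b
    rw [map_smul, map_smul]
    rfl
  have hιπ0 : ∀ i j (b : Bi), evenPart _ _ (ι i ≫ π j) b = (Pi.single i b : Fin n → Bi) j := by
    intro i j b
    change (G.symm (tensorEquiv (evenPart _ _ (ι i) b).1)).1 j = _
    rw [hι0, LinearEquiv.apply_symm_apply, hGg]
  have hιπ1 : ∀ i j (b : Bi), oddPart _ _ (ι i ≫ π j) b = (Pi.single i b : Fin n → Bi) j := by
    intro i j b
    change (H.symm (tensorEquiv (oddPart _ _ (ι i) b).2)).1 j = _
    rw [hι1, LinearEquiv.apply_symm_apply, hHh]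
  refine isDirectSum_of_homotopic ι π (fun i => hom_ext' (fun b => ?_) (fun b => ?_))
    (fun i j hij => hom_ext' (fun b => ?_) (fun b => ?_)) ?_
  · rw [hιπ0, Pi.single_eq_same]; rfl
  · rw [hιπ1, Pi.single_eq_same]; rfl
  · rw [hιπ0, Pi.single_eq_of_ne hij.symm]; rfl
  · rw [hιπ1, Pi.single_eq_of_ne hij.symm]; rfl
  · have hsum0 : ∀ u v : BiTensor Bi Bi, evenPart _ _ (∑ i, π i ≫ ι i) (u, v) =
        ((tensorEquiv.symm (∑ i, (G.symm (tensorEquiv u)).1 i • g i),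
          tensorEquiv.symm (∑ i, (G.symm (tensorEquiv u)).1 i • -w i)) :
            BiTensor Bi Bi × BiTensor Bi Bi) := by
      intro u v
      have h1 : ∀ i, evenPart _ _ (π i ≫ ι i) (u, v) =
          ((tensorEquiv.symm ((G.symm (tensorEquiv u)).1 i • g i),
            tensorEquiv.symm ((G.symm (tensorEquiv u)).1 i • -w i)) :
              BiTensor Bi Bi × BiTensor Bi Bi) := fun i => hι0 i _
      rw [map_sum, LinearMap.sum_apply, Finset.sum_congr rfl fun i _ => h1 i, map_sum, map_sum]
      exact (Prod.ext (Prod.fst_sum ..) (Prod.snd_sum ..))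
    have hsum1 : ∀ a b : BiTensor Bi Bi, oddPart _ _ (∑ i, π i ≫ ι i) (a, b) =
        ((tensorEquiv.symm (∑ i, (H.symm (tensorEquiv b)).1 i • k i),
          tensorEquiv.symm (∑ i, (H.symm (tensorEquiv b)).1 i • h i)) :
            BiTensor Bi Bi × BiTensor Bi Bi) := by
      intro a b
      have h1 : ∀ i, oddPart _ _ (π i ≫ ι i) (a, b) =
          ((tensorEquiv.symm ((H.symm (tensorEquiv b)).1 i • k i),
            tensorEquiv.symm ((H.symm (tensorEquiv b)).1 i • h i)) :
              BiTensor Bi Bi × BiTensor Bi Bi) := fun i => hι1 i _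
      rw [map_sum, LinearMap.sum_apply, Finset.sum_congr rfl fun i _ => h1 i, map_sum, map_sum]
      exact (Prod.ext (Prod.fst_sum ..) (Prod.snd_sum ..))
    -- The homotopy is the quotient of the division by f_S(x,y), taken with respect to the basis g
    -- on the even part and h on the odd part. It maps a summand with even left factor to the one
    -- with odd left factor, against multiplication by f_S.
    let s : BiTensor Bi Bi →ₗ[Bi] BiTensor Bi Bi := tensorEquiv.symm.toLinearMap ∘ₗ
      LinearMap.snd Bi _ _ ∘ₗ G.symm.toLinearMap ∘ₗ tensorEquiv.toLinearMap
    let t : BiTensor Bi Bi →ₗ[Bi] BiTensor Bi Bi := tensorEquiv.symm.toLinearMap ∘ₗ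
      LinearMap.snd Bi _ _ ∘ₗ H.symm.toLinearMap ∘ₗ tensorEquiv.toLinearMap
    have hs : ∀ u, tensorEquiv (s u) = (G.symm (tensorEquiv u)).2 := fun u =>
      tensorEquiv.apply_symm_apply _
    have ht : ∀ u, tensorEquiv (t u) = (H.symm (tensorEquiv u)).2 := fun u =>
      tensorEquiv.apply_symm_apply _
    refine ⟨(s ∘ₗ LinearMap.fst Bi (BiTensor Bi Bi) (BiTensor Bi Bi)).prod 0,
      LinearMap.prod 0 (t ∘ₗ LinearMap.snd Bi (BiTensor Bi Bi) (BiTensor Bi Bi)), ?_, ?_, ?_, ?_⟩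
    · rintro q ⟨u, v⟩ ⟨hu, -⟩
      refine And.intro (tensorEquiv_symm_mem ?_) (zero_mem _)
      convert (divEquiv_symm_mem hg hR (tensorEquiv_mem_pgr hu)).2 using 2
      · rw [hn]
        ring
      · rfl
    · rintro q ⟨a, b⟩ ⟨-, hb⟩
      refine And.intro (zero_mem _) (tensorEquiv_symm_mem ?_)
      convert (divEquiv_symm_mem hh hR (tensorEquiv_mem_pgr hb)).2 using 2
      · rw [hn]
        ring
      · rfl
    · rintro ⟨u, v⟩
      change ((u, v) : BiTensor Bi Bi × BiTensor Bi Bi) -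
        evenPart _ _ (∑ i, π i ≫ ι i) (u, v) = _
      rw [hsum0]
      refine Prod.ext ?_ ?_
      · apply tensorEquiv.injective
        change tensorEquiv (u - tensorEquiv.symm (∑ i, (G.symm (tensorEquiv u)).1 i • g i)) =
          tensorEquiv (tmap (LinearMap.lsmul Bi Bi (permPoly d S)) LinearMap.id (s u) +
            tmap LinearMap.id (LinearMap.lsmul Bi Bi (permPoly d T)) 0 + 0)
        rw [map_zero, add_zero, add_zero, tensorEquiv_tmap_left, hs, map_sub,
          LinearEquiv.apply_symm_apply, sub_eq_iff_eq_add']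
        exact (divEquiv_symm_spec hg hR _).symm
      · apply tensorEquiv.injective
        change tensorEquiv (v - tensorEquiv.symm (∑ i, (G.symm (tensorEquiv u)).1 i • -w i)) =
          tensorEquiv (-tmap LinearMap.id (LinearMap.lsmul Bi Bi (permPoly d Tᶜ)) (s u) +
            tmap (LinearMap.lsmul Bi Bi (permPoly d Sᶜ)) LinearMap.id 0 +
            t (tmap LinearMap.id (LinearMap.lsmul Bi Bi (permPoly d Tᶜ)) u +
              tmap (LinearMap.lsmul Bi Bi (permPoly d S)) LinearMap.id v))
        rw [map_zero, add_zero, map_add, map_neg, tensorEquiv_tmap_right, hs, ht, map_add,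
          tensorEquiv_tmap_left, tensorEquiv_tmap_right, hHsymm, map_sub,
          LinearEquiv.apply_symm_apply]
        simp only [smul_neg, Finset.sum_neg_distrib]
        ring
    · rintro ⟨a, b⟩
      change ((a, b) : BiTensor Bi Bi × BiTensor Bi Bi) -
        oddPart _ _ (∑ i, π i ≫ ι i) (a, b) = _
      rw [hsum1]
      refine Prod.ext ?_ ?_
      · apply tensorEquiv.injective
        change tensorEquiv (a - tensorEquiv.symm (∑ i, (H.symm (tensorEquiv b)).1 i • k i)) =
          tensorEquiv (tmap (LinearMap.lsmul Bi Bi (permPoly d Sᶜ)) LinearMap.id 0 +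
            -tmap LinearMap.id (LinearMap.lsmul Bi Bi (permPoly d T)) (t b) +
            s (tmap (LinearMap.lsmul Bi Bi (permPoly d S)) LinearMap.id a +
              tmap LinearMap.id (LinearMap.lsmul Bi Bi (permPoly d T)) b))
        rw [map_zero, zero_add, map_add, map_neg, tensorEquiv_tmap_right, hs, ht, map_add,
          tensorEquiv_tmap_left, tensorEquiv_tmap_right, hGsymm, map_sub,
          LinearEquiv.apply_symm_apply]
        ring
      · apply tensorEquiv.injective
        change tensorEquiv (b - tensorEquiv.symm (∑ i, (H.symm (tensorEquiv b)).1 i • h i)) =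
          tensorEquiv (tmap LinearMap.id (LinearMap.lsmul Bi Bi (permPoly d Tᶜ)) 0 +
            tmap (LinearMap.lsmul Bi Bi (permPoly d S)) LinearMap.id (t b) + 0)
        rw [map_zero, zero_add, add_zero, tensorEquiv_tmap_left, ht, map_sub,
          LinearEquiv.apply_symm_apply, sub_eq_iff_eq_add']
        exact (divEquiv_symm_spec hh hR _).symm

end Decomposition
end LG

namespace LG

/-! ### Arcs of roots of unity as q-shifted powers -/

section Arcs

open Polynomial

variable (d : ℕ)

/-- `{a, a + 1, …, a + l - 1}`. -/
def arc (a : ZMod d) (l : ℕ) : Finset (ZMod d) := (Finset.range l).image fun k : ℕ => a + k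

/-- `η ^ a` for `a ∈ ℤ/d`. -/
noncomputable def etaPow (a : ZMod d) : ℂ := eta d ^ a.val

variable {d}

lemma arc_injOn (a : ZMod d) {l : ℕ} (hl : l ≤ d) :
    Set.InjOn (fun k : ℕ => a + (k : ZMod d)) (Finset.range l) := by
  intro i hi j hj h
  have h1 := add_left_cancel h
  rw [ZMod.natCast_eq_natCast_iff'] at h1
  simp only [Finset.coe_range, Set.mem_Iio] at hi hj
  rwa [Nat.mod_eq_of_lt (by omega), Nat.mod_eq_of_lt (by omega)] at h1

lemma card_arc (a : ZMod d) {l : ℕ} (hl : l ≤ d) : (arc d a l).card = l := by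
  rw [arc, Finset.card_image_of_injOn (arc_injOn a hl), Finset.card_range]

lemma qPoch_mem_pgr {q : ℂ} {a b : Polynomial Bi} (ha : a ∈ pgr d (2 / d)) (hb : b ∈ pgr d (2 / d))
    (n : ℕ) : qPoch q a b n ∈ pgr d (2 / d * n) := by
  have := prod_mem_pgr (Finset.range n) (fun j => a - q ^ j • b)
    fun j _ => sub_mem ha (Submodule.smul_mem _ _ hb)
  rwa [Finset.card_range] at this

lemma qExpand_mem_pgr {q : ℂ} {x y z : Polynomial Bi} (hx : x ∈ pgr d (2 / d))
    (hy : y ∈ pgr d (2 / d)) (hz : z ∈ pgr d (2 / d)) (D : ℕ) (a : ℂ[X]) :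
    qExpand q x y z D a ∈ pgr d (2 / d * D) := by
  refine Submodule.sum_mem _ fun k hk => Submodule.smul_mem _ _ ?_
  rw [Finset.mem_range] at hk
  convert mul_mem_pgr (qPoch_mem_pgr hx hy k) (qPoch_mem_pgr hy hz (D - k)) using 2
  rw [← mul_add, ← Nat.cast_add, Nat.add_sub_cancel' (by omega)]

variable [NeZero d]

lemma eta_pow_mod (k : ℕ) : eta d ^ (k % d) = eta d ^ k :=
  (pow_eq_pow_mod k (eta_primitive d).pow_eq_one).symm

lemma etaPow_add (a b : ZMod d) : etaPow d (a + b) = etaPow d a * etaPow d b := by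
  rw [etaPow, ZMod.val_add, eta_pow_mod, pow_add, etaPow, etaPow]

lemma etaPow_natCast (k : ℕ) : etaPow d (k : ZMod d) = eta d ^ k := by
  rw [etaPow, ZMod.val_natCast, eta_pow_mod]

lemma etaPow_ne_zero (a : ZMod d) : etaPow d a ≠ 0 :=
  pow_ne_zero _ ((eta_primitive d).ne_zero (NeZero.ne d))

/-- Consecutive exponents turn the product into a shifted power with q = η. This is the only place
where it matters that the sets are arcs. -/
lemma permPoly_arc (a : ZMod d) {l : ℕ} (hl : l ≤ d) :
    permPoly d (arc d a l) =
      qPoch (eta d) (MvPolynomial.X 0) (etaPow d a • MvPolynomial.X 1) l := by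
  rw [permPoly, arc, Finset.prod_image (arc_injOn a hl), qPoch]
  refine Finset.prod_congr rfl fun k _ => ?_
  change MvPolynomial.X 0 - MvPolynomial.C (etaPow d (a + k)) * MvPolynomial.X 1 = _
  rw [etaPow_add, etaPow_natCast, smul_smul, MvPolynomial.smul_eq_C_mul, mul_comm (eta d ^ k)]

/-- The generators of the summands in a tensor product. -/
lemma exists_fusion_generators (m n : ZMod d) {i u v : ℕ} (hd : i + u + v + 1 < d) :
    ∃ g h : Polynomial Bi, HasTop d i g ∧ HasTop d u h ∧
      phiL (permPoly d (arc d m (i + u + 1))) ∣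
        C (permPoly d (arc d (m + n + i) (u + v + 1))) * g -
          phiR (permPoly d (arc d n (i + v + 1))) * h := by
  obtain ⟨a, ha, hw, ha0, hc0⟩ := exists_qClebschGordan (eta_primitive d) hd
  set x : Polynomial Bi := C (MvPolynomial.X 0) with hx
  -- Rescaling y by η^m and z by η^(m+n) makes the arcs at m and n start at exponent 0, and the arc
  -- at m + n + i start at exponent i, which is the form needed in `qPoch_dvd_sub`.
  set y : Polynomial Bi := etaPow d m • X with hy
  set z : Polynomial Bi := (etaPow d m * etaPow d n) • C (MvPolynomial.X 1) with hz
  have hxm : x ∈ pgr d (2 / d) := C_X_mem_pgr 0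
  have hym : y ∈ pgr d (2 / d) := Submodule.smul_mem _ _ X_mem_pgr
  have hzm : z ∈ pgr d (2 / d) := Submodule.smul_mem _ _ (C_X_mem_pgr 1)
  have hxt : evTop x = 0 := evTop_C_X 0
  have hyt : evTop y = etaPow d m • X := by rw [hy, map_smul, evTop_X]
  have hzt : evTop z = 0 := by rw [hz, map_smul, evTop_C_X, smul_zero]
  -- The scalar in front of h compensates for the rescaling: each of the i + v + 1 factors of
  -- f_T(y,z) changes by η^m.
  refine ⟨qExpand (eta d) x y z i a, etaPow d m ^ (i + v + 1) •
    qExpand (eta d) x y (eta d ^ (i + v + 1) • z) u ((qRaise (eta d))^[u + v + 1] a), ?_, ?_, ?_⟩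
  · refine ⟨qExpand_mem_pgr hxm hym hzm _ _, _,
      mul_ne_zero ha0 (pow_ne_zero i (etaPow_ne_zero m)), ?_⟩
    rw [map_qExpand, hxt, hyt, hzt, qExpand_zero_zero, _root_.smul_pow, smul_smul]
  · refine ⟨Submodule.smul_mem _ _ (qExpand_mem_pgr hxm hym (Submodule.smul_mem _ _ hzm) _ _), _,
      mul_ne_zero (pow_ne_zero (i + v + 1) (etaPow_ne_zero m))
        (mul_ne_zero hc0 (pow_ne_zero u (etaPow_ne_zero m))), ?_⟩
    rw [map_smul, map_qExpand, hxt, hyt, map_smul, hzt, smul_zero, qExpand_zero_zero,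
      _root_.smul_pow, smul_smul, smul_smul, mul_assoc]
  · have h1 : phiL (permPoly d (arc d m (i + u + 1))) = qPoch (eta d) x y (i + u + 1) := by
      rw [permPoly_arc m (by omega), map_qPoch, map_smul, phiL_X0, phiL_X1]
    have h2 : C (permPoly d (arc d (m + n + i) (u + v + 1))) =
        qPoch (eta d) x (eta d ^ i • z) (u + v + 1) := by
      have := map_qPoch (q := eta d) (CAlgHom : Bi →ₐ[ℂ] Polynomial Bi) (MvPolynomial.X 0)
        (etaPow d (m + n + i) • MvPolynomial.X 1) (u + v + 1)
      rw [permPoly_arc _ (by omega)]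
      refine this.trans ?_
      rw [map_smul, etaPow_add, etaPow_add, etaPow_natCast, hz, smul_smul, mul_comm (eta d ^ i)]
      rfl
    have h3 : phiR (permPoly d (arc d n (i + v + 1))) * etaPow d m ^ (i + v + 1) •
          qExpand (eta d) x y (eta d ^ (i + v + 1) • z) u ((qRaise (eta d))^[u + v + 1] a) =
        qPoch (eta d) y z (i + v + 1) *
          qExpand (eta d) x y (eta d ^ (i + v + 1) • z) u ((qRaise (eta d))^[u + v + 1] a) := by
      rw [permPoly_arc n (by omega), map_qPoch, map_smul, phiR_X0, phiR_X1, hy, hz,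
        ← smul_smul, qPoch_smul, mul_smul_comm, smul_mul_assoc]
    rw [h1, h2, h3]
    exact qPoch_dvd_sub x y z ha hw

end Arcs

/-! ### Contractible permutation-type bifactorizations -/

section Trivial

variable {d : ℕ} [NeZero d]

/-- The empty product makes `d1` the identity, and its inverse is a contracting homotopy. For the
full set the same happens with `d0`. -/
lemma id_permMF_empty (α : ℂ) : 𝟙 (⟨permMF d ∅ α⟩ : HMF d) = 0 := by
  have h : Homotopic d (𝟙 (permMF d ∅ α)) 0 := by
    refine ⟨(LinearMap.id : Bi →ₗ[Bi] Bi), 0, fun q m hm => ?_, fun q m _ => zero_mem _,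
      fun (m : Bi) => ?_, fun (m : Bi) => ?_⟩
    · have e : q - 1 - (α + 2 / d * ((∅ : Finset (ZMod d)).card : ℂ) - 1) = q - α := by
        rw [Finset.card_empty]
        push_cast
        ring
      change MvPolynomial.IsWeightedHomogeneous (wt d) (m : Bi)
        (q - 1 - (α + 2 / d * ((∅ : Finset (ZMod d)).card : ℂ) - 1))
      rw [e]
      exact hm
    · change m - 0 = permPoly d ∅ * m + 0
      simp [permPoly]
    · change m - 0 = permPoly d ∅ᶜ * 0 + permPoly d ∅ * m
      simp [permPoly]
  exact CategoryTheory.Quotient.sound (Homotopic d) h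

lemma id_permMF_univ (α : ℂ) : 𝟙 (⟨permMF d Finset.univ α⟩ : HMF d) = 0 := by
  have h : Homotopic d (𝟙 (permMF d Finset.univ α)) 0 := by
    refine ⟨0, (LinearMap.id : Bi →ₗ[Bi] Bi), fun q m _ => zero_mem _, fun q m hm => ?_,
      fun (m : Bi) => ?_, fun (m : Bi) => ?_⟩
    · have e : q - (α + 2 / d * ((Finset.univ : Finset (ZMod d)).card : ℂ) - 1) = q - 1 - α := by
        rw [Finset.card_univ, ZMod.card, two_div_mul_self]
        ring
      change MvPolynomial.IsWeightedHomogeneous (wt d) (m : Bi) (q - 1 - α)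
      rw [← e]
      exact hm
    · change m - 0 = permPoly d Finset.univ * 0 + permPoly d Finset.univᶜ * m
      simp [permPoly]
    · change m - 0 = permPoly d Finset.univᶜ * m + 0
      simp [permPoly]
  exact CategoryTheory.Quotient.sound (Homotopic d) h

end Trivial
end LG

namespace LG

/-! ### The fusion rule -/

section Fusion

open Polynomial

variable {d : ℕ} [NeZero d]

lemma hatPI_eq (a : ZMod d) (l : Fin (d - 1)) :
    hatPI d a l = ⟨permMF d (arc d a (l + 1)) (-(l : ℕ) / d)⟩ := by
  have hl : (arc d a ((l : ℕ) + 1)).card = l + 1 := card_arc a (by omega)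
  change (⟨permMF d (arc d a (l + 1)) ((1 - (arc d a ((l : ℕ) + 1)).card) / d)⟩ : HMF d) = _
  rw [hl]
  rw [show (1 - ((l + 1 : ℕ) : ℂ)) / d = -(l : ℕ) / d by push_cast; ring]

/-- The summands of a tensor product of two permutation-type bifactorizations, including the
contractible ones, with their generators. -/
lemma exists_fusion_family (m n : ZMod d) {l k : ℕ} (hl : l + 2 ≤ d) (hk : k + 2 ≤ d) :
    ∃ (U : Fin (l + 1) → Finset (ZMod d)) (τ : Equiv.Perm (Fin (l + 1)))
      (g h : Fin (l + 1) → Polynomial Bi),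
      (∀ i : Fin (l + 1), (i : ℕ) ≤ k → l + k + 2 ≤ d + i →
        U i = arc d (m + n + (i : ℕ)) (l + k + 1 - 2 * i)) ∧
      (∀ i : Fin (l + 1), k < i → U i = ∅) ∧
      (∀ i : Fin (l + 1), d + i < l + k + 2 → U i = Finset.univ) ∧
      (∀ i : Fin (l + 1), HasTop d i (g i)) ∧ (∀ i, HasTop d (τ i) (h i)) ∧
      (∀ i, k + 1 + τ i = (U i).card + i) ∧
      ∀ i, phiL (permPoly d (arc d m (l + 1))) ∣ C (permPoly d (U i)) * g i -
        phiR (permPoly d (arc d n (k + 1))) * h i := by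
  set S := arc d m (l + 1) with hS
  set T := arc d n (k + 1) with hT
  have hTc : T.card = k + 1 := card_arc n (by omega)
  have hTc' : Tᶜ.card = d - (k + 1) := by rw [Finset.card_compl, hTc, ZMod.card]
  -- The degree of h_i is forced by |T| + deg h_i = |U_i| + deg g_i with deg g_i = i. These values
  -- again exhaust 0, …, l, so the h_i can serve as a basis too.
  let t : Fin (l + 1) → Fin (l + 1) := fun i =>
    ⟨if k < i then i - (k + 1) else if d + i < l + k + 2 then i + d - (k + 1) else l - i, by
      have := i.2
      split_ifs <;> omega⟩
  have ht : Function.Injective t := by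
    intro i j hij
    have h1 : (t i : ℕ) = t j := congrArg Fin.val hij
    have := i.2
    have := j.2
    simp only [t] at h1
    apply Fin.ext
    split_ifs at h1 <;> omega
  let τ : Equiv.Perm (Fin (l + 1)) := Equiv.ofBijective t (Finite.injective_iff_bijective.mp ht)
  have hτ : ∀ i, τ i = t i := fun _ => rfl
  let U : Fin (l + 1) → Finset (ZMod d) := fun i =>
    if k < i then ∅ else if d + i < l + k + 2 then Finset.univ
    else arc d (m + n + (i : ℕ)) (l + k + 1 - 2 * i)
  have key : ∀ i : Fin (l + 1), ∃ g h : Polynomial Bi, HasTop d i g ∧ HasTop d (t i) h ∧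
      k + 1 + t i = (U i).card + i ∧
      phiL (permPoly d S) ∣ C (permPoly d (U i)) * g - phiR (permPoly d T) * h := by
    intro i
    have hi := i.2
    by_cases h1 : k < i
    · have ht' : (t i : ℕ) = i - (k + 1) := by simp [t, h1]
      have hU : U i = ∅ := by simp [U, h1]
      -- With U_i = ∅ the difference f_{U_i} g - f_T h is exactly zero.
      refine ⟨phiR (permPoly d T) * X ^ (i - (k + 1) : ℕ), X ^ (i - (k + 1) : ℕ), ?_, ?_, ?_, ?_⟩
      · have := (hasTop_phiR T).mul (hasTop_X_pow (d := d) (i - (k + 1)))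
        rwa [hTc, Nat.add_sub_cancel' (by omega)] at this
      · rw [ht']; exact hasTop_X_pow _
      · rw [ht', hU, Finset.card_empty]; omega
      · rw [hU]; simp [permPoly]
    · by_cases h2 : d + i < l + k + 2
      · have ht' : (t i : ℕ) = i + d - (k + 1) := by simp [t, h1, h2]
        have hU : U i = Finset.univ := by simp [U, h1, h2]
        -- With U_i = ℤ/d the difference is (x^d - z^d) y^i - (y^d - z^d) y^i = (x^d - y^d) y^i, a
        -- multiple of f_S.
        refine ⟨X ^ (i : ℕ), phiR (permPoly d Tᶜ) * X ^ (i : ℕ), hasTop_X_pow _, ?_, ?_, ?_⟩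
        · have := (hasTop_phiR Tᶜ).mul (hasTop_X_pow (d := d) i)
          rwa [hTc', show d - (k + 1) + i = (t i : ℕ) by omega] at this
        · rw [ht', hU, Finset.card_univ, ZMod.card]; omega
        · rw [hU, permPoly_univ, ← phiL_add_phiR_potential, ← mul_assoc]
          have eT : phiR (permPoly d T) * phiR (permPoly d Tᶜ) = phiR (potential d) :=
            map_permPoly_mul_compl phiR.toRingHom T
          have eS : phiL (permPoly d S) * phiL (permPoly d Sᶜ) = phiL (potential d) :=
            map_permPoly_mul_compl phiL.toRingHom S
          rw [eT, ← sub_mul, add_sub_cancel_right, ← eS, mul_assoc]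
          exact dvd_mul_right _ _
      · have ht' : (t i : ℕ) = l - i := by simp [t, h1, h2]
        have hU : U i = arc d (m + n + (i : ℕ)) (l + k + 1 - 2 * i) := by simp [U, h1, h2]
        obtain ⟨g, h, hg, hh, hdvd⟩ := exists_fusion_generators (d := d) m n (i := i) (u := l - i)
          (v := k - i) (by omega)
        rw [show (i : ℕ) + (l - i) + 1 = l + 1 by omega,
          show (i : ℕ) + (k - i) + 1 = k + 1 by omega,
          show l - (i : ℕ) + (k - i) + 1 = l + k + 1 - 2 * i by omega] at hdvd
        refine ⟨g, h, hg, ht' ▸ hh, ?_, hU ▸ hdvd⟩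
        rw [ht', hU, card_arc _ (by omega)]
        omega
  choose g h hg hh hdeg hdvd using key
  refine ⟨U, τ, g, h, fun i h1 h2 => ?_, fun i h1 => ?_, fun i h1 => ?_, hg, hh, hdeg, hdvd⟩
  · simp only [U]
    rw [if_neg (by omega), if_neg (by omega)]
  · simp only [U]
    rw [if_pos h1]
  · simp only [U]
    have := i.2
    rw [if_neg (by omega), if_pos h1]

/-- The i-th summand of the splitting belongs to ν = l + k - 2 i. The shifts agree, since -l/d - k/d
+ 2 i/d = -ν/d, and the summands outside the fusion range are zero objects. -/
theorem isDirectSum_tensor_hatPI (hd : 2 ≤ d) (m n : ZMod d) (l k : Fin (d - 1)) :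
    IsDirectSum ((hatPI d m l).tensor (hatPI d n k))
      fun ν : {ν : Fin (d - 1) // Fusion d l k ν} =>
        hatPI d (m + n + (((l : ℕ) + k - (ν.1 : ℕ)) / 2 : ℕ)) ν.1 := by
  obtain ⟨U, τ, g, h, hU, hU0, hU1, hg, hh, hdeg, hdvd⟩ :=
    exists_fusion_family m n (l := l) (k := k) (by omega) (by omega)
  have key := isDirectSum_tensor_permMF (d := d) (S := arc d m (l + 1)) (T := arc d n (k + 1))
    (α := -(l : ℕ) / d) (β := -(k : ℕ) / d) (card_arc m (by omega)) U g h (Equiv.refl _) τ hg hh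
    (fun i => by rw [card_arc n (by omega)]; exact hdeg i) hdvd
  -- The condition i ≤ min(l,k) is |l - k| ≤ ν, and l + k + 2 ≤ d + i is the truncation ν ≤ 2 d - 4
  -- - l - k.
  have hν : ∀ ν : {ν : Fin (d - 1) // Fusion d l k ν}, ∃ i : ℕ, i ≤ l ∧ i ≤ k ∧
      (ν.1 : ℕ) + 2 * i = l + k ∧ (l : ℕ) + k + 2 ≤ d + i := by
    rintro ⟨ν, h1, h2, h3⟩
    rw [le_min_iff] at h2
    refine ⟨((l : ℕ) + k - ν) / 2, ?_⟩
    rcases abs_cases ((l : ℤ) - k) with ⟨h4, h5⟩ | ⟨h4, h5⟩ <;> rw [h4] at h1 h3 <;>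
      simp only <;> omega
  choose e he1 he2 he3 he4 using hν
  rw [hatPI_eq, hatPI_eq]
  have key2 := key.restrict (fun ν => (⟨e ν, Nat.lt_succ_of_le (he1 ν)⟩ : Fin (l + 1)))
    (fun ν ν' h => by
      have h1 := congrArg Fin.val h
      have h2 := he3 ν
      have h3 := he3 ν'
      simp only at h1
      exact Subtype.ext (Fin.ext (by omega)))
    (fun i hi => by
      by_cases h1 : k < (i : ℕ)
      · rw [hU0 i h1]; exact id_permMF_empty _
      · by_cases h2 : d + i < (l : ℕ) + k + 2
        · rw [hU1 i h2]; exact id_permMF_univ _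
        · exfalso
          apply hi
          have hi' := i.2
          have hF : Fusion d l k ⟨l + k - 2 * i, by omega⟩ := by
            refine ⟨?_, ?_, ?_⟩
            · rcases abs_cases ((l : ℤ) - k) with ⟨h4, h5⟩ | ⟨h4, h5⟩ <;> rw [h4] <;>
                simp only <;> omega
            · rw [le_min_iff]; simp only; omega
            · rcases abs_cases ((l : ℤ) - k) with ⟨h4, h5⟩ | ⟨h4, h5⟩ <;> rw [h4] <;>
                simp only <;> omega
          refine ⟨⟨_, hF⟩, Fin.ext ?_⟩
          have := he3 ⟨_, hF⟩
          simp only at this ⊢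
          omega)
  refine key2.of_iso fun ν => eqToIso ?_
  have h3 := he3 ν
  rw [hatPI_eq, hU _ (by simpa using he2 ν) (by simpa using he4 ν)]
  have e1 : (l : ℕ) + k + 1 - 2 * e ν = ν.1 + 1 := by omega
  have e2 : ((l : ℕ) + k - (ν.1 : ℕ)) / 2 = e ν := by omega
  have e3 : -((l : ℕ) : ℂ) / d + -((k : ℕ) : ℂ) / d + 2 / d * (e ν : ℂ) = -((ν.1 : ℕ) : ℂ) / d := by
    have : ((ν.1 : ℕ) : ℂ) + 2 * e ν = (l : ℕ) + (k : ℕ) := by exact_mod_cast h3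
    rw [eq_sub_of_add_eq this]
    ring
  simp only [Equiv.refl_apply]
  rw [e1, e2, e3]

end Fusion
end LG

namespace LG

/-! ### Functoriality of the tensor product -/

section TensorMaps

variable {M N M' N' M'' N'' : Type} [AddCommGroup M] [AddCommGroup N] [Module Bi M] [Module Bi N]
  [AddCommGroup M'] [AddCommGroup N'] [Module Bi M'] [Module Bi N']
  [AddCommGroup M''] [AddCommGroup N''] [Module Bi M''] [Module Bi N'']

lemma tmap_tmap (f : M' →ₗ[Bi] M'') (g : N' →ₗ[Bi] N'') (f' : M →ₗ[Bi] M') (g' : N →ₗ[Bi] N')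
    (t : BiTensor M N) : tmap f g (tmap f' g' t) = tmap (f ∘ₗ f') (g ∘ₗ g') t := by
  induction t using tensor_induction with
  | h0 => simp
  | h1 m n => simp
  | h2 s t hs ht => simp only [map_add, hs, ht]

lemma tmap_id (t : BiTensor M N) :
    tmap (LinearMap.id : M →ₗ[Bi] M) (LinearMap.id : N →ₗ[Bi] N) t = t := by
  induction t using tensor_induction with
  | h0 => simp
  | h1 m n => simp
  | h2 s t hs ht => simp only [map_add, hs, ht]

lemma tmap_add_left (f f' : M →ₗ[Bi] M') (g : N →ₗ[Bi] N') (t : BiTensor M N) :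
    tmap (f + f') g t = tmap f g t + tmap f' g t := by
  induction t using tensor_induction with
  | h0 => simp
  | h1 m n => simp [tmk_add_left]
  | h2 s t hs ht => simp only [map_add, hs, ht]; abel

lemma tmap_add_right (f : M →ₗ[Bi] M') (g g' : N →ₗ[Bi] N') (t : BiTensor M N) :
    tmap f (g + g') t = tmap f g t + tmap f g' t := by
  induction t using tensor_induction with
  | h0 => simp
  | h1 m n => simp [tmk_add_right]
  | h2 s t hs ht => simp only [map_add, hs, ht]; abel

lemma tmap_sub_left (f f' : M →ₗ[Bi] M') (g : N →ₗ[Bi] N') (t : BiTensor M N) :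
    tmap (f - f') g t = tmap f g t - tmap f' g t := by
  rw [eq_sub_iff_add_eq, ← tmap_add_left, sub_add_cancel]

lemma tmap_sub_right (f : M →ₗ[Bi] M') (g g' : N →ₗ[Bi] N') (t : BiTensor M N) :
    tmap f (g - g') t = tmap f g t - tmap f g' t := by
  rw [eq_sub_iff_add_eq, ← tmap_add_right, sub_add_cancel]

end TensorMaps

section TensorFunctor

variable {d : ℕ}

lemma tmap_mem_tgr {A A' B B' : GrBimod d} {f : A →ₗ[Bi] A'} {g : B →ₗ[Bi] B'} {a b : ℂ}
    (hf : ∀ q, ∀ m ∈ A.gr q, f m ∈ A'.gr (q + a)) (hg : ∀ q, ∀ n ∈ B.gr q, g n ∈ B'.gr (q + b))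
    {q : ℂ} {t : BiTensor A B} (ht : t ∈ tgr A B q) : tmap f g t ∈ tgr A' B' (q + (a + b)) := by
  induction ht using Submodule.span_induction with
  | mem x hx =>
    obtain ⟨r, s, m, n, rfl, hm, hn, rfl⟩ := hx
    rw [tmap_tmk, add_add_add_comm]
    exact tmk_mem_tgr (hf r m hm) (hg s n hn)
  | zero => rw [map_zero]; exact zero_mem _
  | add x y _ _ hx hy => rw [map_add]; exact add_mem hx hy
  | smul c x _ hx => rw [← smulC_eq, map_smul, smulC_eq]; exact Submodule.smul_mem _ c hx

lemma tmap_id_mem {A A' B : GrBimod d} {f : A →ₗ[Bi] A'} {a : ℂ}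
    (hf : ∀ q, ∀ m ∈ A.gr q, f m ∈ A'.gr (q + a))
    {q : ℂ} {t : BiTensor A B} (ht : t ∈ tgr A B q) :
    tmap f (LinearMap.id : B →ₗ[Bi] B) t ∈ tgr A' B (q + a) := by
  have := tmap_mem_tgr (g := (LinearMap.id : B →ₗ[Bi] B)) (b := 0) hf
    (fun q n hn => by simpa using hn) ht
  rwa [add_zero] at this

lemma id_tmap_mem {A B B' : GrBimod d} {g : B →ₗ[Bi] B'} {b : ℂ}
    (hg : ∀ q, ∀ m ∈ B.gr q, g m ∈ B'.gr (q + b))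
    {q : ℂ} {t : BiTensor A B} (ht : t ∈ tgr A B q) :
    tmap (LinearMap.id : A →ₗ[Bi] A) g t ∈ tgr A B' (q + b) := by
  have := tmap_mem_tgr (f := (LinearMap.id : A →ₗ[Bi] A)) (a := 0)
    (fun q n hn => by simpa using hn) hg ht
  rwa [zero_add] at this

/-- `f ⊗ 1`. -/
noncomputable def GrMF.mapLeft {M M' : GrMF d} (f : M ⟶ M') (N : GrMF d) :
    M.tensor N ⟶ M'.tensor N :=
  ⟨((tmap f.1.1 LinearMap.id).prodMap (tmap f.1.2 LinearMap.id),
    (tmap f.1.2 LinearMap.id).prodMap (tmap f.1.1 LinearMap.id)), by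
    obtain ⟨f, h1, h2, h3, h4⟩ := f
    have e1 : f.1 ∘ₗ M.d1 = M'.d1 ∘ₗ f.2 := LinearMap.ext h1
    have e2 : f.2 ∘ₗ M.d0 = M'.d0 ∘ₗ f.1 := LinearMap.ext h2
    refine ⟨?_, ?_, ?_, ?_⟩
    · rintro ⟨u, v⟩
      refine Prod.ext ?_ ?_ <;> simp [tmap_tmap, e1, e2]
    · rintro ⟨u, v⟩
      refine Prod.ext ?_ ?_ <;> simp [tmap_tmap, e1, e2]
    · rintro q ⟨u, v⟩ ⟨hu, hv⟩
      have k1 := tmap_id_mem (a := 0) (by simpa using h3) hu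
      have k2 := tmap_id_mem (a := 0) (by simpa using h4) hv
      rw [add_zero] at k1 k2
      exact And.intro k1 k2
    · rintro q ⟨u, v⟩ ⟨hu, hv⟩
      have k1 := tmap_id_mem (a := 0) (by simpa using h4) hu
      have k2 := tmap_id_mem (a := 0) (by simpa using h3) hv
      rw [add_zero] at k1 k2
      exact And.intro k1 k2⟩

/-- `1 ⊗ g`. -/
noncomputable def GrMF.mapRight (M : GrMF d) {N N' : GrMF d} (g : N ⟶ N') :
    M.tensor N ⟶ M.tensor N' :=
  ⟨((tmap LinearMap.id g.1.1).prodMap (tmap LinearMap.id g.1.2),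
    (tmap LinearMap.id g.1.1).prodMap (tmap LinearMap.id g.1.2)), by
    obtain ⟨f, h1, h2, h3, h4⟩ := g
    have e1 : f.1 ∘ₗ N.d1 = N'.d1 ∘ₗ f.2 := LinearMap.ext h1
    have e2 : f.2 ∘ₗ N.d0 = N'.d0 ∘ₗ f.1 := LinearMap.ext h2
    refine ⟨?_, ?_, ?_, ?_⟩
    · rintro ⟨u, v⟩
      refine Prod.ext ?_ ?_ <;> simp [tmap_tmap, e1, e2]
    · rintro ⟨u, v⟩
      refine Prod.ext ?_ ?_ <;> simp [tmap_tmap, e1, e2]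
    · rintro q ⟨u, v⟩ ⟨hu, hv⟩
      have k1 := id_tmap_mem (b := 0) (by simpa using h3) hu
      have k2 := id_tmap_mem (b := 0) (by simpa using h4) hv
      rw [add_zero] at k1 k2
      exact And.intro k1 k2
    · rintro q ⟨u, v⟩ ⟨hu, hv⟩
      have k1 := id_tmap_mem (b := 0) (by simpa using h3) hu
      have k2 := id_tmap_mem (b := 0) (by simpa using h4) hv
      rw [add_zero] at k1 k2
      exact And.intro k1 k2⟩

lemma Homotopic.mapLeft {M M' : GrMF d} {f g : M ⟶ M'} (h : Homotopic d f g) (N : GrMF d) :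
    Homotopic d (GrMF.mapLeft f N) (GrMF.mapLeft g N) := by
  obtain ⟨h0, h1, a, b, c, e⟩ := h
  have hc : f.1.1 - g.1.1 = M'.d1 ∘ₗ h0 + h1 ∘ₗ M.d0 := LinearMap.ext c
  have he : f.1.2 - g.1.2 = M'.d0 ∘ₗ h1 + h0 ∘ₗ M.d1 := LinearMap.ext e
  simp only [sub_eq_add_neg] at a b
  refine ⟨(tmap h0 LinearMap.id).prodMap (tmap h1 LinearMap.id),
    (tmap h1 LinearMap.id).prodMap (tmap h0 LinearMap.id), ?_, ?_, ?_, ?_⟩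
  · rintro q ⟨u, v⟩ ⟨hu, hv⟩
    rw [sub_eq_add_neg]
    exact And.intro (tmap_id_mem a hu) (tmap_id_mem b hv)
  · rintro q ⟨u, v⟩ ⟨hu, hv⟩
    rw [sub_eq_add_neg]
    exact And.intro (tmap_id_mem b hu) (tmap_id_mem a hv)
  · rintro ⟨u, v⟩
    refine Prod.ext ?_ ?_
    · simp only [GrMF.mapLeft, LinearMap.prodMap_apply, Prod.mk_sub_mk, ← tmap_sub_left, hc,
        tmap_add_left]
      simp [tmap_tmap]
      abel
    · simp only [GrMF.mapLeft, LinearMap.prodMap_apply, Prod.mk_sub_mk, ← tmap_sub_left, he,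
        tmap_add_left]
      simp [tmap_tmap]
      abel
  · rintro ⟨u, v⟩
    refine Prod.ext ?_ ?_
    · simp only [GrMF.mapLeft, LinearMap.prodMap_apply, Prod.mk_sub_mk, ← tmap_sub_left, he,
        tmap_add_left]
      simp [tmap_tmap]
      abel
    · simp only [GrMF.mapLeft, LinearMap.prodMap_apply, Prod.mk_sub_mk, ← tmap_sub_left, hc,
        tmap_add_left]
      simp [tmap_tmap]
      abel

/-- An odd map on the right factor has to pass the left factor, so the homotopy 1 ⊗ h carries the
Koszul sign on the summands with odd left factor. The homotopy h ⊗ 1 of `Homotopic.mapLeft` needs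
none. -/
lemma Homotopic.mapRight (M : GrMF d) {N N' : GrMF d} {f g : N ⟶ N'} (h : Homotopic d f g) :
    Homotopic d (GrMF.mapRight M f) (GrMF.mapRight M g) := by
  obtain ⟨h0, h1, a, b, c, e⟩ := h
  have hc : f.1.1 - g.1.1 = N'.d1 ∘ₗ h0 + h1 ∘ₗ N.d0 := LinearMap.ext c
  have he : f.1.2 - g.1.2 = N'.d0 ∘ₗ h1 + h0 ∘ₗ N.d1 := LinearMap.ext e
  simp only [sub_eq_add_neg] at a b
  refine ⟨(-(tmap LinearMap.id h1 ∘ₗ LinearMap.snd Bi _ _)).prod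
      (tmap LinearMap.id h0 ∘ₗ LinearMap.fst Bi _ _),
    (tmap LinearMap.id h1 ∘ₗ LinearMap.snd Bi _ _).prod
      (-(tmap LinearMap.id h0 ∘ₗ LinearMap.fst Bi _ _)), ?_, ?_, ?_, ?_⟩
  · rintro q ⟨u, v⟩ ⟨hu, hv⟩
    rw [sub_eq_add_neg]
    exact And.intro (neg_mem (id_tmap_mem b hv)) (id_tmap_mem a hu)
  · rintro q ⟨u, v⟩ ⟨hu, hv⟩
    rw [sub_eq_add_neg]
    exact And.intro (id_tmap_mem b hv) (neg_mem (id_tmap_mem a hu))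
  · rintro ⟨u, v⟩
    refine Prod.ext ?_ ?_
    · simp only [GrMF.mapRight, LinearMap.prodMap_apply, Prod.mk_sub_mk, ← tmap_sub_right, hc,
        tmap_add_right]
      simp [tmap_tmap]
      abel
    · simp only [GrMF.mapRight, LinearMap.prodMap_apply, Prod.mk_sub_mk, ← tmap_sub_right, he,
        tmap_add_right]
      simp [tmap_tmap]
      abel
  · rintro ⟨u, v⟩
    refine Prod.ext ?_ ?_
    · simp only [GrMF.mapRight, LinearMap.prodMap_apply, Prod.mk_sub_mk, ← tmap_sub_right, hc,
        tmap_add_right]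
      simp [tmap_tmap]
      abel
    · simp only [GrMF.mapRight, LinearMap.prodMap_apply, Prod.mk_sub_mk, ← tmap_sub_right, he,
        tmap_add_right]
      simp [tmap_tmap]

/-- The functor `- ⊗ N` on `ZMF^gr_bi`. -/
noncomputable def GrMF.tensorRight (N : GrMF d) : GrMF d ⥤ GrMF d where
  obj M := M.tensor N
  map f := GrMF.mapLeft f N
  map_id _ := hom_ext' (fun _ => Prod.ext (tmap_id _) (tmap_id _))
    (fun _ => Prod.ext (tmap_id _) (tmap_id _))
  map_comp f g := hom_ext'
    (fun _ => Prod.ext (tmap_tmap g.1.1 LinearMap.id f.1.1 LinearMap.id _).symm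
      (tmap_tmap g.1.2 LinearMap.id f.1.2 LinearMap.id _).symm)
    (fun _ => Prod.ext (tmap_tmap g.1.2 LinearMap.id f.1.2 LinearMap.id _).symm
      (tmap_tmap g.1.1 LinearMap.id f.1.1 LinearMap.id _).symm)

/-- The functor `M ⊗ -` on `ZMF^gr_bi`. -/
noncomputable def GrMF.tensorLeft (M : GrMF d) : GrMF d ⥤ GrMF d where
  obj N := M.tensor N
  map g := GrMF.mapRight M g
  map_id _ := hom_ext' (fun _ => Prod.ext (tmap_id _) (tmap_id _))
    (fun _ => Prod.ext (tmap_id _) (tmap_id _))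
  map_comp f g := hom_ext'
    (fun _ => Prod.ext (tmap_tmap LinearMap.id g.1.1 LinearMap.id f.1.1 _).symm
      (tmap_tmap LinearMap.id g.1.2 LinearMap.id f.1.2 _).symm)
    (fun _ => Prod.ext (tmap_tmap LinearMap.id g.1.1 LinearMap.id f.1.1 _).symm
      (tmap_tmap LinearMap.id g.1.2 LinearMap.id f.1.2 _).symm)

instance (N : GrMF d) : (GrMF.tensorRight N).Additive where
  map_add {_ _ f g} := hom_ext'
    (fun _ => Prod.ext (tmap_add_left f.1.1 g.1.1 LinearMap.id _)
      (tmap_add_left f.1.2 g.1.2 LinearMap.id _))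
    (fun _ => Prod.ext (tmap_add_left f.1.2 g.1.2 LinearMap.id _)
      (tmap_add_left f.1.1 g.1.1 LinearMap.id _))

instance (M : GrMF d) : (GrMF.tensorLeft M).Additive where
  map_add {_ _ f g} := hom_ext'
    (fun _ => Prod.ext (tmap_add_right LinearMap.id f.1.1 g.1.1 _)
      (tmap_add_right LinearMap.id f.1.2 g.1.2 _))
    (fun _ => Prod.ext (tmap_add_right LinearMap.id f.1.1 g.1.1 _)
      (tmap_add_right LinearMap.id f.1.2 g.1.2 _))

/-- The functor `- ⊗ Y` on `HMF^gr_bi`. -/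
noncomputable def HMF.tensorRight (Y : HMF d) : HMF d ⥤ HMF d :=
  CategoryTheory.Quotient.lift (Homotopic d)
    (GrMF.tensorRight Y.as ⋙ Quotient.functor (Homotopic d))
    fun _ _ _ _ h => CategoryTheory.Quotient.sound (Homotopic d) (h.mapLeft Y.as)

/-- The functor `X ⊗ -` on `HMF^gr_bi`. -/
noncomputable def HMF.tensorLeft (X : HMF d) : HMF d ⥤ HMF d :=
  CategoryTheory.Quotient.lift (Homotopic d)
    (GrMF.tensorLeft X.as ⋙ Quotient.functor (Homotopic d))
    fun _ _ _ _ h => CategoryTheory.Quotient.sound (Homotopic d) (h.mapRight X.as)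

instance (Y : HMF d) : (HMF.tensorRight Y).Additive where
  map_add {X X' f g} := by
    obtain ⟨f, rfl⟩ := (Quotient.functor (Homotopic d)).map_surjective (X := X.as) (Y := X'.as) f
    obtain ⟨g, rfl⟩ := (Quotient.functor (Homotopic d)).map_surjective (X := X.as) (Y := X'.as) g
    exact (GrMF.tensorRight Y.as ⋙ Quotient.functor (Homotopic d)).map_add

instance (X : HMF d) : (HMF.tensorLeft X).Additive where
  map_add {Y Y' f g} := by
    obtain ⟨f, rfl⟩ := (Quotient.functor (Homotopic d)).map_surjective (X := Y.as) (Y := Y'.as) f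
    obtain ⟨g, rfl⟩ := (Quotient.functor (Homotopic d)).map_surjective (X := Y.as) (Y := Y'.as) g
    exact (GrMF.tensorLeft X.as ⋙ Quotient.functor (Homotopic d)).map_add

end TensorFunctor

/-! ### Closure under tensor products -/

section Closure

variable {d : ℕ} [NeZero d]

lemma isPT_of_isDirectSum_hatPI {J : Type} [Finite J] {X : HMF d}
    {F : J → ZMod d × Fin (d - 1)} (h : IsDirectSum X fun j => hatPI d (F j).1 (F j).2) :
    isPT d X := by
  have := Fintype.ofFinite J
  exact ⟨_, fun i => F ((Fintype.equivFin J).symm i), h.reindex (Fintype.equivFin J).symm⟩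

lemma isPT_of_isDirectSum {J : Type} [Finite J] {X : HMF d} {F : J → HMF d}
    (h : IsDirectSum X F) (hF : ∀ j, isPT d (F j)) : isPT d X := by
  choose n G hG using hF
  exact isPT_of_isDirectSum_hatPI (F := fun p : Σ j, Fin (n j) => G p.1 p.2) (h.sigma hG)

/-- Tensoring with a fixed object on either side is an additive functor on the homotopy category and
preserves finite direct sums. This reduces the claim to the fusion rule. -/
lemma isPT_tensor (hd : 2 ≤ d) {X Y : HMF d} (hX : isPT d X) (hY : isPT d Y) :
    isPT d (X.tensor Y) := by
  obtain ⟨n, F, hF⟩ := hX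
  obtain ⟨m, G, hG⟩ := hY
  refine isPT_of_isDirectSum (hF.map (HMF.tensorRight Y)) fun i => ?_
  refine isPT_of_isDirectSum (hG.map (HMF.tensorLeft (hatPI d (F i).1 (F i).2))) fun j => ?_
  exact isPT_of_isDirectSum_hatPI (F := fun ν : {ν : Fin (d - 1) // Fusion d (F i).2 (G j).2 ν} =>
    ((F i).1 + (G j).1 + ((((F i).2 : ℕ) + (G j).2 - (ν.1 : ℕ)) / 2 : ℕ), ν.1))
    (isDirectSum_tensor_hatPI hd (F i).1 (G j).1 (F i).2 (G j).2)

end Closure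
end LG

namespace LG

/-! ### Morphisms between the basic objects -/

section HomComputation

variable {d : ℕ}

lemma mem_arc {a b : ZMod d} {l : ℕ} : b ∈ arc d a l ↔ ∃ k < l, a + (k : ZMod d) = b := by
  simp [arc]

/-- A nonempty proper arc has exactly one element whose predecessor lies outside it, namely its
starting point. The cardinality gives the length. -/
lemma arc_injective : Function.Injective fun p : ZMod d × Fin (d - 1) => arc d p.1 (p.2 + 1) := by
  rintro ⟨a, l⟩ ⟨b, k⟩ h
  simp only at h
  have hl := l.2
  have hk := k.2
  have hc := congrArg Finset.card h
  rw [card_arc a (by omega), card_arc b (by omega)] at hc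
  obtain rfl : l = k := Fin.ext (by omega)
  have ha : a ∈ arc d b (l + 1) := h ▸ mem_arc.mpr ⟨0, by omega, by simp⟩
  have hb : b - 1 ∉ arc d b (l + 1) := by
    rintro hm
    obtain ⟨i, hi, e⟩ := mem_arc.mp hm
    have e' : ((i + 1 : ℕ) : ZMod d) = 0 := by
      push_cast
      linear_combination e
    rw [ZMod.natCast_eq_zero_iff] at e'
    have := Nat.le_of_dvd (by omega) e'
    omega
  rw [← h] at hb
  obtain ⟨i, hi, e⟩ := mem_arc.mp ha
  rcases Nat.eq_zero_or_pos i with rfl | hpos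
  · simp at e
    rw [e]
  · exfalso
    have hbm : b ∈ arc d a (l + 1) := h ▸ mem_arc.mpr ⟨0, by omega, by simp⟩
    obtain ⟨j, hj, e2⟩ := mem_arc.mp hbm
    rcases Nat.eq_zero_or_pos j with rfl | hjpos
    · have e3 : ((i : ℕ) : ZMod d) = 0 := by
        simp only [Nat.cast_zero, add_zero] at e2
        linear_combination e + e2
      rw [ZMod.natCast_eq_zero_iff] at e3
      have := Nat.le_of_dvd (by omega) e3
      omega
    · refine hb (mem_arc.mpr ⟨j - 1, by omega, ?_⟩)
      rw [Nat.cast_sub (by omega), ← e2]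
      push_cast
      ring

variable [NeZero d]

/-- The zeros at y = 1 recover the set S, because η is a primitive root. -/
lemma eval_permPoly_eq_zero_iff (S : Finset (ZMod d)) (j : ZMod d) :
    MvPolynomial.eval ![eta d ^ j.val, 1] (permPoly d S) = 0 ↔ j ∈ S := by
  rw [permPoly, map_prod, Finset.prod_eq_zero_iff]
  constructor
  · rintro ⟨i, hi, h⟩
    have h' : eta d ^ j.val = eta d ^ i.val := by simpa [sub_eq_zero] using h
    rwa [ZMod.val_injective d ((eta_primitive d).pow_inj (ZMod.val_lt j) (ZMod.val_lt i) h')]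
  · exact fun h => ⟨j, h, by simp⟩

lemma hom_permMF_ext {S : Finset (ZMod d)} {α : ℂ} {M : GrMF d} {f g : permMF d S α ⟶ M}
    (h0 : evenPart _ _ f (1 : Bi) = evenPart _ _ g (1 : Bi))
    (h1 : oddPart _ _ f (1 : Bi) = oddPart _ _ g (1 : Bi)) : f = g := by
  refine hom_ext' (fun (m : Bi) => ?_) (fun (m : Bi) => ?_)
  · have e : (m : Bi) = m • (1 : Bi) := by simp
    have k1 := (evenPart _ _ f).map_smul m (1 : Bi)
    have k2 := (evenPart _ _ g).map_smul m (1 : Bi)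
    rw [h0, ← k2] at k1
    rw [← e] at k1
    exact k1
  · have e : (m : Bi) = m • (1 : Bi) := by simp
    have k1 := (oddPart _ _ f).map_smul m (1 : Bi)
    have k2 := (oddPart _ _ g).map_smul m (1 : Bi)
    rw [h1, ← k2] at k1
    rw [← e] at k1
    exact k1

lemma half_ne_natCast {s t : ℕ} (h : t < s) (n : ℕ) : (n : ℂ) ≠ ((t : ℂ) - s) / 2 := by
  intro e
  have e' : ((2 * n + s : ℕ) : ℂ) = t := by
    push_cast
    rw [e]
    ring
  have := Nat.cast_injective e'
  omega

lemma homog_evenPart {S T : Finset (ZMod d)} {α β : ℂ} (f : permMF d S α ⟶ permMF d T β) :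
    MvPolynomial.IsWeightedHomogeneous (wt d) (evenPart _ _ f (1 : Bi) : Bi) (α - β) :=
  f.2.2.2.1 α (1 : Bi) (mem_poly_gr.mpr (by
    rw [sub_self]; exact MvPolynomial.isWeightedHomogeneous_one ℂ (wt d)))

lemma homog_oddPart {S T : Finset (ZMod d)} {α β : ℂ} (f : permMF d S α ⟶ permMF d T β) :
    MvPolynomial.IsWeightedHomogeneous (wt d) (oddPart _ _ f (1 : Bi) : Bi)
      (α + 2 / d * S.card - 1 - (β + 2 / d * T.card - 1)) :=
  f.2.2.2.2 (α + 2 / d * S.card - 1) (1 : Bi) (mem_poly_gr.mpr (by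
    rw [sub_self]; exact MvPolynomial.isWeightedHomogeneous_one ℂ (wt d)))

lemma evenPart_mul_permPoly {S T : Finset (ZMod d)} {α β : ℂ} (f : permMF d S α ⟶ permMF d T β) :
    permPoly d S * (evenPart _ _ f (1 : Bi) : Bi) =
      permPoly d T * (oddPart _ _ f (1 : Bi) : Bi) := by
  have h1 := f.2.1 (1 : Bi)
  have h2 := (evenPart _ _ f).map_smul (permPoly d S) (1 : Bi)
  exact h2.symm.trans h1

/-- There are no nonzero morphisms of degree zero between different `P̂_S`. -/
lemma hom_hatP_eq_zero {S T : Finset (ZMod d)} (hST : S ≠ T)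
    (f : permMF d S ((1 - S.card) / d) ⟶ permMF d T ((1 - T.card) / d)) : f = 0 := by
  have hp := homog_evenPart f
  have hr := homog_oddPart f
  have hrel := evenPart_mul_permPoly f
  set p : Bi := evenPart _ _ f (1 : Bi) with hpdef
  set r : Bi := oddPart _ _ f (1 : Bi) with hrdef
  have e1 : ((1 - (S.card : ℂ)) / d - (1 - T.card) / d) =
      2 / d * (((T.card : ℂ) - S.card) / 2) := by
    ring
  have e2 : ((1 - (S.card : ℂ)) / d + 2 / d * S.card - 1 -
      ((1 - (T.card : ℂ)) / d + 2 / d * T.card - 1)) =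
      2 / d * (((S.card : ℂ) - T.card) / 2) := by
    ring
  rw [e1] at hp
  rw [e2] at hr
  -- The degrees of p and r are opposite. If |S| ≠ |T|, one is negative and that polynomial
  -- vanishes. If |S| = |T|, p is constant, and evaluating f_S p = f_T r at a root of f_T that is
  -- not one of f_S gives p = 0. The relation then kills the other polynomial.
  have hor : p = 0 ∨ r = 0 := by
    rcases lt_trichotomy T.card S.card with h | h | h
    · exact Or.inl (eq_zero_of_degree hp (half_ne_natCast h))
    · have hTS : ¬ T ⊆ S := fun h' => hST (Finset.eq_of_subset_of_card_le h' h.ge).symm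
      obtain ⟨j, hjT, hjS⟩ := Finset.not_subset.mp hTS
      rw [h, sub_self, zero_div, mul_zero] at hp
      have hc := eq_C_of_degree_zero hp
      rw [hc] at hrel
      have := congrArg (MvPolynomial.eval ![eta d ^ j.val, 1]) hrel
      rw [map_mul, map_mul, (eval_permPoly_eq_zero_iff T j).mpr hjT, zero_mul, mul_eq_zero,
        eval_permPoly_eq_zero_iff, MvPolynomial.eval_C] at this
      rw [this.resolve_left hjS, MvPolynomial.C_0] at hc
      exact Or.inl hc
    · exact Or.inr (eq_zero_of_degree hr (half_ne_natCast h))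
  have hp0 : p = 0 := by
    rcases hor with h | h
    · exact h
    · rw [h, mul_zero] at hrel
      exact (mul_eq_zero.mp hrel).resolve_left (permPoly_ne_zero S)
  have hr0 : r = 0 := by
    rw [hp0, mul_zero] at hrel
    exact (mul_eq_zero.mp hrel.symm).resolve_left (permPoly_ne_zero T)
  exact hom_permMF_ext hp0 hr0

/-- The even component has degree 0, hence is a constant, and cancelling f_S in the relation of
closedness gives the same constant on the odd component. -/
lemma exists_eq_smul_id_permMF {S : Finset (ZMod d)} {α : ℂ} (f : permMF d S α ⟶ permMF d S α) :
    ∃ c : ℂ, f = c • 𝟙 _ := by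
  have hp := homog_evenPart f
  have hrel := evenPart_mul_permPoly f
  rw [sub_self] at hp
  have hc := eq_C_of_degree_zero hp
  set p : Bi := evenPart _ _ f (1 : Bi) with hpdef
  have hr : p = (oddPart _ _ f (1 : Bi) : Bi) := mul_left_cancel₀ (permPoly_ne_zero S) hrel
  set c := MvPolynomial.constantCoeff p
  have hone : p = c • (1 : Bi) := by rw [hc, MvPolynomial.smul_eq_C_mul, mul_one]
  exact ⟨c, hom_permMF_ext hone (hr.symm.trans hone)⟩

/-- A homotopy of degree -1 has components of polynomial degree -|S| and |S| - d. Both are negative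
for 0 < |S| < d, so it is zero and cannot contract the identity. -/
lemma id_permMF_ne_zero {S : Finset (ZMod d)} (h0 : 0 < S.card) (h1 : S.card < d) (α : ℂ) :
    𝟙 (⟨permMF d S α⟩ : HMF d) ≠ 0 := by
  intro h
  have hh : Homotopic d (𝟙 (permMF d S α)) 0 :=
    (Quotient.functor_map_eq_iff (Homotopic d) _ _).mp h
  obtain ⟨k0, k1, hk0, hk1, he, -⟩ := hh
  have z0 : k0 (1 : Bi) = (0 : Bi) := by
    have hm : MvPolynomial.IsWeightedHomogeneous (wt d) (k0 (1 : Bi) : Bi)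
        (α - 1 - (α + 2 / d * S.card - 1)) :=
      hk0 α (1 : Bi) (mem_poly_gr.mpr (by
        rw [sub_self]; exact MvPolynomial.isWeightedHomogeneous_one ℂ (wt d)))
    have e : α - 1 - (α + 2 / d * S.card - 1) = 2 / d * (-(S.card : ℂ)) := by ring
    rw [e] at hm
    refine eq_zero_of_degree hm fun n hn => ?_
    rw [eq_neg_iff_add_eq_zero] at hn
    have : n + S.card = 0 := by exact_mod_cast hn
    omega
  have z1 : k1 (1 : Bi) = (0 : Bi) := by
    have hm : MvPolynomial.IsWeightedHomogeneous (wt d) (k1 (1 : Bi) : Bi)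
        (α + 2 / d * S.card - 1 - 1 - α) :=
      hk1 (α + 2 / d * S.card - 1) (1 : Bi) (mem_poly_gr.mpr (by
        rw [sub_self]; exact MvPolynomial.isWeightedHomogeneous_one ℂ (wt d)))
    have e : α + 2 / d * S.card - 1 - 1 - α = 2 / d * ((S.card : ℂ) - d) := by
      rw [mul_sub, two_div_mul_self]
      ring
    rw [e] at hm
    refine eq_zero_of_degree hm fun n hn => ?_
    rw [eq_sub_iff_add_eq] at hn
    have : n + d = S.card := by exact_mod_cast hn
    omega
  have h2 := he (1 : Bi)
  have h3 : k1 ((permMF d S α).d0 (1 : Bi)) = (0 : Bi) := by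
    refine (k1.map_smul (permPoly d Sᶜ) (1 : Bi)).trans ?_
    rw [z1]
    exact smul_zero _
  rw [h3, z0, map_zero, add_zero] at h2
  have h4 : (1 : Bi) - 0 = 0 := h2
  simp at h4

lemma hom_hatPI_eq_zero {p q : ZMod d × Fin (d - 1)} (h : p ≠ q)
    (f : hatPI d p.1 p.2 ⟶ hatPI d q.1 q.2) : f = 0 := by
  obtain ⟨f, rfl⟩ := (Quotient.functor (Homotopic d)).map_surjective
    (X := (hatPI d p.1 p.2).as) (Y := (hatPI d q.1 q.2).as) f
  have : f = 0 := hom_hatP_eq_zero (fun e => h (arc_injective e)) f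
  rw [this, Functor.map_zero]

lemma exists_eq_smul_id_hatPI (a : ZMod d) (l : Fin (d - 1)) (f : hatPI d a l ⟶ hatPI d a l) :
    ∃ c : ℂ, f = c • 𝟙 _ := by
  obtain ⟨f, rfl⟩ := (Quotient.functor (Homotopic d)).map_surjective
    (X := (hatPI d a l).as) (Y := (hatPI d a l).as) f
  obtain ⟨c, hc⟩ := exists_eq_smul_id_permMF f
  exact ⟨c, congrArg (Quotient.functor (Homotopic d)).map hc⟩

lemma id_hatPI_ne_zero (a : ZMod d) (l : Fin (d - 1)) : 𝟙 (hatPI d a l) ≠ 0 := by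
  have hl := l.2
  have hc : (arc d a (l + 1)).card = l + 1 := card_arc a (by omega)
  exact id_permMF_ne_zero (S := arc d a (l + 1)) (by omega) (by omega) _

end HomComputation

/-! ### Existence of finite direct sums -/

section FiniteSums

variable {d : ℕ}

/-- The direct sum of two bifactorizations. -/
noncomputable def GrMF.prod (M N : GrMF d) : GrMF d where
  M0 := M.M0.prod N.M0
  M1 := M.M1.prod N.M1
  d0 := M.d0.prodMap N.d0
  d1 := M.d1.prodMap N.d1
  d1_d0 m := Prod.ext (M.d1_d0 m.1) (N.d1_d0 m.2)
  d0_d1 m := Prod.ext (M.d0_d1 m.1) (N.d0_d1 m.2)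
  d0_mem q _ hm := And.intro (M.d0_mem q _ hm.1) (N.d0_mem q _ hm.2)
  d1_mem q _ hm := And.intro (M.d1_mem q _ hm.1) (N.d1_mem q _ hm.2)

/-- The inclusion of the first summand. -/
noncomputable def GrMF.inl (M N : GrMF d) : M ⟶ M.prod N :=
  ⟨(LinearMap.inl Bi M.M0 N.M0, LinearMap.inl Bi M.M1 N.M1),
    fun _ => Prod.ext rfl (map_zero N.d1).symm, fun _ => Prod.ext rfl (map_zero N.d0).symm,
    fun _ _ hm => And.intro hm (zero_mem _), fun _ _ hm => And.intro hm (zero_mem _)⟩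

/-- The inclusion of the second summand. -/
noncomputable def GrMF.inr (M N : GrMF d) : N ⟶ M.prod N :=
  ⟨(LinearMap.inr Bi M.M0 N.M0, LinearMap.inr Bi M.M1 N.M1),
    fun _ => Prod.ext (map_zero M.d1).symm rfl, fun _ => Prod.ext (map_zero M.d0).symm rfl,
    fun _ _ hm => And.intro (zero_mem _) hm, fun _ _ hm => And.intro (zero_mem _) hm⟩

/-- The projection to the first summand. -/
noncomputable def GrMF.fst (M N : GrMF d) : M.prod N ⟶ M :=
  ⟨(LinearMap.fst Bi M.M0 N.M0, LinearMap.fst Bi M.M1 N.M1),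
    fun _ => rfl, fun _ => rfl, fun _ _ hm => hm.1, fun _ _ hm => hm.1⟩

/-- The projection to the second summand. -/
noncomputable def GrMF.snd (M N : GrMF d) : M.prod N ⟶ N :=
  ⟨(LinearMap.snd Bi M.M0 N.M0, LinearMap.snd Bi M.M1 N.M1),
    fun _ => rfl, fun _ => rfl, fun _ _ hm => hm.2, fun _ _ hm => hm.2⟩

lemma HMF.exists_binary_sum (X Y : HMF d) : ∃ (Z : HMF d) (i : X ⟶ Z) (j : Y ⟶ Z) (p : Z ⟶ X)
    (q : Z ⟶ Y), i ≫ p = 𝟙 X ∧ j ≫ q = 𝟙 Y ∧ i ≫ q = 0 ∧ j ≫ p = 0 ∧ p ≫ i + q ≫ j = 𝟙 Z := by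
  let Q := Quotient.functor (Homotopic d)
  let M := X.as
  let N := Y.as
  refine ⟨⟨M.prod N⟩, Q.map (GrMF.inl M N), Q.map (GrMF.inr M N), Q.map (GrMF.fst M N),
    Q.map (GrMF.snd M N), ?_, ?_, ?_, ?_, ?_⟩
  · exact congrArg (fun f => Q.map f) (show GrMF.inl M N ≫ GrMF.fst M N = 𝟙 M from rfl)
  · exact congrArg (fun f => Q.map f) (show GrMF.inr M N ≫ GrMF.snd M N = 𝟙 N from rfl)
  · exact congrArg (fun f => Q.map f) (show GrMF.inl M N ≫ GrMF.snd M N = 0 from rfl)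
  · exact congrArg (fun f => Q.map f) (show GrMF.inr M N ≫ GrMF.fst M N = 0 from rfl)
  · have : GrMF.fst M N ≫ GrMF.inl M N + GrMF.snd M N ≫ GrMF.inr M N = 𝟙 (M.prod N) :=
      hom_ext' (fun m => Prod.ext (add_zero _) (zero_add _))
        (fun m => Prod.ext (add_zero _) (zero_add _))
    exact congrArg (fun f => Q.map f) this

lemma HMF.exists_isDirectSum [NeZero d] (n : ℕ) (F : Fin n → HMF d) : ∃ X, IsDirectSum X F := by
  induction n with
  | zero =>
    -- The contractible object P_∅ represents the empty sum.
    refine ⟨⟨permMF d ∅ 0⟩, .of_total (fun j => j.elim0) (fun j => j.elim0) (fun j => j.elim0)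
      (fun j => j.elim0) ?_⟩
    rw [id_permMF_empty]
    simp
  | succ n ih =>
    obtain ⟨Y, hY⟩ := ih fun j => F j.succ
    obtain ⟨ι, π, h1, h0, ht⟩ := hY.exists_total
    obtain ⟨Z, i, j, p, q, hip, hjq, hiq, hjp, hpq⟩ := HMF.exists_binary_sum (F 0) Y
    refine ⟨Z, .of_total (Fin.cases i fun k => ι k ≫ j) (Fin.cases p fun k => q ≫ π k) ?_ ?_ ?_⟩
    · intro k
      cases k using Fin.cases with
      | zero => exact hip
      | succ k => simp [reassoc_of% hjq, h1]
    · intro k l hkl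
      cases k using Fin.cases with
      | zero =>
        cases l using Fin.cases with
        | zero => exact absurd rfl hkl
        | succ l => simp [reassoc_of% hiq]
      | succ k =>
        cases l using Fin.cases with
        | zero => simp [hjp]
        | succ l => simp [reassoc_of% hjq, h0 k l fun h => hkl (congrArg _ h)]
    · rw [Fin.sum_univ_succ, ← hpq]
      congr 1
      have : ∀ k, (q ≫ π k) ≫ ι k ≫ j = q ≫ (π k ≫ ι k) ≫ j := by simp
      simp only [Fin.cases_succ, this]
      rw [← Preadditive.comp_sum, ← Preadditive.sum_comp, ht, Category.id_comp]

end FiniteSums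
end LG

namespace LG

/-! ### Semisimplicity from Schur's lemma -/

section Semisimple

universe v u

/-- A family of pairwise non-isomorphic objects, with scalars as endomorphisms and no morphisms
between different members, of which each object is a finite direct sum. -/
structure IsSimpleBasis {C : Type u} [Category.{v} C] [Preadditive C] [Linear ℂ C] {I : Type}
    (P : I → C) : Prop where
  hom_eq_zero : ∀ {i j : I}, i ≠ j → ∀ f : P i ⟶ P j, f = 0
  exists_eq_smul : ∀ (i : I) (f : P i ⟶ P i), ∃ c : ℂ, f = c • 𝟙 _
  id_ne_zero : ∀ i : I, 𝟙 (P i) ≠ 0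
  exists_sum : ∀ X : C, ∃ (n : ℕ) (F : Fin n → I), IsDirectSum X fun j => P (F j)

namespace IsSimpleBasis

section Simple

variable {C : Type u} [Category.{v} C] [Preadditive C] [Linear ℂ C] {I : Type} {P : I → C}

lemma eq_and_exists_inverse (h : IsSimpleBasis P) {i j : I} {f : P i ⟶ P j} (hf : f ≠ 0) :
    i = j ∧ ∃ g : P j ⟶ P i, f ≫ g = 𝟙 _ ∧ g ≫ f = 𝟙 _ := by
  by_cases hij : i = j
  · subst hij
    obtain ⟨c, rfl⟩ := h.exists_eq_smul i f
    have hc : c ≠ 0 := fun hc => hf (by rw [hc, zero_smul])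
    exact ⟨rfl, c⁻¹ • 𝟙 _, by simp [smul_smul, hc], by simp [smul_smul, hc]⟩
  · exact absurd (h.hom_eq_zero hij f) hf

lemma simple (h : IsSimpleBasis P) (i : I) : Simple (P i) where
  mono_isIso_iff_nonzero {Y} f hm := by
    constructor
    · rintro hiso rfl
      apply h.id_ne_zero i
      rw [← IsIso.inv_hom_id (0 : Y ⟶ P i), comp_zero]
    · intro hf
      obtain ⟨n, F, hF⟩ := h.exists_sum Y
      obtain ⟨ι, π, -, -, ht⟩ := hF.exists_total
      -- Some basic summand of Y maps nontrivially to P i, and hence isomorphically. This gives a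
      -- right inverse of f, and a monomorphism with a right inverse is invertible.
      have hex : ∃ j, ι j ≫ f ≠ 0 := by
        by_contra! hall
        apply hf
        rw [← Category.id_comp f, ← ht, Preadditive.sum_comp]
        exact Finset.sum_eq_zero fun j _ => by rw [Category.assoc, hall j, comp_zero]
      obtain ⟨j, hj⟩ := hex
      obtain ⟨-, g, -, hg⟩ := h.eq_and_exists_inverse hj
      rw [← Category.assoc] at hg
      exact ⟨g ≫ ι j, by rw [← cancel_mono f]; simp [hg], hg⟩

lemma existsUnique_iso (h : IsSimpleBasis P) (X : C) (hX : Simple X) :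
    ∃! i, Nonempty (X ≅ P i) := by
  obtain ⟨n, F, hF⟩ := h.exists_sum X
  obtain ⟨ι, π, h1, -, ht⟩ := hF.exists_total
  have hex : ∃ j, ι j ≠ 0 := by
    by_contra! hall
    apply id_nonzero X
    rw [← ht]
    exact Finset.sum_eq_zero fun j _ => by rw [hall j, comp_zero]
  obtain ⟨j, hj⟩ := hex
  have : Mono (ι j) := mono_of_mono_fac (h1 j)
  have := isIso_of_mono_of_nonzero hj
  refine ⟨F j, ⟨(asIso (ι j)).symm⟩, ?_⟩
  rintro k ⟨e⟩
  by_contra hne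
  have h0 := h.hom_eq_zero hne (e.inv ≫ inv (ι j))
  apply h.id_ne_zero k
  calc 𝟙 (P k) = (e.inv ≫ inv (ι j)) ≫ ι j ≫ e.hom := by simp
    _ = 0 := by rw [h0, zero_comp]

end Simple

section Abelian

variable {C : Type u} [Category.{0} C] [Preadditive C] [Linear ℂ C] {I : Type} {P : I → C}

/-- Hom(P i, X) embeds into the product of the Hom(P i, P (F j)), each of dimension at most one. -/
lemma finite_hom (h : IsSimpleBasis P) (i : I) (X : C) : Module.Finite ℂ (P i ⟶ X) := by
  obtain ⟨n, F, hF⟩ := h.exists_sum X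
  obtain ⟨ι, π, -, -, ht⟩ := hF.exists_total
  have hfin : ∀ j, Module.Finite ℂ (P i ⟶ P j) := by
    intro j
    by_cases hij : i = j
    · subst hij
      refine Module.Finite.of_surjective (LinearMap.toSpanSingleton ℂ (P i ⟶ P i) (𝟙 _)) fun f => ?_
      obtain ⟨c, rfl⟩ := h.exists_eq_smul i f
      exact ⟨c, rfl⟩
    · have : Subsingleton (P i ⟶ P j) :=
        ⟨fun f g => by rw [h.hom_eq_zero hij f, h.hom_eq_zero hij g]⟩
      infer_instance
  refine Module.Finite.of_injective
    (LinearMap.pi fun j => Linear.rightComp ℂ (P i) (π j)) fun f g hfg => ?_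
  have hj : ∀ j, f ≫ π j = g ≫ π j := fun j => congrFun hfg j
  rw [← Category.comp_id f, ← Category.comp_id g, ← ht]
  simp only [Preadditive.comp_sum, ← Category.assoc, hj]

/-- The functor that sends `X` to the multiplicity spaces `Hom (P i, X)`. -/
noncomputable def multiplicity (h : IsSimpleBasis P) : C ⥤ Discrete I ⥤ FGModuleCat.{0} ℂ where
  obj X := Discrete.functor fun i =>
    haveI := h.finite_hom i X
    FGModuleCat.of ℂ (P i ⟶ X)
  map {X Y} f := Discrete.natTrans fun i =>
    haveI := h.finite_hom i.as X
    haveI := h.finite_hom i.as Y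
    FGModuleCat.ofHom (Linear.rightComp ℂ (P i.as) f)
  map_id X := by
    ext ⟨i⟩ u
    exact Category.comp_id _
  map_comp f g := by
    ext ⟨i⟩ u
    exact (Category.assoc _ _ _).symm

instance (h : IsSimpleBasis P) : h.multiplicity.Faithful where
  map_injective {X Y f g} hfg := by
    obtain ⟨n, F, hF⟩ := h.exists_sum X
    obtain ⟨ι, π, -, -, ht⟩ := hF.exists_total
    have hj : ∀ j, ι j ≫ f = ι j ≫ g := fun j =>
      congrArg (fun T => (T.app ⟨F j⟩).hom.hom (ι j)) hfg
    rw [← Category.id_comp f, ← Category.id_comp g, ← ht]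
    simp only [Preadditive.sum_comp, Category.assoc, hj]

instance (h : IsSimpleBasis P) : h.multiplicity.Full where
  map_surjective {X Y} T := by
    obtain ⟨n, F, hF⟩ := h.exists_sum X
    obtain ⟨ι, π, -, -, ht⟩ := hF.exists_total
    let t (i : I) : (P i ⟶ X) →ₗ[ℂ] (P i ⟶ Y) := (T.app ⟨i⟩).hom.hom
    -- A natural transformation over a discrete category carries no condition. Compatibility with
    -- maps between basic objects is automatic, as these are scalars or zero.
    have key : ∀ {i j : I} (v : P i ⟶ P j) (w : P j ⟶ X), t i (v ≫ w) = v ≫ t j w := by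
      intro i j v w
      by_cases hij : i = j
      · subst hij
        obtain ⟨c, rfl⟩ := h.exists_eq_smul i v
        simp
      · simp [h.hom_eq_zero hij v]
    -- The preimage is prescribed on each summand of X by the value of T on its inclusion.
    refine ⟨∑ j, π j ≫ t (F j) (ι j), ?_⟩
    ext ⟨i⟩ w
    suffices hw : ∀ w : P i ⟶ X, w ≫ (∑ j, π j ≫ t (F j) (ι j)) = t i w from hw w
    intro w
    conv_rhs => rw [← Category.comp_id w, ← ht, Preadditive.comp_sum, map_sum]
    rw [Preadditive.comp_sum]
    refine Finset.sum_congr rfl fun j _ => ?_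
    rw [← Category.assoc, ← key, Category.assoc]

lemma exists_hom_equiv (h : IsSimpleBasis P) {m : I → ℕ} [Finite I] {X : C}
    (hX : IsDirectSum X fun p : Σ i, Fin (m i) => P p.1) (i : I) :
    Nonempty ((P i ⟶ X) ≃ₗ[ℂ] (Fin (m i) → ℂ)) := by
  classical
  have := Fintype.ofFinite I
  obtain ⟨ι, π, h1, h0, ht⟩ := hX.exists_total
  let L : (Fin (m i) → ℂ) →ₗ[ℂ] (P i ⟶ X) := Fintype.linearCombination ℂ fun k => ι ⟨i, k⟩
  refine ⟨(LinearEquiv.ofBijective L ⟨?_, fun f => ?_⟩).symm⟩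
  · rw [injective_iff_map_eq_zero]
    intro c hc
    ext k
    have e : L c ≫ π ⟨i, k⟩ = c k • 𝟙 (P i) := by
      rw [Fintype.linearCombination_apply, Preadditive.sum_comp,
        Finset.sum_eq_single k (fun l _ hl => ?_) (by simp), Linear.smul_comp, h1 ⟨i, k⟩]
      rw [Linear.smul_comp, h0 ⟨i, l⟩ ⟨i, k⟩ (by simpa using hl), smul_zero]
    rw [hc, zero_comp] at e
    exact (smul_eq_zero.mp e.symm).resolve_right (h.id_ne_zero i)
  · choose c hc using fun k => h.exists_eq_smul i (f ≫ π ⟨i, k⟩)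
    refine ⟨c, ?_⟩
    rw [Fintype.linearCombination_apply]
    conv_rhs => rw [← Category.comp_id f, ← ht, Preadditive.comp_sum, Fintype.sum_sigma]
    rw [Finset.sum_eq_single i (fun j _ hj => Finset.sum_eq_zero fun k _ => ?_) (by simp)]
    · refine Finset.sum_congr rfl fun k _ => ?_
      rw [← Category.assoc, hc k, Linear.smul_comp, Category.id_comp]
    · rw [← Category.assoc, h.hom_eq_zero hj.symm (f ≫ π ⟨j, k⟩), zero_comp]

/-- A family of vector spaces is realized by the sum of dim G_i copies of P i. Finiteness of I makes
this a finite sum. -/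
lemma essSurj_multiplicity (h : IsSimpleBasis P) [Finite I]
    (hsum : ∀ (n : ℕ) (F : Fin n → C), ∃ X, IsDirectSum X F) : h.multiplicity.EssSurj where
  mem_essImage G := by
    let m (i : I) : ℕ := Module.finrank ℂ (G.obj ⟨i⟩)
    have := Fintype.ofFinite I
    let e := Fintype.equivFin (Σ i, Fin (m i))
    obtain ⟨X, hX⟩ := hsum _ fun k => P (e.symm k).1
    have hX' : IsDirectSum X fun p : Σ i, Fin (m i) => P p.1 := by
      have := hX.reindex e
      simpa using this
    have φ := fun i => (h.exists_hom_equiv hX' i).some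
    refine ⟨X, ⟨Discrete.natIso fun i => ?_⟩⟩
    haveI := h.finite_hom i.as X
    exact LinearEquiv.toFGModuleCatIso
      ((φ i.as).trans (Module.finBasis ℂ (G.obj i)).equivFun.symm)

lemma isSemisimpleCategory (h : IsSimpleBasis P) [Finite I]
    (hsum : ∀ (n : ℕ) (F : Fin n → C), ∃ X, IsDirectSum X F) : IsSemisimpleCategory C := by
  have := h.essSurj_multiplicity hsum
  have : h.multiplicity.IsEquivalence := {}
  have : HasFiniteBiproducts C := ⟨fun n => ⟨fun F => by
    obtain ⟨X, b, ⟨hb⟩, -⟩ := hsum n F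
    exact HasBiproduct.mk ⟨b, hb⟩⟩⟩
  -- The abelian structure is pulled back along the multiplicity functor and keeps the given
  -- addition of morphisms.
  refine ⟨⟨abelianOfEquivalence h.multiplicity, rfl⟩, fun X => ?_⟩
  obtain ⟨n, F, hF⟩ := h.exists_sum X
  exact ⟨n, fun j => P (F j), fun j => h.simple _, hF⟩

end Abelian

end IsSimpleBasis

end Semisimple

/-! ### The basic objects inside the full subcategory -/

section Main

variable {d : ℕ} [NeZero d]

lemma PT.isDirectSum {J : Type} [Finite J] {X : PT d} {F : J → PT d}
    (h : IsDirectSum X.obj fun j => (F j).obj) : IsDirectSum X F := by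
  have := Fintype.ofFinite J
  obtain ⟨ι, π, h1, h0, ht⟩ := h.exists_total
  refine .of_total (fun j => ObjectProperty.homMk (ι j)) (fun j => ObjectProperty.homMk (π j))
    (fun j => ObjectProperty.hom_ext _ (h1 j))
    (fun j k hjk => ObjectProperty.hom_ext _ (h0 j k hjk)) (ObjectProperty.hom_ext _ ?_)
  exact (map_sum ((isPT d).ι.mapAddHom (X := X) (Y := X)) _ _).trans ht

lemma PT.exists_isDirectSum (n : ℕ) (F : Fin n → PT d) : ∃ X, IsDirectSum X F := by
  obtain ⟨X, hX⟩ := HMF.exists_isDirectSum n fun j => (F j).obj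
  exact ⟨⟨X, isPT_of_isDirectSum hX fun j => (F j).property⟩, PT.isDirectSum hX⟩

lemma PT.isSimpleBasis : IsSimpleBasis fun p : ZMod d × Fin (d - 1) => PT.P d p.1 p.2 where
  hom_eq_zero hpq f := ObjectProperty.hom_ext _ (hom_hatPI_eq_zero hpq f.hom)
  exists_eq_smul p f := by
    obtain ⟨c, hc⟩ := exists_eq_smul_id_hatPI p.1 p.2 f.hom
    exact ⟨c, ObjectProperty.hom_ext _ hc⟩
  id_ne_zero p h := id_hatPI_ne_zero p.1 p.2 (congrArg (fun f => f.hom) h)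
  exists_sum X := by
    obtain ⟨n, F, hF⟩ := X.property
    exact ⟨n, F, PT.isDirectSum hF⟩

end Main
end LG

theorem theorem4p2 (d : ℕ) [NeZero d] (hd : 2 ≤ d) :
    LG.IsSemisimpleCategory (LG.PT d) ∧
    (∀ (a : ZMod d) (l : Fin (d - 1)),
      Simple (LG.PT.P d a l) ∧ ∀ f : LG.PT.P d a l ⟶ LG.PT.P d a l, ∃ c : ℂ, f = c • 𝟙 _) ∧
    (∀ X : LG.PT d, Simple X → ∃! p : ZMod d × Fin (d - 1), Nonempty (X ≅ LG.PT.P d p.1 p.2)) ∧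
    (∀ X Y : LG.HMF d, LG.isPT d X → LG.isPT d Y → LG.isPT d (X.tensor Y)) ∧
    (∀ (m n : ZMod d) (l k : Fin (d - 1)),
      LG.IsDirectSum ((LG.hatPI d m l).tensor (LG.hatPI d n k))
        fun ν : {ν : Fin (d - 1) // LG.Fusion d l k ν} =>
          LG.hatPI d (m + n + (((l : ℕ) + k - (ν.1 : ℕ)) / 2 : ℕ)) ν.1) := by
  have hP := LG.PT.isSimpleBasis (d := d)
  have : Finite (ZMod d) := inferInstance
  exact ⟨hP.isSemisimpleCategory LG.PT.exists_isDirectSum,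
    fun a l => ⟨hP.simple (a, l), hP.exists_eq_smul (a, l)⟩, hP.existsUnique_iso,
    fun _ _ hX hY => LG.isPT_tensor hd hX hY, LG.isDirectSum_tensor_hatPI hd⟩
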